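/- **Setting.** All objects are smooth; the result is local, so let $U\subset\mathbb R^4$ be open with a coframe $(\omega^0,\omega^1,\omega^2,\omega^3)$, and let the Cayley structure on $U$ be the conformal class of the cubic form $$\rho=\tfrac13(\omega^2)^3+\omega^0\omega^3\omega^3-\omega^1\omega^2\omega^3 .$$ Let $G$ be the group of matrices $$g=\begin{pmatrix} f_0&u&v&\frac{uv}{f_0}-\frac{u^3}{3f_0^2}\\ 0&f_0f_1&uf_1&vf_1\\ 0&0&f_0f_1^2&uf_1^2\\ 0&0&0&f_0f_1^3\end{pmatrix},\qquad f_0,f_1\neq0,$$ let $\mathcal P=U\times G$ be the bundle of adapted coframes, and write again $\omega^i$ for the lifted forms $(g^{-1})^i{}_j\,\omega^j$ on $\mathcal P$. There are unique 1-forms $\theta^1,\theta^2,\phi_0,\phi_1$ and functions $a_1,\dots,a_8$ on $\mathcal P$ such that $$\begin{aligned} d\omega^0&=-\phi_0\wedge\omega^0-\theta^2\wedge\omega^1-\theta^1\wedge\omega^2,\\ d\omega^1&=-(\phi_0+\phi_1)\wedge\omega^1-\theta^2\wedge\omega^2-\theta^1\wedge\omega^3,\\ d\omega^2&=-(\phi_0+2\phi_1)\wedge\omega^2-\theta^2\wedge\omega^3+a_7\,\omega^0\wedge\omega^1+a_2\,\omega^0\wedge\omega^3,\\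 d\omega^3&=-(\phi_0+3\phi_1)\wedge\omega^3+a_8\,\omega^0\wedge\omega^1+a_6\,\omega^0\wedge\omega^2+a_4\,\omega^0\wedge\omega^3+a_5\,\omega^1\wedge\omega^2+a_3\,\omega^1\wedge\omega^3+a_1\,\omega^2\wedge\omega^3, \end{aligned}$$ and $(\omega^0,\dots,\omega^3,\theta^1,\theta^2,\phi_0,\phi_1)$ is a coframe on $\mathcal P$. Let $(e_0,\dots,e_7)$ be the dual frame and put $f_{;k}=df(e_k)$, $b_{2ij}=d\theta^2(e_i,e_j)$, $b_{4ij}=d\phi_1(e_i,e_j)$. The Cayley structure is *half-flat* if, locally on the 5-dimensional space $J=\{(x,s): x\in U,\ s\in\mathbb R\}$ of ruling planes $\operatorname{Ker}\{\omega^0+s\,\omega^1-\frac13s^3\omega^3,\ \omega^2+s\,\omega^3\}\subset T_xU$ of the cone $\rho=0$, there is a 3-parameter family of surfaces tangent to ruling planes, exactly one through each point along each ruling plane; that is, locally there is a submersion of $J$ to $\mathbb R^3$ such that at each $(x,s)$ the tangent plane of its fibre is mapped isomorphically onto the ruling plane $(x,s)$ by the projection to $U$. A *path geometry* $(S,\ell_1,\ell_2)$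 is a 3-fold $S$ with line fields $\ell_1,\ell_2$ such that locally there is a coframe $(\eta^0,\eta^1,\zeta)$ with $\ell_1=\{\eta^1,\zeta\}^\perp$, $\ell_2=\{\eta^0,\eta^1\}^\perp$ and $d\eta^1\equiv-\eta^0\wedge\zeta$ mod $\eta^1$. It *arises from a projective structure* on the surface $Q$ of leaves of $\ell_2$ if there is a torsion-free linear connection on $Q$ such that the integral curves of $\ell_1$ are exactly the lifts to $S$ of its unparametrized geodesics. **Proposition.** Let the Cayley structure on $U$ be half-flat and $a_6=0$ on $\mathcal P$. Then: 1. The distribution $\operatorname{Ker}\{\omega^2,\omega^3\}$ on $U$ is null ($\rho$ vanishes on it) and integrable: through every point of $U$ there passes an integral surface. 2. Let $\sigma:W\to U$, with $W\subset\mathbb R^2$ open, be any (immersed) integral surface, so that $W\times G$ is an integral manifold of $\{\omega^2,\omega^3\}$ in $\mathcal P$ by means of $\sigma$. There the integral manifolds of the Pfaffian system $\{\omega^0,\omega^1,\theta^2\}$ are given by the fibres of $$W\times G\to S_{\mathsf{null}}=W\times\mathbb R,\qquad (w,g)\mapsto\Big(w,\frac{u}{f_0f_1}\Big),$$ the systems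 $\{\omega^0,\theta^2\}^\perp$ and $\{\omega^0,\omega^1\}^\perp$ descend to line fields $\ell_1$ and $\ell_2$ on $S_{\mathsf{null}}$, the triple $(S_{\mathsf{null}},\ell_1,\ell_2)$ is a path geometry, and it arises from a projective structure on the integral surface $W$. 3. There is an $\mathfrak{sl}_3(\mathbb R)$-valued 1-form $\psi=(\psi^i{}_j)_{0\le i,j\le2}$ on $\mathcal P$ with $\psi^2{}_0=\omega^0$, $\psi^1{}_0=\omega^1$, $\psi^2{}_1=\theta^2$, and there are functions $K_2,L_2$ on $\mathcal P$ such that on the integral manifolds of $\{\omega^2,\omega^3\}$ in $\mathcal P$ $$d\psi+\psi\wedge\psi=\begin{pmatrix}0&K_1\,\omega^0\wedge\omega^1&K_2\,\omega^0\wedge\omega^1+L_2\,\omega^0\wedge\theta^2\\0&0&L_1\,\omega^0\wedge\theta^2\\0&0&0\end{pmatrix},\qquad L_1=0,$$ $$\begin{aligned}K_1={}&-\tfrac{41}2a_2a_3a_4-\tfrac{133}6a_2a_3a_5-\tfrac56b_{201;0}+\tfrac16b_{401;1}-\tfrac54b_{402;0}+6a_2a_{4;1}-\tfrac14a_4b_{402}+\tfrac{17}6a_2b_{401}\\&+\tfrac53b_{201}a_5+\tfrac{22}3a_2a_{5;1}-\tfrac73a_3b_{401}+\tfrac{53}3a_2^2a_5+\tfrac74a_4b_{201}-4a_4a_{5;2}-\tfrac14a_5b_{402}\\&-4a_5a_{4;2}-4a_4a_{4;2}-4a_5a_{5;2}-\tfrac{53}{12}a_3a_{4;1}+15a_2^2a_4+7a_3^2a_4+7a_3^2a_5-\tfrac{29}6a_3a_{5;1}.\end{aligned}$$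 -/

import Mathlib

namespace CayleyGeom

/-! ### Differential 1-forms and their exterior derivatives on a normed space -/

section Forms

variable {V : Type*} [NormedAddCommGroup V] [NormedSpace ℝ V]

/-- The exterior derivative of a 1-form `α`, evaluated at `p` on the tangent vectors `X`, `Y`. -/
noncomputable def extd (α : V → V →L[ℝ] ℝ) (p : V) (X Y : V) : ℝ :=
  extDeriv (fun q => ContinuousAlternatingMap.ofSubsingleton ℝ V ℝ (0 : Fin 1) (α q)) p ![X, Y]

theorem extd_apply {α : V → V →L[ℝ] ℝ} {p : V} (h : DifferentiableAt ℝ α p) (X Y : V) :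
    extd α p X Y = fderiv ℝ α p X Y - fderiv ℝ α p Y X := by
  have h1 : HasFDerivAt
      (fun q => ContinuousAlternatingMap.ofSubsingleton ℝ V ℝ (0 : Fin 1) (α q))
      (((ContinuousAlternatingMap.ofSubsingletonLIE (𝕜 := ℝ) (E := V) (F := ℝ) (0 : Fin 1)).toContinuousLinearEquiv :
        (V →L[ℝ] ℝ) →L[ℝ] (V [⋀^Fin 1]→L[ℝ] ℝ)).comp (fderiv ℝ α p)) p :=
    ((ContinuousAlternatingMap.ofSubsingletonLIE (𝕜 := ℝ) (E := V) (F := ℝ) (0 : Fin 1)).toContinuousLinearEquiv :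
        (V →L[ℝ] ℝ) →L[ℝ] (V [⋀^Fin 1]→L[ℝ] ℝ)).hasFDerivAt.comp p h.hasFDerivAt
  have h2 : ∀ v : V, fderiv ℝ (fun q => α q v) p = (fderiv ℝ α p).flip v := by
    intro v
    ext w
    simp [fderiv_clm_apply h (differentiableAt_const v)]
  rw [extd, extDeriv_apply h1.differentiableAt]
  simp [Fin.sum_univ_two, Fin.removeNth, sub_eq_add_neg, h2]

/-- The wedge product of two covectors, evaluated on `X`, `Y`. -/
def wedge (α β : V →L[ℝ] ℝ) (X Y : V) : ℝ := α X * β Y - α Y * β X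

end Forms

/-! ### Cayley structures on an open set of `ℝ⁴` -/

abbrev E4 : Type := Fin 4 → ℝ

/-- `ω = (ω⁰, ω¹, ω², ω³)` is a smooth coframe on `U`. -/
def IsCoframeOn (U : Set E4) (ω : Fin 4 → E4 → E4 →L[ℝ] ℝ) : Prop :=
  (∀ i, ContDiffOn ℝ (⊤ : ℕ∞) (ω i) U) ∧ ∀ x ∈ U, LinearIndependent ℝ (fun i => ω i x)

/-- The cubic form `ρ = ⅓ (ω²)³ + ω⁰ ω³ ω³ - ω¹ ω² ω³`; its conformal class is the Cayley structure
with adapted coframe `ω`. -/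
noncomputable def cayleyCubic (ω : Fin 4 → E4 → E4 →L[ℝ] ℝ) (x X : E4) : ℝ :=
  1 / 3 * ω 2 x X ^ 3 + ω 0 x X * ω 3 x X ^ 2 - ω 1 x X * ω 2 x X * ω 3 x X

/-- The ruling planes `Ker {ω⁰ + u ω¹ - ⅓ u³ ω³, ω² + u ω³}`, `u ∈ ℝ`, of the cone `ρ = 0` in
the tangent space at `x`. -/
noncomputable def rulingPlane (ω : Fin 4 → E4 → E4 →L[ℝ] ℝ) (x : E4) (u : ℝ) : Submodule ℝ E4 :=
  LinearMap.ker (ω 0 x + u • ω 1 x - (u ^ 3 / 3) • ω 3 x).toLinearMap ⊓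
    LinearMap.ker (ω 2 x + u • ω 3 x).toLinearMap

/-- Half-flatness: there is (locally in the 5-dimensional space `J = {(x, u)}` of ruling planes) a
three-parameter family of surfaces such that through each point and along each ruling plane
there passes a unique member of the family, and the members are tangent to ruling planes.
The family is given by the submersion `τ` from `J` to its parameter space `ℝ³`: the member with
parameter `t` is the projection to `U` of the fibre `τ = t`, which consists of the pairs `(x, u)`
such that this member passes through `x` and has there the ruling plane of parameter `u`
as tangent plane. -/
def IsHalfFlat (U : Set E4) (ω : Fin 4 → E4 → E4 →L[ℝ] ℝ) : Prop :=
  ∀ x ∈ U, ∀ u : ℝ, ∃ (O : Set (E4 × ℝ)) (τ : E4 × ℝ → Fin 3 → ℝ),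
    IsOpen O ∧ (x, u) ∈ O ∧ ContDiffOn ℝ (⊤ : ℕ∞) τ O ∧
    ∀ q ∈ O, q.1 ∈ U ∧ Function.Surjective (fderiv ℝ τ q) ∧
      Submodule.map (LinearMap.fst ℝ E4 ℝ) (LinearMap.ker (fderiv ℝ τ q).toLinearMap) =
        rulingPlane ω q.1 q.2

/-- The plane `Ker {ω², ω³}` of the null distribution at `x`. -/
def nullPlane (ω : Fin 4 → E4 → E4 →L[ℝ] ℝ) (x : E4) : Submodule ℝ E4 :=
  LinearMap.ker (ω 2 x).toLinearMap ⊓ LinearMap.ker (ω 3 x).toLinearMap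

abbrev E2 : Type := Fin 2 → ℝ

/-- `σ : W → U` is a (parametrized, immersed) integral surface of `Ker {ω², ω³}`. -/
def IsIntegralSurface (U : Set E4) (ω : Fin 4 → E4 → E4 →L[ℝ] ℝ) (W : Set E2) (σ : E2 → E4) :
    Prop :=
  IsOpen W ∧ ContDiffOn ℝ (⊤ : ℕ∞) σ W ∧ Set.MapsTo σ W U ∧
    ∀ w ∈ W, LinearMap.range (fderiv ℝ σ w).toLinearMap = nullPlane ω (σ w)

/-! ### The bundle of adapted coframes, the structure forms and the invariants -/

/-- The ambient space of `P = U × G`; the second component is `(f₀, f₁, u, v)`. -/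
abbrev PSpace : Type := E4 × (Fin 4 → ℝ)

/-- The elements of the structure group, the group of linear maps that preserve the Cayley cubic
form up to a factor. -/
noncomputable def groupMatrix (g : Fin 4 → ℝ) : Matrix (Fin 4) (Fin 4) ℝ :=
  !![g 0, g 2, g 3, g 2 * g 3 / g 0 - g 2 ^ 3 / (3 * g 0 ^ 2);
     0, g 0 * g 1, g 2 * g 1, g 3 * g 1;
     0, 0, g 0 * g 1 ^ 2, g 2 * g 1 ^ 2;
     0, 0, 0, g 0 * g 1 ^ 3]

/-- The bundle `P` of adapted coframes over `U`, trivialized by `ω` as `U × G`. -/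
def adaptedBundle (U : Set E4) : Set PSpace := {p | p.1 ∈ U ∧ p.2 0 ≠ 0 ∧ p.2 1 ≠ 0}

/-- The lifted (tautological) coframe `g⁻¹ ω` on `P`. -/
noncomputable def liftedCoframe (ω : Fin 4 → E4 → E4 →L[ℝ] ℝ) (i : Fin 4) (p : PSpace) :
    PSpace →L[ℝ] ℝ :=
  ∑ j, (groupMatrix p.2)⁻¹ i j • (ω j p.1).comp (ContinuousLinearMap.fst ℝ E4 (Fin 4 → ℝ))

/-- The structure forms `θ¹, θ², φ₀, φ₁` and the torsion functions `a₁, …, a₈` on `P`, determined by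
the first order structure equations (absorption of torsion), together with the frame on `P`
dual to the coframe `(ω⁰, ω¹, ω², ω³, θ¹, θ², φ₀, φ₁)`. Here `ω⁰, …, ω³` are the lifted forms. -/
structure StructureForms (U : Set E4) (ω : Fin 4 → E4 → E4 →L[ℝ] ℝ) where
  θ₁ : PSpace → PSpace →L[ℝ] ℝ
  θ₂ : PSpace → PSpace →L[ℝ] ℝ
  φ₀ : PSpace → PSpace →L[ℝ] ℝ
  φ₁ : PSpace → PSpace →L[ℝ] ℝ
  a₁ : PSpace → ℝ
  a₂ : PSpace → ℝ
  a₃ : PSpace → ℝ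
  a₄ : PSpace → ℝ
  a₅ : PSpace → ℝ
  a₆ : PSpace → ℝ
  a₇ : PSpace → ℝ
  a₈ : PSpace → ℝ
  e : Fin 8 → PSpace → PSpace
  smooth_θ₁ : ContDiffOn ℝ (⊤ : ℕ∞) θ₁ (adaptedBundle U)
  smooth_θ₂ : ContDiffOn ℝ (⊤ : ℕ∞) θ₂ (adaptedBundle U)
  smooth_φ₀ : ContDiffOn ℝ (⊤ : ℕ∞) φ₀ (adaptedBundle U)
  smooth_φ₁ : ContDiffOn ℝ (⊤ : ℕ∞) φ₁ (adaptedBundle U)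
  smooth_a : ∀ f ∈ [a₁, a₂, a₃, a₄, a₅, a₆, a₇, a₈], ContDiffOn ℝ (⊤ : ℕ∞) f (adaptedBundle U)
  smooth_e : ∀ k, ContDiffOn ℝ (⊤ : ℕ∞) (e k) (adaptedBundle U)
  dω₀ : ∀ p ∈ adaptedBundle U, ∀ X Y, extd (liftedCoframe ω 0) p X Y =
    - wedge (φ₀ p) (liftedCoframe ω 0 p) X Y
    - wedge (θ₂ p) (liftedCoframe ω 1 p) X Y
    - wedge (θ₁ p) (liftedCoframe ω 2 p) X Y
  dω₁ : ∀ p ∈ adaptedBundle U, ∀ X Y, extd (liftedCoframe ω 1) p X Y =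
    - wedge (φ₀ p + φ₁ p) (liftedCoframe ω 1 p) X Y
    - wedge (θ₂ p) (liftedCoframe ω 2 p) X Y
    - wedge (θ₁ p) (liftedCoframe ω 3 p) X Y
  dω₂ : ∀ p ∈ adaptedBundle U, ∀ X Y, extd (liftedCoframe ω 2) p X Y =
    - wedge (φ₀ p + (2 : ℝ) • φ₁ p) (liftedCoframe ω 2 p) X Y
    - wedge (θ₂ p) (liftedCoframe ω 3 p) X Y
    + a₇ p * wedge (liftedCoframe ω 0 p) (liftedCoframe ω 1 p) X Y
    + a₂ p * wedge (liftedCoframe ω 0 p) (liftedCoframe ω 3 p) X Y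
  dω₃ : ∀ p ∈ adaptedBundle U, ∀ X Y, extd (liftedCoframe ω 3) p X Y =
    - wedge (φ₀ p + (3 : ℝ) • φ₁ p) (liftedCoframe ω 3 p) X Y
    + a₈ p * wedge (liftedCoframe ω 0 p) (liftedCoframe ω 1 p) X Y
    + a₆ p * wedge (liftedCoframe ω 0 p) (liftedCoframe ω 2 p) X Y
    + a₄ p * wedge (liftedCoframe ω 0 p) (liftedCoframe ω 3 p) X Y
    + a₅ p * wedge (liftedCoframe ω 1 p) (liftedCoframe ω 2 p) X Y
    + a₃ p * wedge (liftedCoframe ω 1 p) (liftedCoframe ω 3 p) X Y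
    + a₁ p * wedge (liftedCoframe ω 2 p) (liftedCoframe ω 3 p) X Y
  dual : ∀ p ∈ adaptedBundle U, ∀ i j : Fin 8,
    (![liftedCoframe ω 0 p, liftedCoframe ω 1 p, liftedCoframe ω 2 p, liftedCoframe ω 3 p,
      θ₁ p, θ₂ p, φ₀ p, φ₁ p] : Fin 8 → PSpace →L[ℝ] ℝ) i (e j p) = if i = j then 1 else 0

namespace StructureForms

variable {U : Set E4} {ω : Fin 4 → E4 → E4 →L[ℝ] ℝ} (F : StructureForms U ω)

/-- The coefficients `b₂ᵢⱼ` of the structure equation of `dθ²`. -/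
noncomputable def b₂ (i j : Fin 8) (p : PSpace) : ℝ := extd F.θ₂ p (F.e i p) (F.e j p)

/-- The coefficients `b₄ᵢⱼ` of the structure equation of `dφ₁`. -/
noncomputable def b₄ (i j : Fin 8) (p : PSpace) : ℝ := extd F.φ₁ p (F.e i p) (F.e j p)

/-- The coframe derivative `f_{;k}` of a function on `P`. -/
noncomputable def D (f : PSpace → ℝ) (k : Fin 8) (p : PSpace) : ℝ := fderiv ℝ f p (F.e k p)

/-- The function `K₁` in terms of the invariants of the Cayley structure. -/
noncomputable def K₁ (p : PSpace) : ℝ :=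
  - 41 / 2 * F.a₂ p * F.a₃ p * F.a₄ p - 133 / 6 * F.a₂ p * F.a₃ p * F.a₅ p
  - 5 / 6 * F.D (F.b₂ 0 1) 0 p + 1 / 6 * F.D (F.b₄ 0 1) 1 p - 5 / 4 * F.D (F.b₄ 0 2) 0 p
  + 6 * F.a₂ p * F.D F.a₄ 1 p - 1 / 4 * F.a₄ p * F.b₄ 0 2 p + 17 / 6 * F.a₂ p * F.b₄ 0 1 p
  + 5 / 3 * F.b₂ 0 1 p * F.a₅ p + 22 / 3 * F.a₂ p * F.D F.a₅ 1 p
  - 7 / 3 * F.a₃ p * F.b₄ 0 1 p + 53 / 3 * F.a₂ p ^ 2 * F.a₅ p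
  + 7 / 4 * F.a₄ p * F.b₂ 0 1 p - 4 * F.a₄ p * F.D F.a₅ 2 p - 1 / 4 * F.a₅ p * F.b₄ 0 2 p
  - 4 * F.a₅ p * F.D F.a₄ 2 p - 4 * F.a₄ p * F.D F.a₄ 2 p - 4 * F.a₅ p * F.D F.a₅ 2 p
  - 53 / 12 * F.a₃ p * F.D F.a₄ 1 p + 15 * F.a₂ p ^ 2 * F.a₄ p + 7 * F.a₃ p ^ 2 * F.a₄ p
  + 7 * F.a₃ p ^ 2 * F.a₅ p - 29 / 6 * F.a₃ p * F.D F.a₅ 1 p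

end StructureForms

/-! ### Path geometries on surfaces -/

/-- The model of the 3-folds that carry the path geometries. -/
abbrev E3 : Type := E2 × ℝ

/-- `(S, ℓ₁, ℓ₂)` is a path geometry (of surfaces): `S` is a 3-fold, and locally there is a coframe
`(η⁰, η¹, ζ)` with `ℓ₁ = {η¹, ζ}^⊥`, `ℓ₂ = {η⁰, η¹}^⊥` and `dη¹ ≡ - η⁰ ∧ ζ` modulo `η¹`. -/
def IsPathGeometry (S : Set E3) (ℓ₁ ℓ₂ : E3 → Submodule ℝ E3) : Prop :=
  IsOpen S ∧ ∀ s ∈ S, ∃ (O : Set E3) (η₀ η₁ ζ : E3 → E3 →L[ℝ] ℝ),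
    IsOpen O ∧ s ∈ O ∧ O ⊆ S ∧
    ContDiffOn ℝ (⊤ : ℕ∞) η₀ O ∧ ContDiffOn ℝ (⊤ : ℕ∞) η₁ O ∧ ContDiffOn ℝ (⊤ : ℕ∞) ζ O ∧
    ∀ q ∈ O, LinearIndependent ℝ ![η₀ q, η₁ q, ζ q] ∧
      ℓ₁ q = LinearMap.ker (η₁ q).toLinearMap ⊓ LinearMap.ker (ζ q).toLinearMap ∧
      ℓ₂ q = LinearMap.ker (η₀ q).toLinearMap ⊓ LinearMap.ker (η₁ q).toLinearMap ∧
      ∀ X Y, η₁ q X = 0 → η₁ q Y = 0 → extd η₁ q X Y = - wedge (η₀ q) (ζ q) X Y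

/-- At the parameter `t` the curve `γ` satisfies the equation of unparametrized geodesics,
`∇_{γ'} γ' ∈ ℝ γ'`, of the linear connection with Christoffel symbols `Γᵏᵢⱼ = Γ · k i j`. -/
def IsUnparamGeodesicAt (Γ : E2 → Fin 2 → Fin 2 → Fin 2 → ℝ) (γ : ℝ → E2) (t : ℝ) : Prop :=
  ∃ c : ℝ, ∀ k, deriv (deriv γ) t k
    + ∑ i, ∑ j, Γ (γ t) k i j * deriv γ t i * deriv γ t j = c * deriv γ t k

/-- The path geometry `(W × ℝ, ℓ₁, ℓ₂)` arises from a projective structure on the surface `W`: there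
is a torsion-free linear connection on `W` such that an immersed contact curve of `W × ℝ`
(a curve tangent to `ℓ₁ ⊕ ℓ₂` and nowhere to `ℓ₂`, that is the lift of an immersed curve of `W`)
is an integral curve of `ℓ₁` exactly if its projection to `W` is an unparametrized geodesic. -/
def ArisesFromProjectiveStructure (W : Set E2) (ℓ₁ ℓ₂ : E3 → Submodule ℝ E3) : Prop :=
  ∃ Γ : E2 → Fin 2 → Fin 2 → Fin 2 → ℝ,
    ContDiffOn ℝ (⊤ : ℕ∞) Γ W ∧ (∀ w ∈ W, ∀ k i j, Γ w k i j = Γ w k j i) ∧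
    ∀ (I : Set ℝ) (c : ℝ → E3), IsOpen I → ContDiffOn ℝ (⊤ : ℕ∞) c I →
      (∀ t ∈ I, (c t).1 ∈ W ∧ deriv c t ∈ ℓ₁ (c t) ⊔ ℓ₂ (c t) ∧ deriv c t ∉ ℓ₂ (c t)) →
      ∀ t ∈ I, (deriv c t ∈ ℓ₁ (c t) ↔ IsUnparamGeodesicAt Γ (fun s => (c s).1) t)

/-- The components of the normalized curvature of the Cartan connection of a path geometry. -/
def pathCurvature {V : Type*} [NormedAddCommGroup V] [NormedSpace ℝ V]
    (π₀ π₁ π₂ : V →L[ℝ] ℝ) (K₁ K₂ L₁ L₂ : ℝ) (X Y : V) : Matrix (Fin 3) (Fin 3) ℝ :=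
  !![0, K₁ * wedge π₀ π₁ X Y, K₂ * wedge π₀ π₁ X Y + L₂ * wedge π₀ π₂ X Y;
     0, 0, L₁ * wedge π₀ π₂ X Y;
     0, 0, 0]

/-- `ψ` is a smooth `𝔰𝔩₃(ℝ)`-valued 1-form on `P` with soldering entries `π⁰, π¹, π²` which, on the
leaves of the (integrable) distribution `T`, is a Cartan connection form of a path geometry, i.e. its
curvature `Ψ = dψ + ψ ∧ ψ` has the normalized form with curvature functions `K₁, K₂, L₁, L₂`. -/
structure IsPathCartanForm {V : Type*} [NormedAddCommGroup V] [NormedSpace ℝ V]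
    (P : Set V) (T : V → Submodule ℝ V) (π₀ π₁ π₂ : V → V →L[ℝ] ℝ)
    (ψ : Fin 3 → Fin 3 → V → V →L[ℝ] ℝ) (K₁ K₂ L₁ L₂ : V → ℝ) : Prop where
  smooth : ∀ i j, ContDiffOn ℝ (⊤ : ℕ∞) (ψ i j) P
  trace : ∀ p ∈ P, ψ 0 0 p + ψ 1 1 p + ψ 2 2 p = 0
  solder : ∀ p ∈ P, ψ 2 0 p = π₀ p ∧ ψ 1 0 p = π₁ p ∧ ψ 2 1 p = π₂ p
  curvature : ∀ p ∈ P, ∀ X ∈ T p, ∀ Y ∈ T p, ∀ i j,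
    extd (ψ i j) p X Y + ∑ k, wedge (ψ i k p) (ψ k j p) X Y =
      pathCurvature (π₀ p) (π₁ p) (π₂ p) (K₁ p) (K₂ p) (L₁ p) (L₂ p) X Y i j

/-! ### The path geometry on the null surfaces -/

/-- Over an integral surface parametrized by `W`, the leaf of `{ω², ω³}` in `P` is `W × G`; this is
its projection to the leaf space `S = W × ℝ` of the Pfaffian system `{ω⁰, ω¹, θ²}`. -/
noncomputable def leafProj (n : E2 × (Fin 4 → ℝ)) : E3 := (n.1, n.2 2 / (n.2 0 * n.2 1))

/-- `ℓ₁` and `ℓ₂` are the line fields that `{ω⁰, θ²}^⊥` and `{ω⁰, ω¹}^⊥` induce on the leaf space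
`S = W × ℝ` of the Pfaffian system `{ω⁰, ω¹, θ²}` on the leaf of `{ω², ω³}` over the integral
surface `σ`. The first clause says that the fibres of `leafProj` are integral manifolds of
`{ω⁰, ω¹, θ²}`. The vector `Z` is the tangent vector of `P` that corresponds to `X`. -/
def IsNullPathGeometry {U : Set E4} {ω : Fin 4 → E4 → E4 →L[ℝ] ℝ} (F : StructureForms U ω)
    (W : Set E2) (σ : E2 → E4) (ℓ₁ ℓ₂ : E3 → Submodule ℝ E3) : Prop :=
  ∀ w ∈ W, ∀ g : Fin 4 → ℝ, g 0 ≠ 0 → g 1 ≠ 0 → ∀ X : E2 × (Fin 4 → ℝ),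
    let p : PSpace := (σ w, g)
    let Z : PSpace := (fderiv ℝ σ w X.1, X.2)
    (fderiv ℝ leafProj (w, g) X = 0 ↔
      liftedCoframe ω 0 p Z = 0 ∧ liftedCoframe ω 1 p Z = 0 ∧ F.θ₂ p Z = 0) ∧
    (fderiv ℝ leafProj (w, g) X ∈ ℓ₁ (leafProj (w, g)) ↔
      liftedCoframe ω 0 p Z = 0 ∧ F.θ₂ p Z = 0) ∧
    (fderiv ℝ leafProj (w, g) X ∈ ℓ₂ (leafProj (w, g)) ↔
      liftedCoframe ω 0 p Z = 0 ∧ liftedCoframe ω 1 p Z = 0)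

/-- The tangent spaces of the leaves of `{ω², ω³}` in `P`. -/
noncomputable def leafTangent (ω : Fin 4 → E4 → E4 →L[ℝ] ℝ) (p : PSpace) : Submodule ℝ PSpace :=
  LinearMap.ker (liftedCoframe ω 2 p).toLinearMap ⊓
    LinearMap.ker (liftedCoframe ω 3 p).toLinearMap

end CayleyGeom

open CayleyGeom

/-!
The coframe `(ω⁰, ω¹, ω², ω³, θ¹, θ², φ₀, φ₁)` makes exterior calculus on the bundle `P` of adapted
coframes a piece of algebra: the smooth functions on `P` form a commutative algebra with eight
derivations `D k`, the structure functions `T i j k = dηⁱ(eⱼ, eₖ)` give the commutators of the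
derivations, and `d(dηⁱ) = 0` is a cyclic identity (`FrameCalculus`, `frameCalculus`). All identities
between invariants are derived in this algebra.

The structure equations prescribe `dω⁰, …, dω³`. Evaluated on vertical vectors, `d(dωⁱ) = 0`
determines the vertical parts of `dθ¹, dθ², dφ₀, dφ₁` and the vertical derivatives of the torsion
functions (`T_four_mixed`, `fibre_derivatives` and the lemmas between them). In particular `a₆ = 0`
implies `a₈ = 0`. Half-flatness says that the common kernel of `ω⁰, ω², θ²` on `P` is tangent to the
fibres of a submersion, hence `dθ²(e₁, e₃) = 0` (`extd_theta₂_eq_zero`). The derivatives of this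
identity along the fibre direction `e₅` form a chain (`halfFlat_one` to `halfFlat_six`), whose end is
`a₇² = 0` (`a₇_sq_eq_zero`).

With `a₇ = a₈ = 0` the null distribution `Ker {ω², ω³}` is involutive. It has integral surfaces by the
Frobenius theorem, which is proved here for total differential equations `df = L(a, f)` by solving
ordinary differential equations along segments (`exists_total_differential_solution`).

Over an integral surface with coordinate `s = u / (f₀ f₁)` on its directions, `ω⁰` is a multiple of the
contact form `α⁰ - s α¹`, and modulo `ω⁰` the form `θ²` is a multiple of `ds + B(s) α¹` with `B` a cubic
polynomial in `s` (`theta₂_eq`, `exists_nullPathGeometry`). Second order equations that are cubic in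
the slope are those of the unparametrized geodesics of connections
(`arisesFromProjectiveStructure_of_coframe`).

The remaining relations of half-flatness and `d(dωⁱ) = 0` on the leaves of `{ω², ω³}` are solved for the
horizontal derivatives that occur (`leaf_relations`). With them the curvature of an explicit
`𝔰𝔩₃`-valued form is computed (`cartanForm`, `curvature_cartanForm_of_lt`, `pathK₁_eq`).
-/

namespace CayleyGeom

/-! ### Calculus in a moving frame -/

section Frame

/-- The differential calculus of a moving frame `(eᵢ)` with dual coframe `(ηⁱ)`: a commutative algebra
(of functions), the derivations `D i = eᵢ`, and the structure functions `T i j k = dηⁱ(eⱼ, eₖ)`,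
subject to the commutation relations of the frame and to `d(dηⁱ) = 0`. -/
structure FrameCalculus (ι A : Type*) [Fintype ι] [CommRing A] [Algebra ℝ A] where
  D : ι → Derivation ℝ A A
  T : ι → ι → ι → A
  skew : ∀ i j k, T i j k = - T i k j
  comm : ∀ j k f, D j (D k f) = D k (D j f) - ∑ i, T i j k * D i f
  bianchi : ∀ i j k l, D j (T i k l) + D k (T i l j) + D l (T i j k)
    + ∑ m, (T i m l * T m j k + T i m j * T m k l + T i m k * T m l j) = 0

variable {V : Type*} [NormedAddCommGroup V] [NormedSpace ℝ V]

/-- A function on the set `P`, extended by zero. -/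
noncomputable def zeroExtend {P : Set V} (f : P → ℝ) : V → ℝ := Function.extend Subtype.val f 0

omit [NormedAddCommGroup V] [NormedSpace ℝ V] in
theorem zeroExtend_coe {P : Set V} (f : P → ℝ) (p : P) : zeroExtend f p = f p :=
  Subtype.val_injective.extend_apply f 0 p

omit [NormedAddCommGroup V] [NormedSpace ℝ V] in
theorem zeroExtend_eqOn {P : Set V} (f : V → ℝ) : Set.EqOn (zeroExtend fun p : P => f p) f P :=
  fun p hp => zeroExtend_coe (fun p : P => f p) ⟨p, hp⟩

omit [NormedAddCommGroup V] [NormedSpace ℝ V] in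
theorem zeroExtend_of_notMem {P : Set V} {p : V} (hp : p ∉ P) (f : P → ℝ) : zeroExtend f p = 0 :=
  Function.extend_apply' _ _ _ (by rintro ⟨q, rfl⟩; exact hp q.2)

/-- The algebra of smooth functions on `P`. They are encoded as functions on the subtype `P`, so that
an identity that holds on `P` only is an equality of elements; smoothness refers to the extension by zero. -/
def SmoothFun (P : Set V) : Subalgebra ℝ (P → ℝ) where
  carrier := {f | ContDiffOn ℝ (⊤ : ℕ∞) (zeroExtend f) P}
  mul_mem' {f g} hf hg := (ContDiffOn.mul hf hg).congr fun p hp => by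
    simp [zeroExtend_coe _ ⟨p, hp⟩]
  add_mem' {f g} hf hg := (ContDiffOn.add hf hg).congr fun p hp => by
    simp [zeroExtend_coe _ ⟨p, hp⟩]
  algebraMap_mem' r := (contDiffOn_const (c := r)).congr (zeroExtend_eqOn fun _ => r)

variable {P : Set V}

/-- The restriction to `P` of a function that is smooth on `P`. -/
noncomputable def SmoothFun.mk (f : V → ℝ) (hf : ContDiffOn ℝ (⊤ : ℕ∞) f P) : SmoothFun P :=
  ⟨fun p => f p, hf.congr (zeroExtend_eqOn f)⟩

@[simp] theorem SmoothFun.mk_apply (f : V → ℝ) (hf : ContDiffOn ℝ (⊤ : ℕ∞) f P) (p : P) :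
    (SmoothFun.mk f hf).1 p = f p := rfl

theorem smoothFun_differentiableAt (hP : IsOpen P) (f : SmoothFun P) (p : P) :
    DifferentiableAt ℝ (zeroExtend f.1) p :=
  (f.2.contDiffAt (hP.mem_nhds p.2)).differentiableAt (by simp)

theorem contDiffOn_fderiv_apply {F : Type*} [NormedAddCommGroup F] [NormedSpace ℝ F]
    (hP : IsOpen P) {f : V → F} {X : V → V} (hf : ContDiffOn ℝ (⊤ : ℕ∞) f P)
    (hX : ContDiffOn ℝ (⊤ : ℕ∞) X P) :
    ContDiffOn ℝ (⊤ : ℕ∞) (fun p => fderiv ℝ f p (X p)) P :=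
  (hf.fderiv_of_isOpen hP (by simp)).clm_apply hX

omit [NormedAddCommGroup V] [NormedSpace ℝ V] in
theorem zeroExtend_mul (f g : P → ℝ) : zeroExtend (f * g) = zeroExtend f * zeroExtend g := by
  ext p
  by_cases hp : p ∈ P
  · simp [zeroExtend_coe _ ⟨p, hp⟩]
  · simp [zeroExtend_of_notMem hp]

omit [NormedAddCommGroup V] [NormedSpace ℝ V] in
theorem zeroExtend_add (f g : P → ℝ) : zeroExtend (f + g) = zeroExtend f + zeroExtend g := by
  ext p
  by_cases hp : p ∈ P
  · simp [zeroExtend_coe _ ⟨p, hp⟩]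
  · simp [zeroExtend_of_notMem hp]

omit [NormedAddCommGroup V] [NormedSpace ℝ V] in
theorem zeroExtend_smul (r : ℝ) (f : P → ℝ) : zeroExtend (r • f) = r • zeroExtend f := by
  ext p
  by_cases hp : p ∈ P
  · simp [zeroExtend_coe _ ⟨p, hp⟩]
  · simp [zeroExtend_of_notMem hp]

/-- A smooth vector field on the open set `P`, as a derivation of the smooth functions on `P`. -/
noncomputable def vectorFieldDerivation (hP : IsOpen P) (X : V → V)
    (hX : ContDiffOn ℝ (⊤ : ℕ∞) X P) : Derivation ℝ (SmoothFun P) (SmoothFun P) :=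
  Derivation.mk'
    { toFun := fun f => SmoothFun.mk (fun p => fderiv ℝ (zeroExtend f.1) p (X p))
        (contDiffOn_fderiv_apply hP f.2 hX)
      map_add' := fun f g => by
        ext p
        simp [zeroExtend_add, fderiv_add (smoothFun_differentiableAt hP f p) (smoothFun_differentiableAt hP g p)]
      map_smul' := fun r f => by
        ext p
        simp [zeroExtend_smul, fderiv_const_smul (smoothFun_differentiableAt hP f p)] }
    fun f g => by
      ext p
      simp [zeroExtend_mul, fderiv_mul (smoothFun_differentiableAt hP f p) (smoothFun_differentiableAt hP g p),
        zeroExtend_coe]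

theorem vectorFieldDerivation_apply (hP : IsOpen P) {X : V → V} (hX : ContDiffOn ℝ (⊤ : ℕ∞) X P)
    (f : SmoothFun P) (p : P) :
    (vectorFieldDerivation hP X hX f).1 p = fderiv ℝ (zeroExtend f.1) p (X p) := rfl

theorem vectorFieldDerivation_mk (hP : IsOpen P) {X : V → V} (hX : ContDiffOn ℝ (⊤ : ℕ∞) X P)
    {f : V → ℝ} (hf : ContDiffOn ℝ (⊤ : ℕ∞) f P) (p : P) :
    (vectorFieldDerivation hP X hX (SmoothFun.mk f hf)).1 p = fderiv ℝ f p (X p) := by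
  have h : zeroExtend (SmoothFun.mk f hf).1 =ᶠ[nhds (p : V)] f :=
    (zeroExtend_eqOn f).eventuallyEq_of_mem (hP.mem_nhds p.2)
  rw [vectorFieldDerivation_apply, h.fderiv_eq]

theorem extd_contDiffOn (hP : IsOpen P) {α : V → V →L[ℝ] ℝ} {X Y : V → V}
    (hα : ContDiffOn ℝ (⊤ : ℕ∞) α P) (hX : ContDiffOn ℝ (⊤ : ℕ∞) X P)
    (hY : ContDiffOn ℝ (⊤ : ℕ∞) Y P) :
    ContDiffOn ℝ (⊤ : ℕ∞) (fun p => extd α p (X p) (Y p)) P :=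
  (((contDiffOn_fderiv_apply hP hα hX).clm_apply hY).sub
    ((contDiffOn_fderiv_apply hP hα hY).clm_apply hX)).congr fun p hp =>
      extd_apply ((hα.contDiffAt (hP.mem_nhds hp)).differentiableAt (by simp)) _ _

/-- Cartan's formula for a 1-form that is constant on the two vector fields. -/
theorem extd_eq_neg_lieBracket {α : V → V →L[ℝ] ℝ} {X Y : V → V} {p : V} {a b : ℝ}
    (hα : DifferentiableAt ℝ α p) (hX : DifferentiableAt ℝ X p) (hY : DifferentiableAt ℝ Y p)
    (ha : ∀ᶠ q in nhds p, α q (X q) = a) (hb : ∀ᶠ q in nhds p, α q (Y q) = b) :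
    extd α p (X p) (Y p) = - α p (VectorField.lieBracket ℝ X Y p) := by
  have key : ∀ {Z W : V → V} {c : ℝ}, DifferentiableAt ℝ Z p →
      (∀ᶠ q in nhds p, α q (Z q) = c) → fderiv ℝ α p (W p) (Z p) = - α p (fderiv ℝ Z p (W p)) := by
    intro Z W c hZ hc
    have h1 : fderiv ℝ (fun q => α q (Z q)) p = 0 := by
      rw [Filter.EventuallyEq.fderiv_eq (f₁ := fun q => α q (Z q)) (f := fun _ => c) hc]
      simp
    rw [fderiv_clm_apply hα hZ] at h1
    have h2 := congrArg (fun L : V →L[ℝ] ℝ => L (W p)) h1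
    simp at h2
    linarith
  rw [extd_apply hα, key (W := X) hY hb, key (W := Y) hX ha, VectorField.lieBracket, map_sub]
  ring

variable {ι : Type*} [Fintype ι] [DecidableEq ι]

/-- In the dimension of the space, dual families are bases. -/
theorem dual_frame_expand [FiniteDimensional ℝ V] (hι : Module.finrank ℝ V = Fintype.card ι)
    {η : ι → V →L[ℝ] ℝ} {e : ι → V} (h : ∀ i j, η i (e j) = if i = j then 1 else 0) (X : V) :
    X = ∑ i, η i X • e i := by
  have hli : LinearIndependent ℝ e := by
    rw [Fintype.linearIndependent_iff]
    intro c hc i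
    have := congrArg (η i) hc
    simpa [map_sum, h] using this
  have hspan := hli.span_eq_top_of_card_eq_finrank' hι.symm
  obtain ⟨c, rfl⟩ := (Submodule.mem_span_range_iff_exists_fun ℝ).1
    (show X ∈ Submodule.span ℝ (Set.range e) by rw [hspan]; trivial)
  simp [map_sum, h]

/-- The calculus of a smooth moving frame on an open set. The identity `d(dηⁱ) = 0` is obtained as the
Jacobi identity of the frame. -/
noncomputable def frameCalculus [FiniteDimensional ℝ V] (hP : IsOpen P)
    (hι : Module.finrank ℝ V = Fintype.card ι) (η : ι → V → V →L[ℝ] ℝ) (e : ι → V → V)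
    (hη : ∀ i, ContDiffOn ℝ (⊤ : ℕ∞) (η i) P) (he : ∀ i, ContDiffOn ℝ (⊤ : ℕ∞) (e i) P)
    (dual : ∀ p ∈ P, ∀ i j, η i p (e j p) = if i = j then 1 else 0) :
    FrameCalculus ι (SmoothFun P) :=
  let D := fun k => vectorFieldDerivation hP (e k) (he k)
  let T := fun i j k => SmoothFun.mk (fun p => extd (η i) p (e j p) (e k p))
        (extd_contDiffOn hP (hη i) (he j) (he k))
  have hdη : ∀ i, ∀ p ∈ P, DifferentiableAt ℝ (η i) p := fun i p hp =>
    ((hη i).contDiffAt (hP.mem_nhds hp)).differentiableAt (by simp)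
  have hde : ∀ i, ∀ p ∈ P, DifferentiableAt ℝ (e i) p := fun i p hp =>
    ((he i).contDiffAt (hP.mem_nhds hp)).differentiableAt (by simp)
  have skew : ∀ i j k, T i j k = - T i k j := fun i j k => by
    ext p
    simp [T, extd_apply (hdη i p p.2)]
  have comm : ∀ j k f, D j (D k f) = D k (D j f) - ∑ i, T i j k * D i f := fun j k f => by
    ext p
    have hf : ContDiffAt ℝ (⊤ : ℕ∞) (zeroExtend f.1) (p : V) := f.2.contDiffAt (hP.mem_nhds p.2)
    have h1 := VectorField.fderiv_apply_lieBracket (n := 2) (hf.of_le (WithTop.coe_le_coe.2 (le_top : (2 : ℕ∞) ≤ ⊤))) (by simp)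
      (hde k p p.2) (hde j p p.2)
    have h2 : ∀ a b, (D a (D b f)).1 p
        = fderiv ℝ (fun x => fderiv ℝ (zeroExtend f.1) x (e b x)) p (e a p) := fun a b =>
      vectorFieldDerivation_mk hP (he a) (contDiffOn_fderiv_apply hP f.2 (he b)) p
    rw [dual_frame_expand hι (dual p p.2) (VectorField.lieBracket ℝ (e j) (e k) p)] at h1
    have h3 : ∀ i, η i p (VectorField.lieBracket ℝ (e j) (e k) p)
        = - extd (η i) p (e j p) (e k p) := fun i => by
      rw [extd_eq_neg_lieBracket (hdη i p p.2) (hde j p p.2) (hde k p p.2)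
        (Filter.eventually_of_mem (hP.mem_nhds p.2) fun q hq => dual q hq i j)
        (Filter.eventually_of_mem (hP.mem_nhds p.2) fun q hq => dual q hq i k), neg_neg]
    simp only [h3, map_sum, map_smul, smul_eq_mul, neg_mul, Finset.sum_neg_distrib] at h1
    have h4 : ∀ i, (T i j k * D i f).1 p
        = extd (η i) p (e j p) (e k p) * fderiv ℝ (zeroExtend f.1) p (e i p) := fun i => rfl
    have h5 : (D k (D j f) - ∑ i, T i j k * D i f).1 p
        = (D k (D j f)).1 p - ∑ i, (T i j k * D i f).1 p := by
      simp
    rw [h5, h2, h2, Finset.sum_congr rfl fun i _ => h4 i]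
    linarith
  { D := D
    T := T
    skew := skew
    comm := comm
    bianchi := fun i j k l => by
      set c : ι → SmoothFun P := fun i => D j (T i k l) + D k (T i l j) + D l (T i j k)
        + ∑ m, (T i m l * T m j k + T i m j * T m k l + T i m k * T m l j) with hc
      -- the Jacobi identity for `D j`, `D k`, `D l`, applied to `f`
      have h0 : ∀ f, ∑ i, c i * D i f = 0 := by
        intro f
        have hs : ∀ a b, D a (D b f) - D b (D a f) = - ∑ i, T i a b * D i f := fun a b => by
          rw [comm a b f]; ring
        have hd : ∀ a b d, D a (D b (D d f)) - D a (D d (D b f))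
            = - ∑ i, (D a (T i b d) * D i f + T i b d * D a (D i f)) := fun a b d => by
          rw [← map_sub, hs, map_neg, map_sum]
          simp only [Derivation.leibniz, smul_eq_mul]
          congr 1
          exact Finset.sum_congr rfl fun i _ => by ring
        have hb : ∀ a b d, D a (D b (D d f)) - D b (D a (D d f))
            = - ∑ i, T i a b * D i (D d f) := fun a b d => by
          rw [comm a b (D d f)]; ring
        have hsum : ∀ a b d, ∑ m, T m a b * (D d (D m f) - D m (D d f))
            = ∑ i, (∑ m, T i m d * T m a b) * D i f := fun a b d => by
          simp only [hs, Finset.sum_mul, Finset.mul_sum, ← Finset.sum_neg_distrib]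
          rw [Finset.sum_comm]
          refine Finset.sum_congr rfl fun i _ => Finset.sum_congr rfl fun m _ => ?_
          rw [skew i m d]
          ring
        have e1 := hd j k l
        have e2 := hd k l j
        have e3 := hd l j k
        have e4 := hb j k l
        have e5 := hb k l j
        have e6 := hb l j k
        have e7 := hsum j k l
        have e8 := hsum k l j
        have e9 := hsum l j k
        simp only [mul_sub, Finset.sum_sub_distrib, Finset.sum_add_distrib] at e1 e2 e3 e7 e8 e9
        simp only [hc, add_mul, Finset.sum_add_distrib]
        linear_combination e1 + e2 + e3 - e4 - e5 - e6 - e7 - e8 - e9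
      ext p
      -- the linear functions `f = L` separate the frame vectors
      have h1 : ∀ L : V →L[ℝ] ℝ, L (∑ i, (c i).1 p • e i p) = 0 := by
        intro L
        have h2 : ∀ i, (D i (SmoothFun.mk L L.contDiff.contDiffOn)).1 p = L (e i p) := fun i => by
          rw [vectorFieldDerivation_mk, ContinuousLinearMap.fderiv]
        have h3 := congrArg (fun F : SmoothFun P => F.1 p) (h0 (SmoothFun.mk L L.contDiff.contDiffOn))
        simpa [h2] using h3
      have h4 := h1 (η i p)
      change (c i).1 p = 0
      simpa [dual p p.2] using h4 }

end Frame

/-! ### The structure equations of a Cayley structure -/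

section Algebra

variable {A : Type*} [CommRing A] [Algebra ℝ A]

/-- The value of `ηᵃ ∧ ηᵇ` on `(eⱼ, eₖ)`. -/
def dualWedge (a b j k : Fin 8) : A :=
  (if j = a then 1 else 0) * (if k = b then 1 else 0)
    - (if k = a then 1 else 0) * (if j = b then 1 else 0)

theorem derivation_ofNat (D : Derivation ℝ A A) (n : ℕ) [n.AtLeastTwo] :
    D (ofNat(n) : A) = 0 :=
  D.map_natCast n

/-- The calculus of the coframe `(ω⁰, ω¹, ω², ω³, θ¹, θ², φ₀, φ₁)` of a Cayley structure: the indices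
`0, …, 7` refer to these forms in this order. -/
structure CayleyCalculus (A : Type*) [CommRing A] [Algebra ℝ A] extends
    FrameCalculus (Fin 8) A where
  (a₁ a₂ a₃ a₄ a₅ a₆ a₇ a₈ : A)
  T_zero : ∀ j k, T 0 j k = - dualWedge 6 0 j k - dualWedge 5 1 j k - dualWedge 4 2 j k
  T_one : ∀ j k, T 1 j k = - dualWedge 6 1 j k - dualWedge 7 1 j k - dualWedge 5 2 j k
    - dualWedge 4 3 j k
  T_two : ∀ j k, T 2 j k = - dualWedge 6 2 j k - 2 * dualWedge 7 2 j k - dualWedge 5 3 j k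
    + a₇ * dualWedge 0 1 j k + a₂ * dualWedge 0 3 j k
  T_three : ∀ j k, T 3 j k = - dualWedge 6 3 j k - 3 * dualWedge 7 3 j k
    + a₈ * dualWedge 0 1 j k + a₆ * dualWedge 0 2 j k + a₄ * dualWedge 0 3 j k
    + a₅ * dualWedge 1 2 j k + a₃ * dualWedge 1 3 j k + a₁ * dualWedge 2 3 j k

/-- The oriented form of `skew`, for use as a rewrite rule that terminates. -/
theorem FrameCalculus.skew_of_lt (C : FrameCalculus (Fin 8) A) {j k : Fin 8} (_ : k < j)
    (i : Fin 8) : C.T i j k = - C.T i k j :=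
  C.skew i j k

/-- The oriented form of `comm`: it moves the derivatives with the smaller index to the left. -/
theorem FrameCalculus.comm_of_lt (C : FrameCalculus (Fin 8) A) {j k : Fin 8} (_ : k < j) (f : A) :
    C.D j (C.D k f) = C.D k (C.D j f) - ∑ i, C.T i j k * C.D i f :=
  C.comm j k f

theorem FrameCalculus.T_self (C : FrameCalculus (Fin 8) A) (i j : Fin 8) : C.T i j j = 0 := by
  have h := congrArg ((1 / 2 : ℝ) • ·) (add_eq_zero_iff_eq_neg.2 (C.skew i j j))
  linear_combination (norm := algebra) h

/-- `a₈` is the derivative of `a₆` along the fibre direction `e₅`. -/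
theorem CayleyCalculus.a₈_eq_zero (C : CayleyCalculus A) (h : C.a₆ = 0) : C.a₈ = 0 := by
  have h1 := C.bianchi 3 0 2 5
  simp [Fin.sum_univ_eight, C.T_zero, C.T_one, C.T_two, C.T_three, dualWedge, h] at h1
  exact h1

/-- The calculus of a Cayley structure with `a₆ = 0`. -/
structure NullCalculus (A : Type*) [CommRing A] [Algebra ℝ A] extends
    FrameCalculus (Fin 8) A where
  (a₁ a₂ a₃ a₄ a₅ a₇ : A)
  T_zero : ∀ j k, T 0 j k = - dualWedge 6 0 j k - dualWedge 5 1 j k - dualWedge 4 2 j k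
  T_one : ∀ j k, T 1 j k = - dualWedge 6 1 j k - dualWedge 7 1 j k - dualWedge 5 2 j k
    - dualWedge 4 3 j k
  T_two : ∀ j k, T 2 j k = - dualWedge 6 2 j k - 2 * dualWedge 7 2 j k - dualWedge 5 3 j k
    + a₇ * dualWedge 0 1 j k + a₂ * dualWedge 0 3 j k
  T_three : ∀ j k, T 3 j k = - dualWedge 6 3 j k - 3 * dualWedge 7 3 j k
    + a₄ * dualWedge 0 3 j k + a₅ * dualWedge 1 2 j k + a₃ * dualWedge 1 3 j k
    + a₁ * dualWedge 2 3 j k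

namespace NullCalculus

variable (C : NullCalculus A)

theorem le_four_cases {v : Fin 8} (hv : 4 ≤ v) : v = 4 ∨ v = 5 ∨ v = 6 ∨ v = 7 := by
  revert v; decide

theorem lt_four_cases {j : Fin 8} (hj : j < 4) : j = 0 ∨ j = 1 ∨ j = 2 ∨ j = 3 := by
  revert j; decide

attribute [local simp] Fin.sum_univ_eight T_zero T_one T_two T_three dualWedge
  FrameCalculus.skew_of_lt FrameCalculus.T_self derivation_ofNat

/-! ### The vertical parts of the structure equations -/

/-- The fibres of the bundle carry the structure equations of the structure group: the vertical parts
of `dθ¹, dθ², dφ₀, dφ₁` are determined by `d(dωⁱ) = 0`, evaluated on one horizontal vector and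
two vertical vectors. -/
theorem T_six_fibre {j k : Fin 8} (hj : 4 ≤ j) (hk : 4 ≤ k) : C.T 6 j k = 0 := by
  have h := C.bianchi 0 0 j k
  rcases le_four_cases hj with rfl | rfl | rfl | rfl <;>
  rcases le_four_cases hk with rfl | rfl | rfl | rfl <;>
  linear_combination (norm := simp) -h

theorem T_five_fibre {j k : Fin 8} (hj : 4 ≤ j) (hk : 4 ≤ k) :
    C.T 5 j k = dualWedge 7 5 j k := by
  have h := C.bianchi 0 1 j k
  rcases le_four_cases hj with rfl | rfl | rfl | rfl <;>
  rcases le_four_cases hk with rfl | rfl | rfl | rfl <;>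
  linear_combination (norm := simp) -h

theorem T_four_fibre {j k : Fin 8} (hj : 4 ≤ j) (hk : 4 ≤ k) :
    C.T 4 j k = 2 * dualWedge 7 4 j k := by
  have h := C.bianchi 0 2 j k
  rcases le_four_cases hj with rfl | rfl | rfl | rfl <;>
  rcases le_four_cases hk with rfl | rfl | rfl | rfl <;>
  linear_combination (norm := simp) -h

theorem T_seven_fibre {j k : Fin 8} (hj : 4 ≤ j) (hk : 4 ≤ k) : C.T 7 j k = 0 := by
  have h := C.bianchi 1 1 j k
  have h6 := C.bianchi 0 0 j k
  rcases le_four_cases hj with rfl | rfl | rfl | rfl <;>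
  rcases le_four_cases hk with rfl | rfl | rfl | rfl <;>
  linear_combination (norm := simp) h6 - h

attribute [local simp] T_four_fibre T_five_fibre T_six_fibre T_seven_fibre

/-- The part of `dθ¹` that involves the fibre directions. Like the parts of `dθ², dφ₀, dφ₁` and of the
differentials of the torsion functions below, it is determined by `d(dωⁱ) = 0`, evaluated on
two horizontal vectors and one vertical vector. -/
theorem T_four_mixed {j v : Fin 8} (hj : j < 4) (hv : 4 ≤ v) :
    C.T 4 j v = - C.a₄ * dualWedge 0 4 j v - 2 * C.a₃ * dualWedge 1 4 j v
      - C.a₁ * dualWedge 2 4 j v - C.a₂ * dualWedge 0 5 j v + C.a₁ * dualWedge 1 5 j v := by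
  have h i k l := C.bianchi i k l v
  obtain rfl | rfl | rfl | rfl := lt_four_cases hj
  · obtain rfl | rfl | rfl | rfl := le_four_cases hv <;>
    linear_combination (norm := simp) h 1 0 3
  · obtain rfl | rfl | rfl | rfl := le_four_cases hv <;>
    linear_combination (norm := (simp; algebra)) 2 * h 1 1 3 - h 2 2 3 - h 0 0 3 - h 0 1 2
  · obtain rfl | rfl | rfl | rfl := le_four_cases hv <;>
    linear_combination (norm := (simp <;> algebra)) h 1 2 3 - h 0 1 3
  · obtain rfl | rfl | rfl | rfl := le_four_cases hv <;>
    linear_combination (norm := simp) -h 0 2 3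

attribute [local simp] T_four_mixed

theorem T_five_mixed {j v : Fin 8} (hj : j < 4) (hv : 4 ≤ v) :
    C.T 5 j v = - 2 * C.a₃ * dualWedge 2 4 j v + (C.a₂ - C.a₃) * dualWedge 1 5 j v
      + C.a₁ * dualWedge 2 5 j v := by
  have h i k l := C.bianchi i k l v
  obtain rfl | rfl | rfl | rfl := lt_four_cases hj
  · obtain rfl | rfl | rfl | rfl := le_four_cases hv <;>
    linear_combination (norm := simp) h 1 0 2
  · obtain rfl | rfl | rfl | rfl := le_four_cases hv <;>
    linear_combination (norm := (simp <;> algebra)) h 2 1 3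
  · obtain rfl | rfl | rfl | rfl := le_four_cases hv <;>
    linear_combination (norm := simp) -h 0 1 2
  · obtain rfl | rfl | rfl | rfl := le_four_cases hv <;>
    linear_combination (norm := simp) -h 0 1 3

attribute [local simp] T_five_mixed

theorem T_six_mixed {j v : Fin 8} (hj : j < 4) (hv : 4 ≤ v) :
    C.T 6 j v = C.a₇ * dualWedge 1 4 j v - C.a₄ * dualWedge 2 4 j v + C.a₂ * dualWedge 3 4 j v
      - 3 * C.a₇ * dualWedge 0 5 j v - C.a₂ * dualWedge 2 5 j v := by
  have h i k l := C.bianchi i k l v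
  obtain rfl | rfl | rfl | rfl := lt_four_cases hj
  · obtain rfl | rfl | rfl | rfl := le_four_cases hv <;>
    linear_combination (norm := (simp; algebra)) 2 * h 1 0 1 - h 2 0 2
  · obtain rfl | rfl | rfl | rfl := le_four_cases hv <;>
    linear_combination (norm := simp) -h 0 0 1
  · obtain rfl | rfl | rfl | rfl := le_four_cases hv <;>
    linear_combination (norm := simp) -h 0 0 2
  · obtain rfl | rfl | rfl | rfl := le_four_cases hv <;>
    linear_combination (norm := simp) -h 0 0 3

attribute [local simp] T_six_mixed

theorem T_seven_mixed {j v : Fin 8} (hj : j < 4) (hv : 4 ≤ v) :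
    C.T 7 j v = - C.a₇ * dualWedge 1 4 j v + (C.a₄ + C.a₅) * dualWedge 2 4 j v
      - (C.a₂ + C.a₃) * dualWedge 3 4 j v + 2 * C.a₇ * dualWedge 0 5 j v
      - (1 / 2 : ℝ) • C.a₅ * dualWedge 1 5 j v + (2 * C.a₂ - C.a₃) * dualWedge 2 5 j v
      + C.a₁ * dualWedge 3 5 j v := by
  have h i k l := C.bianchi i k l v
  obtain rfl | rfl | rfl | rfl := lt_four_cases hj
  · obtain rfl | rfl | rfl | rfl := le_four_cases hv <;>
    linear_combination (norm := (simp <;> algebra)) h 1 0 1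
  · obtain rfl | rfl | rfl | rfl := le_four_cases hv <;>
    linear_combination (norm := (simp; algebra)) (1 / 2 : ℝ) • h 2 1 2
  · obtain rfl | rfl | rfl | rfl := le_four_cases hv <;>
    linear_combination (norm := (simp <;> algebra)) -h 1 1 2
  · obtain rfl | rfl | rfl | rfl := le_four_cases hv <;>
    linear_combination (norm := (simp <;> algebra)) -h 1 1 3

attribute [local simp] T_seven_mixed

/-- The derivatives of the torsion functions along the fibres, that is the infinitesimal action of the
structure group on the torsion. -/
theorem fibre_derivatives {v : Fin 8} (hv : 4 ≤ v) :
    C.D v C.a₁ = ![0, 0, 0, 0, -C.a₄ - 4 * C.a₅, -5 * C.a₂ + 4 * C.a₃, C.a₁, 2 * C.a₁] v ∧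
    C.D v C.a₂ = ![0, 0, 0, 0, C.a₇, -C.a₄, C.a₂, C.a₂] v ∧
    C.D v C.a₃ = ![0, 0, 0, 0, 2 * C.a₇, C.a₄ + (5 / 2 : ℝ) • C.a₅, C.a₃, C.a₃] v ∧
    C.D v C.a₄ = ![0, 0, 0, 0, 0, -3 * C.a₇, C.a₄, 0] v ∧
    C.D v C.a₅ = ![0, 0, 0, 0, 0, 0, C.a₅, 0] v ∧
    C.D v C.a₇ = ![0, 0, 0, 0, 0, 0, C.a₇, -C.a₇] v := by
  have h i k l := C.bianchi i k l v
  refine ⟨?_, ?_, ?_, ?_, ?_, ?_⟩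
  · obtain rfl | rfl | rfl | rfl := le_four_cases hv <;>
    linear_combination (norm := (simp <;> algebra)) h 3 2 3
  · obtain rfl | rfl | rfl | rfl := le_four_cases hv <;>
    linear_combination (norm := (simp <;> algebra)) h 2 0 3
  · obtain rfl | rfl | rfl | rfl := le_four_cases hv <;>
    linear_combination (norm := (simp <;> algebra)) h 3 1 3
  · obtain rfl | rfl | rfl | rfl := le_four_cases hv <;>
    linear_combination (norm := (simp <;> algebra)) h 3 0 3
  · obtain rfl | rfl | rfl | rfl := le_four_cases hv <;>
    linear_combination (norm := (simp <;> algebra)) h 3 1 2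
  · obtain rfl | rfl | rfl | rfl := le_four_cases hv <;>
    linear_combination (norm := (simp <;> algebra)) h 2 0 1

end NullCalculus

namespace NullCalculus

variable (C : NullCalculus A)

attribute [local simp] Fin.sum_univ_eight T_zero T_one T_two T_three dualWedge
  FrameCalculus.skew_of_lt FrameCalculus.T_self derivation_ofNat
  T_four_fibre T_five_fibre T_six_fibre T_seven_fibre
  T_four_mixed T_five_mixed T_six_mixed T_seven_mixed fibre_derivatives FrameCalculus.comm_of_lt

/-! ### Derivatives of the curvature along the fibre direction `e₅` -/

theorem D_five_T_five_01 : C.D 5 (C.T 5 0 1)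
    = - C.T 7 0 1 - C.a₁ * C.a₇ - C.D 0 C.a₂ + C.D 0 C.a₃ := by
  linear_combination (norm := (simp; algebra)) C.bianchi 5 0 1 5

theorem D_five_T_five_02 : C.D 5 (C.T 5 0 2)
    = C.T 5 0 1 - C.T 7 0 2 - C.D 0 C.a₁ - 2 * C.a₂ * C.a₃ := by
  linear_combination (norm := (simp; algebra)) C.bianchi 5 0 2 5

theorem D_five_T_five_03 : C.D 5 (C.T 5 0 3) = C.T 5 0 2 - C.T 7 0 3 - C.a₁ * C.a₂ := by
  linear_combination (norm := (simp; algebra)) C.bianchi 5 0 3 5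

theorem D_five_T_five_12 : C.D 5 (C.T 5 1 2)
    = C.T 5 0 2 - C.T 7 1 2 + 2 * C.a₁ * C.a₃ - C.D 1 C.a₁ + C.D 2 C.a₂ - C.D 2 C.a₃ := by
  linear_combination (norm := (simp; algebra)) C.bianchi 5 1 2 5

theorem D_five_T_five_13 : C.D 5 (C.T 5 1 3)
    = C.T 5 0 3 + C.T 5 1 2 - C.T 7 1 3 + C.D 3 C.a₂ - C.D 3 C.a₃ := by
  linear_combination (norm := (simp; algebra)) C.bianchi 5 1 3 5

theorem D_five_T_seven_01 : C.D 5 (C.T 7 0 1)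
    = - C.a₂ * C.a₇ - C.a₃ * C.a₇ + (1 / 2 : ℝ) • C.D 0 C.a₅ + 2 * C.D 1 C.a₇ := by
  linear_combination (norm := (simp; algebra)) C.bianchi 7 0 1 5

theorem D_five_T_seven_02 : C.D 5 (C.T 7 0 2)
    = C.T 7 0 1 + 2 * C.a₁ * C.a₇ + C.a₂ * C.a₄ + C.a₂ * C.a₅ - 2 * C.D 0 C.a₂ + C.D 0 C.a₃
      + 2 * C.D 2 C.a₇ := by
  linear_combination (norm := (simp; algebra)) C.bianchi 7 0 2 5

theorem D_five_T_seven_03 : C.D 5 (C.T 7 0 3)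
    = C.T 7 0 2 - C.a₁ * C.a₄ - C.D 0 C.a₁ - 3 * C.a₂ ^ 2 + 2 * C.D 3 C.a₇ := by
  linear_combination (norm := (simp; algebra)) C.bianchi 7 0 3 5

theorem D_five_T_seven_12 : C.D 5 (C.T 7 1 2)
    = C.T 7 0 2 - C.a₁ * C.a₄ - (5 / 2 : ℝ) • (C.a₁ * C.a₅) - 2 * C.a₂ ^ 2 + 3 * C.a₂ * C.a₃
      - 2 * C.D 1 C.a₂ - C.a₃ ^ 2 + C.D 1 C.a₃ - (1 / 2 : ℝ) • C.D 2 C.a₅ := by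
  linear_combination (norm := (simp; algebra)) C.bianchi 7 1 2 5

theorem D_five_T_seven_13 : C.D 5 (C.T 7 1 3)
    = C.T 7 0 3 + C.T 7 1 2 + C.a₁ * C.a₃ - C.D 1 C.a₁ - (1 / 2 : ℝ) • C.D 3 C.a₅ := by
  linear_combination (norm := (simp; algebra)) C.bianchi 7 1 3 5

attribute [local simp] D_five_T_five_01 D_five_T_five_02 D_five_T_five_03 D_five_T_five_12
  D_five_T_five_13 D_five_T_seven_01 D_five_T_seven_02 D_five_T_seven_03 D_five_T_seven_12
  D_five_T_seven_13

/-! ### Consequences of half-flatness -/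

section HalfFlat

variable {C} (h : C.T 5 1 3 = 0)
include h

/-- Half-flatness says that `dθ²(e₁, e₃) = 0` on the whole bundle. So this function may be differentiated
along the fibres, and its iterated derivatives in the direction `e₅` form a chain of identities
that ends with `a₇² = 0`. -/
theorem halfFlat_one : C.T 5 0 3 + C.T 5 1 2 - C.T 7 1 3 + C.D 3 C.a₂ - C.D 3 C.a₃ = 0 := by
  linear_combination (norm := (simp; try algebra)) congrArg (C.D 5) h

theorem halfFlat_two :
    C.T 5 0 2 - C.T 7 0 3 - C.T 7 1 2 + C.D 2 C.a₂ - C.D 2 C.a₃ - C.D 3 C.a₄ - C.D 3 C.a₅ = 0 := by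
  linear_combination (norm := (simp; algebra)) (1 / 2 : ℝ) • congrArg (C.D 5) (halfFlat_one h)

theorem halfFlat_three :
    C.T 5 0 1 - 3 * C.T 7 0 2 + 6 * C.a₂ ^ 2 - 7 * C.a₂ * C.a₃ + 3 * C.D 1 C.a₂ + 2 * C.a₃ ^ 2
      - 2 * C.D 1 C.a₃ - 3 * C.D 2 C.a₄ - 3 * C.D 2 C.a₅ + C.D 3 C.a₇ = 0 := by
  linear_combination (norm := (simp; algebra)) congrArg (C.D 5) (halfFlat_two h)

theorem halfFlat_four :
    - C.T 7 0 1 - 6 * C.a₂ * C.a₄ - 6 * C.a₂ * C.a₅ + 2 * C.D 0 C.a₂ + 4 * C.a₃ * C.a₄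
      + 4 * C.a₃ * C.a₅ - C.D 0 C.a₃ - 2 * C.D 1 C.a₄ - 2 * C.D 1 C.a₅ + C.D 2 C.a₇ = 0 := by
  linear_combination (norm := (simp; algebra)) (1 / 4 : ℝ) • congrArg (C.D 5) (halfFlat_three h)

theorem halfFlat_five :
    4 * C.a₂ * C.a₇ - 3 * C.a₃ * C.a₇ + 2 * C.a₄ ^ 2 + 4 * C.a₄ * C.a₅ - C.D 0 C.a₄
      + 2 * C.a₅ ^ 2 - C.D 0 C.a₅ + C.D 1 C.a₇ = 0 := by
  linear_combination (norm := (simp; algebra)) (1 / 5 : ℝ) • congrArg (C.D 5) (halfFlat_four h)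

theorem halfFlat_six : C.D 0 C.a₇ = 4 * C.a₄ * C.a₇ + 4 * C.a₅ * C.a₇ := by
  linear_combination (norm := (simp; algebra)) (1 / 4 : ℝ) • congrArg (C.D 5) (halfFlat_five h)

theorem a₇_sq_eq_zero : C.a₇ ^ 2 = 0 := by
  linear_combination (norm := (simp; algebra)) (1 / 7 : ℝ) • congrArg (C.D 5) (halfFlat_six h)

end HalfFlat

end NullCalculus

/-! ### The curvature of the Cartan connection form -/

/-- The components of `dψ + ψ ∧ ψ` for a matrix `ψ` of 1-forms, given by their components. -/
def FrameCalculus.curvature (C : FrameCalculus (Fin 8) A)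
    (ψ : Fin 3 → Fin 3 → Fin 8 → A) (i j : Fin 3) (k l : Fin 8) : A :=
  C.D k (ψ i j l) - C.D l (ψ i j k) + ∑ m, ψ i j m * C.T m k l
    + ∑ m, (ψ i m k * ψ m j l - ψ i m l * ψ m j k)

namespace NullCalculus

variable (C : NullCalculus A)

attribute [local simp] Fin.sum_univ_eight T_zero T_one T_two T_three dualWedge
  FrameCalculus.skew_of_lt FrameCalculus.T_self derivation_ofNat
  T_four_fibre T_five_fibre T_six_fibre T_seven_fibre
  T_four_mixed T_five_mixed T_six_mixed T_seven_mixed fibre_derivatives FrameCalculus.comm_of_lt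

/-- The function `K₁` of the path geometries on the null surfaces, with `T 5 i j` and `T 7 i j` in the
place of `b₂ᵢⱼ` and `b₄ᵢⱼ`. -/
noncomputable def pathK₁ : A :=
  - (41 / 2 : ℝ) • (C.a₂ * C.a₃ * C.a₄) - (133 / 6 : ℝ) • (C.a₂ * C.a₃ * C.a₅)
  - (5 / 6 : ℝ) • C.D 0 (C.T 5 0 1) + (1 / 6 : ℝ) • C.D 1 (C.T 7 0 1)
  - (5 / 4 : ℝ) • C.D 0 (C.T 7 0 2)
  + 6 * C.a₂ * C.D 1 C.a₄ - (1 / 4 : ℝ) • (C.a₄ * C.T 7 0 2) + (17 / 6 : ℝ) • (C.a₂ * C.T 7 0 1)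
  + (5 / 3 : ℝ) • (C.T 5 0 1 * C.a₅) + (22 / 3 : ℝ) • (C.a₂ * C.D 1 C.a₅)
  - (7 / 3 : ℝ) • (C.a₃ * C.T 7 0 1) + (53 / 3 : ℝ) • (C.a₂ ^ 2 * C.a₅)
  + (7 / 4 : ℝ) • (C.a₄ * C.T 5 0 1) - 4 * C.a₄ * C.D 2 C.a₅ - (1 / 4 : ℝ) • (C.a₅ * C.T 7 0 2)
  - 4 * C.a₅ * C.D 2 C.a₄ - 4 * C.a₄ * C.D 2 C.a₄ - 4 * C.a₅ * C.D 2 C.a₅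
  - (53 / 12 : ℝ) • (C.a₃ * C.D 1 C.a₄) + 15 * C.a₂ ^ 2 * C.a₄ + 7 * C.a₃ ^ 2 * C.a₄
  + 7 * C.a₃ ^ 2 * C.a₅ - (29 / 6 : ℝ) • (C.a₃ * C.D 1 C.a₅)

/-- The coefficient of `ω⁰` in `ψ¹₁ - ψ⁰₀`. -/
noncomputable def coeffQ : A := - (1 / 2 : ℝ) • (C.a₄ + C.a₅)

/-- The coefficient of `ω⁰` in `ψ⁰₁`. -/
noncomputable def coeffN : A := 2 * C.a₂ * C.a₄ + (7 / 3 : ℝ) • (C.a₂ * C.a₅)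
  - (4 / 3 : ℝ) • (C.a₃ * C.a₄) - (4 / 3 : ℝ) • (C.a₃ * C.a₅) + (2 / 3 : ℝ) • C.D 1 C.a₄ + C.D 1 C.a₅

/-- The coefficient of `ω¹` in `ψ⁰₂`. -/
noncomputable def coeffX : A := - 2 * C.a₂ * C.a₄ - (1 / 3 : ℝ) • (C.a₂ * C.a₅) + C.D 0 C.a₂
  + (4 / 3 : ℝ) • (C.a₃ * C.a₄) + (4 / 3 : ℝ) • (C.a₃ * C.a₅) - (7 / 6 : ℝ) • C.D 1 C.a₄
  - (1 / 2 : ℝ) • C.D 1 C.a₅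

/-- The components of the Cartan connection form of the path geometries on the null surfaces, with
respect to the coframe of the bundle. The entries in the last two columns are those of a matrix in
`𝔰𝔩₃` that acts on `ω⁰, ω¹, θ²` as `φ₀` and `φ₁` do in the structure equations; the horizontal entries
are a solution of the conditions that the curvature has normal form. -/
noncomputable def cartanForm : Fin 3 → Fin 3 → Fin 8 → A :=
  ![![![-(1 / 3 : ℝ) • C.coeffQ, -(1 / 3 : ℝ) • (C.a₂ - C.a₃), 0, 0, 0, 0,
        algebraMap ℝ A (-2 / 3), algebraMap ℝ A (-1 / 3)],
      ![C.coeffN, - C.T 5 0 1, 0, 0, 0, C.coeffQ, 0, 0],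
      ![-(3 / 4 : ℝ) • (C.a₄ + C.a₅) ^ 2, C.coeffX, 0, 0, 0, 0, 0, 0]],
    ![![0, 1, 0, 0, 0, 0, 0, 0],
      ![(2 / 3 : ℝ) • C.coeffQ, (2 / 3 : ℝ) • (C.a₂ - C.a₃), 0, 0, 0, 0,
        algebraMap ℝ A (1 / 3), algebraMap ℝ A (2 / 3)],
      ![0, C.coeffQ, 0, 0, 0, 0, 0, 0]],
    ![![1, 0, 0, 0, 0, 0, 0, 0],
      ![0, 0, 0, 0, 0, 1, 0, 0],
      ![-(1 / 3 : ℝ) • C.coeffQ, -(1 / 3 : ℝ) • (C.a₂ - C.a₃), 0, 0, 0, 0,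
        algebraMap ℝ A (1 / 3), algebraMap ℝ A (-1 / 3)]]]

theorem leaf_cases {k l : Fin 8} (hk : k ≠ 2 ∧ k ≠ 3) (hl : l ≠ 2 ∧ l ≠ 3) (hkl : k < l) :
    (k = 0 ∧ (l = 1 ∨ l = 4 ∨ l = 5 ∨ l = 6 ∨ l = 7)) ∨ (k = 1 ∧ (l = 4 ∨ l = 5 ∨ l = 6 ∨ l = 7)) ∨
    (k = 4 ∧ (l = 5 ∨ l = 6 ∨ l = 7)) ∨ (k = 5 ∧ (l = 6 ∨ l = 7)) ∨ (k = 6 ∧ l = 7) := by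
  revert k l; decide

section HalfFlat

variable {C} (h : C.T 5 1 3 = 0) (h7 : C.a₇ = 0)
include h7

/-- This identity, like the next four, is the part of `d(dωⁱ) = 0` that only involves horizontal vectors. -/
theorem D_zero_a₅ : C.D 0 C.a₅ = C.a₄ * C.a₅ := by
  linear_combination (norm := (simp [h7]; try algebra)) C.bianchi 3 0 1 2

theorem T_six_01 : C.T 6 0 1 = - 2 * C.T 7 0 1 - C.a₂ * C.a₅ := by
  linear_combination (norm := (simp [h7]; try algebra)) - C.bianchi 2 0 1 2

theorem T_six_02 : C.T 6 0 2 = C.T 5 0 1 - C.T 7 0 2 := by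
  linear_combination (norm := (simp [h7]; try algebra)) C.bianchi 1 0 1 2

theorem D_one_a₂ : C.D 1 C.a₂ = - C.T 5 0 1 - C.a₂ * C.a₃ := by
  linear_combination (norm := (simp [h7]; algebra)) - C.bianchi 2 0 1 3

theorem D_zero_a₃ : C.D 0 C.a₃ = C.T 7 0 1 - 2 * C.a₂ * C.a₅ + C.D 1 C.a₄ := by
  linear_combination (norm := (simp [h7]; algebra)) C.bianchi 3 0 1 3 + T_six_01 h7

theorem fibre_derivative_coeffQ {v : Fin 8} (hv : 4 ≤ v) :
    C.D v C.coeffQ = ![0, 0, 0, 0, 0, 0, C.coeffQ, 0] v := by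
  obtain rfl | rfl | rfl | rfl := le_four_cases hv <;>
    linear_combination (norm := (simp [coeffQ, h7] <;> algebra))

include h

theorem T_seven_01 : C.T 7 0 1 = - 3 * C.a₂ * C.a₄ - 2 * C.a₂ * C.a₅ + C.D 0 C.a₂
    + 2 * C.a₃ * C.a₄ + 2 * C.a₃ * C.a₅ - (3 / 2 : ℝ) • C.D 1 C.a₄ - C.D 1 C.a₅ := by
  linear_combination (norm := (simp [h7]; algebra))
    - (1 / 2 : ℝ) • (halfFlat_four h + D_zero_a₃ h7)

theorem T_five_01 : C.T 5 0 1 = 3 * C.a₂ ^ 2 - 5 * C.a₂ * C.a₃ + C.a₃ ^ 2 - C.D 1 C.a₃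
    - (3 / 2 : ℝ) • (C.D 2 C.a₄ + C.D 2 C.a₅ + C.T 7 0 2) := by
  linear_combination (norm := (simp [h7]; algebra))
    - (1 / 2 : ℝ) • halfFlat_three h + (3 / 2 : ℝ) • D_one_a₂ h7

theorem D_zero_a₄ : C.D 0 C.a₄ = 2 * C.a₄ ^ 2 + 3 * C.a₄ * C.a₅ + 2 * C.a₅ ^ 2 := by
  linear_combination (norm := (simp [h7]; algebra)) - halfFlat_five h - D_zero_a₅ h7

/-- The relations that half-flatness and `d(dωⁱ) = 0` impose on the leaves of `{ω², ω³}`. -/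
theorem leaf_relations :
    C.D 0 C.a₄ = 2 * C.a₄ ^ 2 + 3 * C.a₄ * C.a₅ + 2 * C.a₅ ^ 2 ∧
    C.D 0 C.a₅ = C.a₄ * C.a₅ ∧
    C.T 6 0 1 = - 2 * C.T 7 0 1 - C.a₂ * C.a₅ ∧
    C.T 6 0 2 = C.T 5 0 1 - C.T 7 0 2 ∧
    C.D 1 C.a₂ = - C.T 5 0 1 - C.a₂ * C.a₃ ∧
    C.D 0 C.a₃ = C.T 7 0 1 - 2 * C.a₂ * C.a₅ + C.D 1 C.a₄ ∧
    C.T 7 0 1 = - 3 * C.a₂ * C.a₄ - 2 * C.a₂ * C.a₅ + C.D 0 C.a₂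
      + 2 * C.a₃ * C.a₄ + 2 * C.a₃ * C.a₅ - (3 / 2 : ℝ) • C.D 1 C.a₄ - C.D 1 C.a₅ :=
  ⟨D_zero_a₄ h h7, D_zero_a₅ h7, T_six_01 h7, T_six_02 h7, D_one_a₂ h7, D_zero_a₃ h7,
    T_seven_01 h h7⟩

theorem fibre_derivative_T_five_01 {v : Fin 8} (hv : 4 ≤ v) : C.D v (C.T 5 0 1)
    = ![0, 0, 0, 0, 0, - 2 * C.a₂ * C.a₅ - C.D 0 C.a₂ + C.D 1 C.a₄,
      2 * C.T 5 0 1, 2 * C.T 5 0 1] v := by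
  have h1 := C.bianchi 5 0 1 v
  obtain rfl | rfl | rfl | rfl := le_four_cases hv <;>
    linear_combination (norm := (simp [h7, leaf_relations h h7]; try algebra)) h1

theorem D_zero_coeffQ : C.D 0 C.coeffQ = - (C.a₄ + C.a₅) ^ 2 := by
  linear_combination (norm := (simp [coeffQ, leaf_relations h h7]; algebra))

theorem fibre_derivative_coeffN {v : Fin 8} (hv : 4 ≤ v) :
    C.D v C.coeffN = ![0, 0, 0, 0, 0, - 2 * (C.a₄ + C.a₅) ^ 2, 2 * C.coeffN, C.coeffN] v := by
  obtain rfl | rfl | rfl | rfl := le_four_cases hv <;>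
    linear_combination (norm := (simp [coeffN, h7, leaf_relations h h7] <;> algebra))

theorem fibre_derivative_coeffX {v : Fin 8} (hv : 4 ≤ v) :
    C.D v C.coeffX = ![0, 0, 0, 0, 0, - (C.a₄ + C.a₅) ^ 2, 2 * C.coeffX, C.coeffX] v := by
  obtain rfl | rfl | rfl | rfl := le_four_cases hv <;>
    linear_combination (norm := (simp [coeffX, h7, leaf_relations h h7] <;> algebra))

set_option maxHeartbeats 1000000 in
/-- The right-hand side is the coefficient of `ω⁰ ∧ ω¹` in the component `(0, 1)` of the curvature of
`cartanForm`. The form of `K₁` on the left-hand side results by the commutators of the frame on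
`a₃`, `a₄` and `a₅`. -/
theorem pathK₁_eq : C.pathK₁ = - C.D 0 (C.T 5 0 1) - C.D 1 C.coeffN + (2 : ℝ) • (C.coeffQ * C.T 5 0 1)
    + C.coeffN * (C.a₂ - C.a₃) := by
  have e := leaf_relations h h7
  have e5 := T_five_01 h h7
  linear_combination (norm := (simp [coeffQ, coeffN, pathK₁, e, e5, h7]; algebra))
    (5 / 6 : ℝ) • (C.comm 0 1 C.a₃ + (3 / 2 : ℝ) • (C.comm 0 2 C.a₄ + C.comm 0 2 C.a₅))

set_option maxHeartbeats 4000000 in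
/-- The curvature of `cartanForm` on the leaves of `{ω², ω³}`. The entry `(0, 2)` defines `K₂` and `L₂`;
the entry `(1, 2)` contains the assertion `L₁ = 0`. -/
theorem curvature_cartanForm_of_lt {k l : Fin 8} (hk : k ≠ 2 ∧ k ≠ 3) (hl : l ≠ 2 ∧ l ≠ 3)
    (hkl : k < l) (i j : Fin 3) : C.curvature C.cartanForm i j k l =
      !![0, C.pathK₁ * dualWedge 0 1 k l,
          C.curvature C.cartanForm 0 2 0 1 * dualWedge 0 1 k l
            + C.curvature C.cartanForm 0 2 0 5 * dualWedge 0 5 k l;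
        0, 0, 0; 0, 0, 0] i j := by
  have e := leaf_relations h h7
  have eQ := @fibre_derivative_coeffQ _ _ _ _ h7
  have eQ₀ := D_zero_coeffQ h h7
  have eN := @fibre_derivative_coeffN _ _ _ _ h h7
  have eX := @fibre_derivative_coeffX _ _ _ _ h h7
  have eT := @fibre_derivative_T_five_01 _ _ _ _ h h7
  revert i j
  obtain ⟨rfl, rfl | rfl | rfl | rfl | rfl⟩ | ⟨rfl, rfl | rfl | rfl | rfl⟩ |
    ⟨rfl, rfl | rfl | rfl⟩ | ⟨rfl, rfl | rfl⟩ | ⟨rfl, rfl⟩ := leaf_cases hk hl hkl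
  all_goals
    simp [Fin.forall_fin_succ, FrameCalculus.curvature, cartanForm, Fin.sum_univ_three, h7, e, eQ,
      eQ₀, eN, eX, eT]
  all_goals and_intros
  all_goals first
    | linear_combination (norm := algebra)
    | linear_combination (norm := (simp only [coeffQ]; algebra))
    | linear_combination (norm := (simp [coeffQ, coeffN, coeffX, e]; algebra))
    | linear_combination (norm := algebra) - pathK₁_eq h h7

end HalfFlat

end NullCalculus
end Algebra

/-! ### The lifted coframe -/

section Lifted

theorem isOpen_adaptedBundle {U : Set E4} (hU : IsOpen U) : IsOpen (adaptedBundle U) :=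
  (hU.preimage continuous_fst).inter
    ((isOpen_ne.preimage (by fun_prop : Continuous fun p : PSpace => p.2 0)).inter
      (isOpen_ne.preimage (by fun_prop : Continuous fun p : PSpace => p.2 1)))

theorem groupMatrix_inv {g : Fin 4 → ℝ} (h0 : g 0 ≠ 0) (h1 : g 1 ≠ 0) :
    (groupMatrix g)⁻¹ =
      !![1 / g 0, - g 2 / (g 0 ^ 2 * g 1), (g 2 ^ 2 / g 0 - g 3) / (g 0 ^ 2 * g 1 ^ 2),
          (g 2 * g 3 - 2 / 3 * g 2 ^ 3 / g 0) / (g 0 ^ 3 * g 1 ^ 3);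
         0, 1 / (g 0 * g 1), - g 2 / (g 0 ^ 2 * g 1 ^ 2),
          (g 2 ^ 2 / g 0 - g 3) / (g 0 ^ 2 * g 1 ^ 3);
         0, 0, 1 / (g 0 * g 1 ^ 2), - g 2 / (g 0 ^ 2 * g 1 ^ 3);
         0, 0, 0, 1 / (g 0 * g 1 ^ 3)] := by
  apply Matrix.inv_eq_right_inv
  ext i j
  fin_cases i <;> fin_cases j <;>
    simp [groupMatrix, Matrix.mul_apply, Fin.sum_univ_four] <;> field_simp <;> ring

theorem contDiffOn_groupMatrix_inv (U : Set E4) (i j : Fin 4) :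
    ContDiffOn ℝ (⊤ : ℕ∞) (fun p : PSpace => (groupMatrix p.2)⁻¹ i j) (adaptedBundle U) := by
  suffices h : ∀ A : Fin 4 → Fin 4 → PSpace → ℝ,
      (∀ p ∈ adaptedBundle U, (groupMatrix p.2)⁻¹ = Matrix.of fun i j => A i j p) →
      ContDiffOn ℝ (⊤ : ℕ∞) (A i j) (adaptedBundle U) →
      ContDiffOn ℝ (⊤ : ℕ∞) (fun p : PSpace => (groupMatrix p.2)⁻¹ i j) (adaptedBundle U) by
    refine h (fun i j p => _) (fun p hp => groupMatrix_inv hp.2.1 hp.2.2) ?_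
    have c0 : ∀ p ∈ adaptedBundle U, p.2 0 ≠ 0 := fun p hp => hp.2.1
    have c1 : ∀ p ∈ adaptedBundle U, p.2 1 ≠ 0 := fun p hp => hp.2.2
    fin_cases i <;> fin_cases j <;> simp only [Fin.zero_eta, Fin.mk_one, Fin.reduceFinMk, Matrix.cons_val] <;>
      fun_prop (disch := (intro p hp; simp [c0 p hp, c1 p hp]))
  exact fun A h1 h2 => h2.congr fun p hp => by rw [h1 p hp]; rfl

/-- The components of the coframe `ω` in terms of the lifted coframe: `ω = g ω̂`. -/
theorem coframe_eq {ω : Fin 4 → E4 → E4 →L[ℝ] ℝ} {p : PSpace} (h0 : p.2 0 ≠ 0) (h1 : p.2 1 ≠ 0)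
    (i : Fin 4) (Z : PSpace) :
    ω i p.1 Z.1 = ∑ j, groupMatrix p.2 i j * liftedCoframe ω j p Z := by
  have hdet : groupMatrix p.2 * (groupMatrix p.2)⁻¹ = 1 := by
    rw [groupMatrix_inv h0 h1]
    ext i j
    fin_cases i <;> fin_cases j <;>
      simp [groupMatrix, Matrix.mul_apply, Fin.sum_univ_four] <;> field_simp <;> ring
  have h : (groupMatrix p.2 * (groupMatrix p.2)⁻¹).mulVec (fun j => ω j p.1 Z.1) i = ω i p.1 Z.1 := by
    rw [hdet, Matrix.one_mulVec]
  rw [← h, ← Matrix.mulVec_mulVec]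
  simp [Matrix.mulVec, dotProduct, liftedCoframe]

theorem contDiffOn_liftedCoframe {U : Set E4} {ω : Fin 4 → E4 → E4 →L[ℝ] ℝ}
    (hω : IsCoframeOn U ω) (i : Fin 4) :
    ContDiffOn ℝ (⊤ : ℕ∞) (liftedCoframe ω i) (adaptedBundle U) := by
  unfold liftedCoframe
  refine ContDiffOn.sum fun j _ => (contDiffOn_groupMatrix_inv U i j).smul ?_
  have : ContDiffOn ℝ (⊤ : ℕ∞) (fun p : PSpace => ω j p.1) (adaptedBundle U) :=
    (hω.1 j).comp contDiff_fst.contDiffOn fun p hp => hp.1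
  exact this.clm_comp contDiffOn_const

end Lifted

/-! ### Forms that annihilate the fibres of a submersion -/

section Annihilator

variable {V F : Type*} [NormedAddCommGroup V] [NormedSpace ℝ V] [NormedAddCommGroup F]
  [NormedSpace ℝ F]

/-- A 1-form that annihilates the fibres of a submersion `Φ` is closed along the fibres. -/
theorem extd_eq_zero_of_ker [FiniteDimensional ℝ F] {Φ : V → F} {α : V → V →L[ℝ] ℝ} {p : V}
    (hΦ : ContDiffAt ℝ 2 Φ p) (hs : Function.Surjective (fderiv ℝ Φ p))
    (hα : DifferentiableAt ℝ α p)
    (hv : ∀ᶠ q in nhds p, ∀ Z, fderiv ℝ Φ q Z = 0 → α q Z = 0) {X Y : V}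
    (hX : fderiv ℝ Φ p X = 0) (hY : fderiv ℝ Φ p Y = 0) : extd α p X Y = 0 := by
  have : CompleteSpace F := FiniteDimensional.complete ℝ F
  obtain ⟨R, hR⟩ := (fderiv ℝ Φ p).exists_rightInverse_of_surjective (LinearMap.range_eq_top.2 hs)
  have hL : DifferentiableAt ℝ (fderiv ℝ Φ) p :=
    (hΦ.fderiv_right (m := 1) (by norm_num)).differentiableAt (by norm_num)
  -- the projection of `Z` to the kernel of `fderiv ℝ Φ q` along the range of `R`
  set N : V → F →L[ℝ] F := fun q => Ring.inverse ((fderiv ℝ Φ q).comp R) with hN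
  have hNp : N p = 1 := by simp only [hN, hR]; exact Ring.inverse_one _
  have hM : DifferentiableAt ℝ (fun q => (fderiv ℝ Φ q).comp R) p := hL.clm_comp (by fun_prop)
  have hunit : IsUnit ((fderiv ℝ Φ p).comp R) := by rw [hR]; exact isUnit_one
  have hNd : DifferentiableAt ℝ N p := by
    obtain ⟨w, hw⟩ := hunit
    have h1 := (contDiffAt_ringInverse ℝ (n := 1) w).differentiableAt (by norm_num)
    rw [hw] at h1
    exact h1.comp p hM
  have hev : ∀ᶠ q in nhds p, IsUnit ((fderiv ℝ Φ q).comp R) :=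
    hM.continuousAt.eventually (Units.isOpen.mem_nhds hunit)
  have key : ∀ Z, fderiv ℝ Φ p Z = 0 → ∀ Y, fderiv ℝ α p Y Z = α p (R (fderiv ℝ (fderiv ℝ Φ) p Y Z)) := by
    intro Z hZ Y
    have h0 : (fun q => α q Z - α q (R (N q (fderiv ℝ Φ q Z)))) =ᶠ[nhds p] fun _ => 0 := by
      filter_upwards [hv, hev] with q hq hu
      rw [← map_sub]
      apply hq
      rw [map_sub, sub_eq_zero]
      have := congrArg (fun T : F →L[ℝ] F => T (fderiv ℝ Φ q Z)) (Ring.mul_inverse_cancel _ hu)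
      simpa [hN] using this.symm
    have e1 : HasFDerivAt (fun q => α q Z) ((fderiv ℝ α p).flip Z) p := by
      simpa using hα.hasFDerivAt.clm_apply (hasFDerivAt_const Z p)
    have e2 : HasFDerivAt (fun q => fderiv ℝ Φ q Z) ((fderiv ℝ (fderiv ℝ Φ) p).flip Z) p := by
      simpa using hL.hasFDerivAt.clm_apply (hasFDerivAt_const Z p)
    have e3 := hNd.hasFDerivAt.clm_apply e2
    have e4 := hα.hasFDerivAt.clm_apply (R.hasFDerivAt.comp p e3)
    have e5 := congrArg (fun T : V →L[ℝ] ℝ => T Y)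
      ((e1.sub e4).unique ((hasFDerivAt_const (0 : ℝ) p).congr_of_eventuallyEq h0))
    simpa [hZ, hNp, sub_eq_zero] using e5
  rw [extd_apply hα, key Y hY X, key X hX Y, sub_eq_zero]
  rw [(hΦ.isSymmSndFDerivAt (by simp)).eq X Y]

end Annihilator

/-! ### Half-flatness and the structure equations -/

section HalfFlatness

variable {U : Set E4} {ω : Fin 4 → E4 → E4 →L[ℝ] ℝ}

/-- The point of the space of ruling planes over which the adapted coframe `p` lies: its parameter
is `s = - u / (f₀ f₁)`. -/
noncomputable def rulingPoint (p : PSpace) : E4 × ℝ := (p.1, - p.2 2 / (p.2 0 * p.2 1))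

/-- The ruling plane of `rulingPoint p` is `Ker {ω̂⁰, ω̂²}`, with the lifted forms at `p`. -/
theorem mem_rulingPlane_iff {p : PSpace} (h0 : p.2 0 ≠ 0) (h1 : p.2 1 ≠ 0) (Z : PSpace) :
    Z.1 ∈ rulingPlane ω (rulingPoint p).1 (rulingPoint p).2 ↔
      liftedCoframe ω 0 p Z = 0 ∧ liftedCoframe ω 2 p Z = 0 := by
  have e := coframe_eq (ω := ω) h0 h1
  have h2 : ω 2 p.1 Z.1 + - p.2 2 / (p.2 0 * p.2 1) * ω 3 p.1 Z.1
      = p.2 0 * p.2 1 ^ 2 * liftedCoframe ω 2 p Z := by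
    simp only [e, groupMatrix, Fin.sum_univ_four, Matrix.of_apply, Matrix.cons_val]
    field_simp
    ring
  have h3 : ω 0 p.1 Z.1 + - p.2 2 / (p.2 0 * p.2 1) * ω 1 p.1 Z.1
      - (- p.2 2 / (p.2 0 * p.2 1)) ^ 3 / 3 * ω 3 p.1 Z.1
      = p.2 0 * liftedCoframe ω 0 p Z + (p.2 3 - p.2 2 ^ 2 / p.2 0) * liftedCoframe ω 2 p Z := by
    simp only [e, groupMatrix, Fin.sum_univ_four, Matrix.of_apply, Matrix.cons_val]
    field_simp
    ring
  simp only [rulingPlane, rulingPoint, Submodule.mem_inf, LinearMap.mem_ker,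
    ContinuousLinearMap.coe_coe, add_apply, sub_apply,
    smul_apply, smul_eq_mul, h2, h3]
  constructor
  · rintro ⟨ha, hb⟩
    have hc : liftedCoframe ω 2 p Z = 0 := by simpa [h0, h1] using hb
    exact ⟨by simpa [hc, h0] using ha, hc⟩
  · rintro ⟨ha, hb⟩
    simp [ha, hb]

theorem contDiffAt_rulingPoint {p : PSpace} (h0 : p.2 0 ≠ 0) (h1 : p.2 1 ≠ 0) :
    ContDiffAt ℝ (⊤ : ℕ∞) rulingPoint p := by
  unfold rulingPoint
  fun_prop (disch := simp [h0, h1])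

theorem fderiv_rulingPoint_surjective {p : PSpace} (h0 : p.2 0 ≠ 0) (h1 : p.2 1 ≠ 0) :
    (∀ Z, (fderiv ℝ rulingPoint p Z).1 = Z.1) ∧
      ∀ z : E4 × ℝ, ∃ Z : PSpace, fderiv ℝ rulingPoint p Z = z := by
  have hd : DifferentiableAt ℝ rulingPoint p := (contDiffAt_rulingPoint h0 h1).differentiableAt (by simp)
  have hfst : ∀ Z, (fderiv ℝ rulingPoint p Z).1 = Z.1 := by
    intro Z
    have h2 : HasFDerivAt (fun q => (rulingPoint q).1)
        ((ContinuousLinearMap.fst ℝ E4 ℝ).comp (fderiv ℝ rulingPoint p)) p :=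
      (ContinuousLinearMap.fst ℝ E4 ℝ).hasFDerivAt.comp p hd.hasFDerivAt
    exact congrArg (fun T : PSpace →L[ℝ] E4 => T Z)
      (h2.unique (ContinuousLinearMap.fst ℝ E4 (Fin 4 → ℝ)).hasFDerivAt)
  refine ⟨hfst, fun z => ?_⟩
  -- the curve `t ↦ p + t (0, w)` moves the second component of `rulingPoint` with unit speed
  set w : PSpace := (0, Pi.single 2 (- (p.2 0 * p.2 1))) with hw
  have hsnd : fderiv ℝ rulingPoint p w = (0, 1) := by
    refine Prod.ext (by rw [hfst]) ?_
    have h2 : HasDerivAt (fun t : ℝ => p + t • w) w 0 := by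
      simpa using ((hasDerivAt_id (0 : ℝ)).smul_const w).const_add p
    have h3 : HasDerivAt (fun t : ℝ => rulingPoint (p + t • w)) (fderiv ℝ rulingPoint p w) 0 := by
      have : HasFDerivAt rulingPoint (fderiv ℝ rulingPoint p) (p + (0 : ℝ) • w) := by
        simpa using hd.hasFDerivAt
      exact this.comp_hasDerivAt (0 : ℝ) h2
    have h4 : HasDerivAt (fun t : ℝ => (rulingPoint (p + t • w)).2) (fderiv ℝ rulingPoint p w).2 0 :=
      (ContinuousLinearMap.snd ℝ E4 ℝ).hasFDerivAt.comp_hasDerivAt (0 : ℝ) h3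
    refine h4.unique ?_
    have h5 : (fun t : ℝ => (rulingPoint (p + t • w)).2) = fun t => - p.2 2 / (p.2 0 * p.2 1) + t := by
      funext t
      simp [rulingPoint, hw]
      field_simp
      ring
    rw [h5]
    exact (hasDerivAt_id (0 : ℝ)).const_add _
  refine ⟨(z.1, 0) + (z.2 - (fderiv ℝ rulingPoint p (z.1, 0)).2) • w, ?_⟩
  rw [map_add, map_smul, hsnd]
  exact Prod.ext (by simp [hfst]) (by simp)

variable (F : StructureForms U ω)

/-- On a subspace that annihilates `ω̂⁰, ω̂²` and their exterior derivatives, `θ²` vanishes because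
`dω̂⁰ ≡ - θ² ∧ ω̂¹` and `dω̂² ≡ - θ² ∧ ω̂³` modulo `ω̂⁰, ω̂²`. -/
theorem theta₂_vanishing {p : PSpace} (hp : p ∈ adaptedBundle U) {K : Submodule ℝ PSpace}
    {Y₁ Y₃ : PSpace} (hY₁ : Y₁ ∈ K) (hY₃ : Y₃ ∈ K)
    (h1 : liftedCoframe ω 1 p Y₁ = 1) (h2 : liftedCoframe ω 3 p Y₁ = 0)
    (h4 : liftedCoframe ω 3 p Y₃ = 1)
    (hK : ∀ Z ∈ K, liftedCoframe ω 0 p Z = 0 ∧ liftedCoframe ω 2 p Z = 0)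
    (hd : ∀ X ∈ K, ∀ Y ∈ K, extd (liftedCoframe ω 0) p X Y = 0 ∧
      extd (liftedCoframe ω 2) p X Y = 0) : ∀ Z ∈ K, F.θ₂ p Z = 0 := by
  have key : ∀ X ∈ K, ∀ Y ∈ K, wedge (F.θ₂ p) (liftedCoframe ω 1 p) X Y = 0 ∧
      wedge (F.θ₂ p) (liftedCoframe ω 3 p) X Y = 0 := by
    intro X hX Y hY
    have e0 := F.dω₀ p hp X Y
    have e2 := F.dω₂ p hp X Y
    rw [(hd X hX Y hY).1] at e0
    rw [(hd X hX Y hY).2] at e2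
    simp only [wedge, (hK X hX).1, (hK X hX).2, (hK Y hY).1, (hK Y hY).2] at e0 e2 ⊢
    constructor <;> linarith
  have a1 := (key Y₁ hY₁ Y₃ hY₃).2
  intro Z hZ
  have a2 := (key Z hZ Y₁ hY₁).1
  simp only [wedge, h1, h2, h4] at a1 a2
  have : F.θ₂ p Y₁ = 0 := by linarith
  rw [this] at a2
  linarith

/-- Half-flatness in terms of the structure equations: `θ²` vanishes, together with `ω̂⁰` and `ω̂²`, on
the fibres of a submersion, so that the coefficient of `ω̂¹ ∧ ω̂³` in `dθ²` is zero. -/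
theorem extd_theta₂_eq_zero (hU : IsOpen U) (hω : IsCoframeOn U ω) (hflat : IsHalfFlat U ω)
    {p : PSpace} (hp : p ∈ adaptedBundle U) : extd F.θ₂ p (F.e 1 p) (F.e 3 p) = 0 := by
  obtain ⟨O, τ, hO, hpO, hτ, hprop⟩ := hflat (rulingPoint p).1 hp.1 (rulingPoint p).2
  have hP := isOpen_adaptedBundle hU
  set Q : Set PSpace := {q | q ∈ adaptedBundle U ∧ rulingPoint q ∈ O} with hQ
  have hsm : ContDiffOn ℝ (⊤ : ℕ∞) rulingPoint (adaptedBundle U) := fun q hq =>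
    (contDiffAt_rulingPoint hq.2.1 hq.2.2).contDiffWithinAt
  have hQo : IsOpen Q := hsm.continuousOn.isOpen_inter_preimage hP hO
  have hpQ : p ∈ Q := ⟨hp, hpO⟩
  set Φ : PSpace → Fin 3 → ℝ := fun q => τ (rulingPoint q) with hΦ
  have hΦs : ∀ q ∈ Q, ContDiffAt ℝ (⊤ : ℕ∞) Φ q := fun q hq =>
    (hτ.contDiffAt (hO.mem_nhds hq.2)).comp q (contDiffAt_rulingPoint hq.1.2.1 hq.1.2.2)
  have hΦd : ∀ q ∈ Q, ∀ Z, fderiv ℝ Φ q Z = fderiv ℝ τ (rulingPoint q) (fderiv ℝ rulingPoint q Z) := by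
    intro q hq Z
    have h1 := (hτ.contDiffAt (hO.mem_nhds hq.2)).differentiableAt (by simp)
    have h2 := (contDiffAt_rulingPoint hq.1.2.1 hq.1.2.2).differentiableAt (n := (⊤ : ℕ∞)) (by simp)
    rw [hΦ, show (fun q => τ (rulingPoint q)) = τ ∘ rulingPoint from rfl, fderiv_comp q h1 h2]
    rfl
  have hsurj : ∀ q ∈ Q, Function.Surjective (fderiv ℝ Φ q) := by
    intro q hq t
    obtain ⟨z, rfl⟩ := (hprop _ hq.2).2.1 t
    obtain ⟨Z, rfl⟩ := (fderiv_rulingPoint_surjective hq.1.2.1 hq.1.2.2).2 z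
    exact ⟨Z, hΦd q hq Z⟩
  have hker : ∀ q ∈ Q, ∀ Z, fderiv ℝ Φ q Z = 0 →
      liftedCoframe ω 0 q Z = 0 ∧ liftedCoframe ω 2 q Z = 0 := by
    intro q hq Z hZ
    rw [← mem_rulingPlane_iff hq.1.2.1 hq.1.2.2, ← (hprop _ hq.2).2.2]
    refine ⟨fderiv ℝ rulingPoint q Z, ?_, (fderiv_rulingPoint_surjective hq.1.2.1 hq.1.2.2).1 Z⟩
    rw [hΦd q hq] at hZ
    exact hZ
  have hlift : ∀ q ∈ Q, ∀ X : PSpace, liftedCoframe ω 0 q X = 0 → liftedCoframe ω 2 q X = 0 →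
      ∃ Y, fderiv ℝ Φ q Y = 0 ∧ Y.1 = X.1 := by
    intro q hq X h0 h2
    have hX := (mem_rulingPlane_iff (ω := ω) hq.1.2.1 hq.1.2.2 X).2 ⟨h0, h2⟩
    rw [← (hprop _ hq.2).2.2] at hX
    obtain ⟨z, hz, hz1⟩ := hX
    obtain ⟨Z, rfl⟩ := (fderiv_rulingPoint_surjective hq.1.2.1 hq.1.2.2).2 z
    refine ⟨Z, by rw [hΦd q hq]; exact hz, ?_⟩
    rw [← (fderiv_rulingPoint_surjective hq.1.2.1 hq.1.2.2).1 Z]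
    exact hz1
  have hdiff : ∀ i, ∀ q ∈ Q, DifferentiableAt ℝ (liftedCoframe ω i) q := fun i q hq =>
    ((contDiffOn_liftedCoframe hω i).contDiffAt (hP.mem_nhds hq.1)).differentiableAt (by simp)
  have hθ : ∀ q ∈ Q, ∀ Z, fderiv ℝ Φ q Z = 0 → F.θ₂ q Z = 0 := by
    intro q hq
    have hd := F.dual q hq.1
    obtain ⟨Y₁, k1, l1⟩ := hlift q hq (F.e 1 q) (by simpa using hd 0 1) (by simpa using hd 2 1)
    obtain ⟨Y₃, k3, l3⟩ := hlift q hq (F.e 3 q) (by simpa using hd 0 3) (by simpa using hd 2 3)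
    have hl : ∀ i (X Y : PSpace), X.1 = Y.1 → liftedCoframe ω i q X = liftedCoframe ω i q Y := by
      intro i X Y h
      simp [liftedCoframe, h]
    refine theta₂_vanishing F hq.1 (K := LinearMap.ker (fderiv ℝ Φ q).toLinearMap) k1 k3
      ((hl _ _ _ l1).trans (by simpa using hd 1 1)) ((hl _ _ _ l1).trans (by simpa using hd 3 1))
      ((hl _ _ _ l3).trans (by simpa using hd 3 3))
      (hker q hq) fun X hX Y hY => ⟨?_, ?_⟩
    · exact extd_eq_zero_of_ker ((hΦs q hq).of_le (WithTop.coe_le_coe.2 le_top)) (hsurj q hq) (hdiff 0 q hq)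
        (Filter.eventually_of_mem (hQo.mem_nhds hq) fun r hr Z hZ => (hker r hr Z hZ).1) hX hY
    · exact extd_eq_zero_of_ker ((hΦs q hq).of_le (WithTop.coe_le_coe.2 le_top)) (hsurj q hq) (hdiff 2 q hq)
        (Filter.eventually_of_mem (hQo.mem_nhds hq) fun r hr Z hZ => (hker r hr Z hZ).2) hX hY
  -- the kernel of the derivative of `Φ` is the common kernel of `ω̂⁰`, `ω̂²` and `θ²`
  have hconv : ∀ Z, liftedCoframe ω 0 p Z = 0 → liftedCoframe ω 2 p Z = 0 → F.θ₂ p Z = 0 →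
      fderiv ℝ Φ p Z = 0 := by
    have hd := F.dual p hp
    let N : PSpace →ₗ[ℝ] Fin 3 → ℝ := LinearMap.pi
      ![(liftedCoframe ω 0 p).toLinearMap, (liftedCoframe ω 2 p).toLinearMap, (F.θ₂ p).toLinearMap]
    have hN0 : ∀ Z, N Z 0 = liftedCoframe ω 0 p Z := fun Z => rfl
    have hN1 : ∀ Z, N Z 1 = liftedCoframe ω 2 p Z := fun Z => rfl
    have hN2 : ∀ Z, N Z 2 = F.θ₂ p Z := fun Z => rfl
    obtain ⟨R, hR⟩ := (fderiv ℝ Φ p).exists_rightInverse_of_surjective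
      (LinearMap.range_eq_top.2 (hsurj p hpQ))
    have hR' : ∀ t, fderiv ℝ Φ p (R t) = t := fun t => congrArg (fun T : (Fin 3 → ℝ) →L[ℝ] _ => T t) hR
    have hNR : ∀ Z, N Z = N (R (fderiv ℝ Φ p Z)) := by
      intro Z
      rw [← sub_eq_zero, ← map_sub]
      have hz : fderiv ℝ Φ p (Z - R (fderiv ℝ Φ p Z)) = 0 := by rw [map_sub, hR', sub_self]
      have h02 := hker p hpQ _ hz
      ext i
      fin_cases i
      exacts [h02.1, h02.2, hθ p hpQ _ hz]
    have hsur : Function.Surjective (N.comp R.toLinearMap) := by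
      intro t
      refine ⟨fderiv ℝ Φ p (t 0 • F.e 0 p + t 1 • F.e 2 p + t 2 • F.e 5 p), ?_⟩
      have e : N (t 0 • F.e 0 p + t 1 • F.e 2 p + t 2 • F.e 5 p) = t := by
        have d0 : ∀ j, liftedCoframe ω 0 p (F.e j p) = if 0 = j then 1 else 0 := fun j => hd 0 j
        have d2 : ∀ j, liftedCoframe ω 2 p (F.e j p) = if 2 = j then 1 else 0 := fun j => hd 2 j
        have d5 : ∀ j, F.θ₂ p (F.e j p) = if 5 = j then 1 else 0 := fun j => hd 5 j
        ext i
        fin_cases i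
        · change N _ 0 = _
          simp [hN0, d0]
        · change N _ 1 = _
          simp [hN1, d2]
        · change N _ 2 = _
          simp [hN2, d5]
      exact (hNR _).symm.trans e
    have hinj := LinearMap.injective_iff_surjective.2 hsur
    intro Z h0 h2 h5
    apply hinj
    rw [map_zero]
    refine (hNR Z).symm.trans ?_
    ext i
    fin_cases i
    exacts [h0, h2, h5]
  have hd := F.dual p hp
  have hθs : DifferentiableAt ℝ F.θ₂ p :=
    (F.smooth_θ₂.contDiffAt (hP.mem_nhds hp)).differentiableAt (by simp)
  refine extd_eq_zero_of_ker ((hΦs p hpQ).of_le (WithTop.coe_le_coe.2 le_top)) (hsurj p hpQ) hθs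
    (Filter.eventually_of_mem (hQo.mem_nhds hpQ) hθ) ?_ ?_
  · exact hconv _ (by simpa using hd 0 1) (by simpa using hd 2 1) (by simpa using hd 5 1)
  · exact hconv _ (by simpa using hd 0 3) (by simpa using hd 2 3) (by simpa using hd 5 3)

end HalfFlatness

/-! ### The Cartan connection form -/

section Components

variable {V : Type*} [NormedAddCommGroup V] [NormedSpace ℝ V] {P : Set V}

theorem contDiffOn_sum_smul {ι : Type*} [Fintype ι] {η : ι → V → V →L[ℝ] ℝ}
    (hη : ∀ i, ContDiffOn ℝ (⊤ : ℕ∞) (η i) P) (f : ι → SmoothFun P) :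
    ContDiffOn ℝ (⊤ : ℕ∞) (fun p => ∑ k, zeroExtend (f k).1 p • η k p) P :=
  ContDiffOn.sum fun k _ => (f k).2.smul (hη k)

theorem extd_sum_smul {ι : Type*} [Fintype ι] {f : ι → V → ℝ} {η : ι → V → V →L[ℝ] ℝ} {p : V}
    (hf : ∀ i, DifferentiableAt ℝ (f i) p) (hη : ∀ i, DifferentiableAt ℝ (η i) p) (X Y : V) :
    extd (fun q => ∑ k, f k q • η k q) p X Y = ∑ k, (fderiv ℝ (f k) p X * η k p Y
      - fderiv ℝ (f k) p Y * η k p X + f k p * extd (η k) p X Y) := by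
  have h : HasFDerivAt (fun q => ∑ k, f k q • η k q)
      (∑ k, (f k p • fderiv ℝ (η k) p + (fderiv ℝ (f k) p).smulRight (η k p))) p :=
    HasFDerivAt.fun_sum fun k _ => (hf k).hasFDerivAt.smul (hη k).hasFDerivAt
  rw [extd_apply h.differentiableAt, h.fderiv]
  simp only [FunLike.coe_sum, Finset.sum_apply, add_apply, smul_apply,
    ContinuousLinearMap.smulRight_apply, smul_eq_mul, ← Finset.sum_sub_distrib]
  refine Finset.sum_congr rfl fun k _ => ?_
  rw [extd_apply (hη k)]
  ring

theorem wedge_add_left (α β γ : V →L[ℝ] ℝ) (X Y : V) :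
    wedge (α + β) γ X Y = wedge α γ X Y + wedge β γ X Y := by
  simp [wedge]; ring

theorem wedge_smul_left (r : ℝ) (α γ : V →L[ℝ] ℝ) (X Y : V) :
    wedge (r • α) γ X Y = r * wedge α γ X Y := by
  simp [wedge]; ring

/-- The wedge product of two covectors as a bilinear form. -/
def wedgeBilin (α β : V →L[ℝ] ℝ) : V →ₗ[ℝ] V →ₗ[ℝ] ℝ :=
  LinearMap.mk₂ ℝ (wedge α β) (fun _ _ _ => by simp [wedge]; ring) (fun _ _ _ => by simp [wedge]; ring)
    (fun _ _ _ => by simp [wedge]; ring) (fun _ _ _ => by simp [wedge]; ring)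

/-- The exterior derivative of a 1-form as a bilinear form. -/
noncomputable def extdBilin (α : V → V →L[ℝ] ℝ) (p : V) : V →ₗ[ℝ] V →ₗ[ℝ] ℝ :=
  LinearMap.mk₂ ℝ (fun X Y => fderiv ℝ α p X Y - fderiv ℝ α p Y X) (fun _ _ _ => by simp; ring)
    (fun _ _ _ => by simp; ring) (fun _ _ _ => by simp; ring) (fun _ _ _ => by simp; ring)

theorem pathCurvature_eq (π₀ π₁ π₂ : V →L[ℝ] ℝ) (K₁ K₂ L₁ L₂ : ℝ) (X Y : V) (i j : Fin 3) :
    pathCurvature π₀ π₁ π₂ K₁ K₂ L₁ L₂ X Y i j =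
      !![0, K₁, K₂; 0, 0, 0; 0, 0, 0] i j * wedge π₀ π₁ X Y
        + !![0, 0, L₂; 0, 0, L₁; 0, 0, 0] i j * wedge π₀ π₂ X Y := by
  fin_cases i <;> fin_cases j <;> simp [pathCurvature]

end Components

section Cartan

variable {U : Set E4} {ω : Fin 4 → E4 → E4 →L[ℝ] ℝ} (F : StructureForms U ω)

/-- The coframe `(ω⁰, ω¹, ω², ω³, θ¹, θ², φ₀, φ₁)` on the bundle of adapted coframes. -/
noncomputable def StructureForms.coframe (i : Fin 8) (p : PSpace) : PSpace →L[ℝ] ℝ :=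
  (![liftedCoframe ω 0 p, liftedCoframe ω 1 p, liftedCoframe ω 2 p, liftedCoframe ω 3 p,
      F.θ₁ p, F.θ₂ p, F.φ₀ p, F.φ₁ p] : Fin 8 → PSpace →L[ℝ] ℝ) i

theorem StructureForms.contDiffOn_coframe (hω : IsCoframeOn U ω) (i : Fin 8) :
    ContDiffOn ℝ (⊤ : ℕ∞) (F.coframe i) (adaptedBundle U) := by
  fin_cases i
  exacts [contDiffOn_liftedCoframe hω 0, contDiffOn_liftedCoframe hω 1,
    contDiffOn_liftedCoframe hω 2, contDiffOn_liftedCoframe hω 3,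
    F.smooth_θ₁, F.smooth_θ₂, F.smooth_φ₀, F.smooth_φ₁]

theorem StructureForms.coframe_dual {p : PSpace} (hp : p ∈ adaptedBundle U) (i j : Fin 8) :
    F.coframe i p (F.e j p) = if i = j then 1 else 0 :=
  F.dual p hp i j

theorem finrank_PSpace : Module.finrank ℝ PSpace = Fintype.card (Fin 8) := by
  simp

/-- The calculus of the coframe on the bundle of adapted coframes. -/
noncomputable def StructureForms.frameCalculus (hU : IsOpen U) (hω : IsCoframeOn U ω) :
    FrameCalculus (Fin 8) (SmoothFun (adaptedBundle U)) :=
  CayleyGeom.frameCalculus (isOpen_adaptedBundle hU) finrank_PSpace F.coframe F.e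
    (F.contDiffOn_coframe hω) F.smooth_e F.dual

variable (hU : IsOpen U) (hω : IsCoframeOn U ω)

theorem StructureForms.T_apply (i j k : Fin 8) (p : adaptedBundle U) :
    ((F.frameCalculus hU hω).T i j k).1 p = extd (F.coframe i) p (F.e j p) (F.e k p) := rfl

theorem StructureForms.D_mk_apply (k : Fin 8) {f : PSpace → ℝ}
    (hf : ContDiffOn ℝ (⊤ : ℕ∞) f (adaptedBundle U)) (p : adaptedBundle U) :
    ((F.frameCalculus hU hω).D k (SmoothFun.mk f hf)).1 p = F.D f k p :=
  vectorFieldDerivation_mk (isOpen_adaptedBundle hU) (F.smooth_e k) hf p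

theorem StructureForms.wedge_coframe {p : PSpace} (hp : p ∈ adaptedBundle U) (a b j k : Fin 8) :
    wedge (F.coframe a p) (F.coframe b p) (F.e j p) (F.e k p) = dualWedge a b j k := by
  have h : ∀ i j, F.coframe i p (F.e j p) = if j = i then 1 else 0 := fun i j => by
    rw [StructureForms.coframe, F.dual p hp i j]
    simp only [eq_comm]
  simp only [wedge, h, dualWedge]

theorem dualWedge_apply (a b j k : Fin 8) (p : adaptedBundle U) :
    (dualWedge a b j k : SmoothFun (adaptedBundle U)).1 p = dualWedge a b j k := by
  unfold dualWedge
  split_ifs <;> simp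

/-- The calculus of a Cayley structure, with the structure equations of `dω⁰, …, dω³`. -/
noncomputable def StructureForms.cayleyCalculus : CayleyCalculus (SmoothFun (adaptedBundle U)) :=
  { F.frameCalculus hU hω with
    a₁ := SmoothFun.mk F.a₁ (F.smooth_a _ (by simp))
    a₂ := SmoothFun.mk F.a₂ (F.smooth_a _ (by simp))
    a₃ := SmoothFun.mk F.a₃ (F.smooth_a _ (by simp))
    a₄ := SmoothFun.mk F.a₄ (F.smooth_a _ (by simp))
    a₅ := SmoothFun.mk F.a₅ (F.smooth_a _ (by simp))
    a₆ := SmoothFun.mk F.a₆ (F.smooth_a _ (by simp))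
    a₇ := SmoothFun.mk F.a₇ (F.smooth_a _ (by simp))
    a₈ := SmoothFun.mk F.a₈ (F.smooth_a _ (by simp))
    T_zero := fun j k => by
      ext p
      have h : extd (F.coframe 0) p (F.e j p) (F.e k p) = _ := F.dω₀ p p.2 (F.e j p) (F.e k p)
      have w := fun a b => F.wedge_coframe p.2 a b j k
      simp [dualWedge_apply, ← w, F.T_apply hU hω]
      exact h
    T_one := fun j k => by
      ext p
      have h : extd (F.coframe 1) p (F.e j p) (F.e k p) = _ := F.dω₁ p p.2 (F.e j p) (F.e k p)
      have w := fun a b => F.wedge_coframe p.2 a b j k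
      rw [wedge_add_left, neg_add'] at h
      simp [dualWedge_apply, ← w, F.T_apply hU hω]
      exact h
    T_two := fun j k => by
      ext p
      have h : extd (F.coframe 2) p (F.e j p) (F.e k p) = _ := F.dω₂ p p.2 (F.e j p) (F.e k p)
      have w := fun a b => F.wedge_coframe p.2 a b j k
      rw [wedge_add_left, wedge_smul_left, neg_add'] at h
      simp [dualWedge_apply, ← w, F.T_apply hU hω]
      exact h
    T_three := fun j k => by
      ext p
      have h : extd (F.coframe 3) p (F.e j p) (F.e k p) = _ := F.dω₃ p p.2 (F.e j p) (F.e k p)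
      have w := fun a b => F.wedge_coframe p.2 a b j k
      rw [wedge_add_left, wedge_smul_left, neg_add'] at h
      simp [dualWedge_apply, ← w, F.T_apply hU hω]
      exact h }

include hU hω in
theorem StructureForms.a₈_eq_zero (ha₆ : ∀ p ∈ adaptedBundle U, F.a₆ p = 0)
    {p : PSpace} (hp : p ∈ adaptedBundle U) : F.a₈ p = 0 := by
  have h6 : (F.cayleyCalculus hU hω).a₆ = 0 := by
    ext q
    exact ha₆ q q.2
  exact congrArg (fun f : SmoothFun (adaptedBundle U) => f.1 ⟨p, hp⟩)
    ((F.cayleyCalculus hU hω).a₈_eq_zero h6)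

variable (ha₆ : ∀ p ∈ adaptedBundle U, F.a₆ p = 0)

/-- The calculus of a Cayley structure with `a₆ = 0`. -/
noncomputable def StructureForms.nullCalculus : NullCalculus (SmoothFun (adaptedBundle U)) :=
  let C := F.cayleyCalculus hU hω
  have h6 : C.a₆ = 0 := by
    ext q
    exact ha₆ q q.2
  { C with
    T_three := fun j k => by
      rw [C.T_three, C.a₈_eq_zero h6, h6, zero_mul, zero_mul, add_zero, add_zero] }

theorem StructureForms.T_five_13_eq_zero (hflat : IsHalfFlat U ω) :
    (F.nullCalculus hU hω ha₆).T 5 1 3 = 0 := by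
  ext p
  exact extd_theta₂_eq_zero F hU hω hflat p.2

theorem StructureForms.a₇_eq_zero (hflat : IsHalfFlat U ω) : (F.nullCalculus hU hω ha₆).a₇ = 0 := by
  ext p
  have h := congrArg (fun f : SmoothFun (adaptedBundle U) => f.1 p)
    ((F.nullCalculus hU hω ha₆).a₇_sq_eq_zero (F.T_five_13_eq_zero hU hω ha₆ hflat))
  exact pow_eq_zero_iff (n := 2) (by norm_num) |>.1 h

/-- The `𝔰𝔩₃`-valued form whose restrictions to the leaves of `{ω², ω³}` are the Cartan connection
forms of the path geometries. -/
noncomputable def StructureForms.cartanForm (i j : Fin 3) (p : PSpace) : PSpace →L[ℝ] ℝ :=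
  ∑ k, zeroExtend ((F.nullCalculus hU hω ha₆).cartanForm i j k).1 p • F.coframe k p

theorem StructureForms.cartanForm_curvature (i j : Fin 3) (k l : Fin 8) (p : adaptedBundle U) :
    extd (F.cartanForm hU hω ha₆ i j) p (F.e k p) (F.e l p)
      + ∑ m, wedge (F.cartanForm hU hω ha₆ i m p) (F.cartanForm hU hω ha₆ m j p) (F.e k p) (F.e l p)
      = ((F.nullCalculus hU hω ha₆).curvature (F.nullCalculus hU hω ha₆).cartanForm i j k l).1 p := by
  set C := F.nullCalculus hU hω ha₆ with hC
  have hP := isOpen_adaptedBundle hU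
  have hd : ∀ a b, F.coframe a p (F.e b p) = if a = b then 1 else 0 := F.dual p p.2
  have hv : ∀ i j k, F.cartanForm hU hω ha₆ i j p (F.e k p) = (C.cartanForm i j k).1 p := by
    intro i j k
    simp [StructureForms.cartanForm, hd, zeroExtend_coe, ← hC]
  have he : extd (F.cartanForm hU hω ha₆ i j) p (F.e k p) (F.e l p) = _ :=
    extd_sum_smul (fun m => smoothFun_differentiableAt hP (C.cartanForm i j m) p)
      (fun m => ((F.contDiffOn_coframe hω m).contDiffAt (hP.mem_nhds p.2)).differentiableAt (by simp)) _ _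
  rw [he]
  simp only [wedge, hv, hd, Finset.sum_add_distrib, Finset.sum_sub_distrib, mul_ite, mul_one, mul_zero,
    Finset.sum_ite_eq', Finset.mem_univ, if_true]
  simp only [FrameCalculus.curvature, Subalgebra.coe_add, Subalgebra.coe_sub, Pi.add_apply,
    Pi.sub_apply, zeroExtend_coe, Finset.sum_sub_distrib]
  simp only [AddSubmonoidClass.coe_finsetSum, Finset.sum_apply, Subalgebra.coe_mul, Pi.mul_apply]
  rfl

theorem StructureForms.K₁_eq (p : adaptedBundle U) :
    (F.nullCalculus hU hω ha₆).pathK₁.1 p = F.K₁ p := by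
  have hD : ∀ (k : Fin 8) {f : PSpace → ℝ} (hf : ContDiffOn ℝ (⊤ : ℕ∞) f (adaptedBundle U)),
    ((F.nullCalculus hU hω ha₆).D k (SmoothFun.mk f hf)).1 p = F.D f k p :=
      fun k f hf => F.D_mk_apply hU hω k hf p
  have e1 : ((F.nullCalculus hU hω ha₆).D 0 ((F.nullCalculus hU hω ha₆).T 5 0 1)).1 p
    = F.D (F.b₂ 0 1) 0 p := hD 0 _
  have e2 : ((F.nullCalculus hU hω ha₆).D 1 ((F.nullCalculus hU hω ha₆).T 7 0 1)).1 p
    = F.D (F.b₄ 0 1) 1 p := hD 1 _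
  have e3 : ((F.nullCalculus hU hω ha₆).D 0 ((F.nullCalculus hU hω ha₆).T 7 0 2)).1 p
    = F.D (F.b₄ 0 2) 0 p := hD 0 _
  have d1 : ((F.nullCalculus hU hω ha₆).D 1 (F.nullCalculus hU hω ha₆).a₄).1 p = F.D F.a₄ 1 p := hD 1 (F.smooth_a _ (by simp))
  have d2 : ((F.nullCalculus hU hω ha₆).D 2 (F.nullCalculus hU hω ha₆).a₄).1 p = F.D F.a₄ 2 p := hD 2 (F.smooth_a _ (by simp))
  have d3 : ((F.nullCalculus hU hω ha₆).D 1 (F.nullCalculus hU hω ha₆).a₅).1 p = F.D F.a₅ 1 p := hD 1 (F.smooth_a _ (by simp))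
  have d4 : ((F.nullCalculus hU hω ha₆).D 2 (F.nullCalculus hU hω ha₆).a₅).1 p = F.D F.a₅ 2 p := hD 2 (F.smooth_a _ (by simp))
  have t1 : ((F.nullCalculus hU hω ha₆).T 5 0 1).1 p = F.b₂ 0 1 p := rfl
  have t2 : ((F.nullCalculus hU hω ha₆).T 7 0 1).1 p = F.b₄ 0 1 p := rfl
  have t3 : ((F.nullCalculus hU hω ha₆).T 7 0 2).1 p = F.b₄ 0 2 p := rfl
  have a2 : (F.nullCalculus hU hω ha₆).a₂.1 p = F.a₂ p := rfl
  have a3 : (F.nullCalculus hU hω ha₆).a₃.1 p = F.a₃ p := rfl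
  have a4 : (F.nullCalculus hU hω ha₆).a₄.1 p = F.a₄ p := rfl
  have a5 : (F.nullCalculus hU hω ha₆).a₅.1 p = F.a₅ p := rfl
  have n6 : ∀ n : ℕ, [n.AtLeastTwo] → ((ofNat(n) : SmoothFun (adaptedBundle U)).1 p : ℝ) = ofNat(n) :=
    fun n _ => rfl
  simp [NullCalculus.pathK₁, StructureForms.K₁, e1, e2, e3, d1, d2, d3, d4, t1, t2, t3, a2, a3, a4, a5, n6]
  ring

/-- A skew bilinear form on the tangent space of the bundle which vanishes on the pairs of vectors
of the dual frame that are tangent to the leaves of `{ω², ω³}` vanishes on these leaves. -/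
theorem StructureForms.eq_zero_on_leaf {p : PSpace} (hp : p ∈ adaptedBundle U)
    (L : PSpace →ₗ[ℝ] PSpace →ₗ[ℝ] ℝ) (hL : ∀ X, L X X = 0)
    (h : ∀ k l : Fin 8, k ≠ 2 ∧ k ≠ 3 → l ≠ 2 ∧ l ≠ 3 → k < l → L (F.e k p) (F.e l p) = 0)
    {X Y : PSpace} (hX : X ∈ leafTangent ω p) (hY : Y ∈ leafTangent ω p) : L X Y = 0 := by
  have hc : ∀ Z ∈ leafTangent ω p, ∀ k : Fin 8, ¬ (k ≠ 2 ∧ k ≠ 3) → F.coframe k p Z = 0 := by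
    intro Z hZ k hk
    obtain rfl | rfl : k = 2 ∨ k = 3 := by tauto
    exacts [hZ.1, hZ.2]
  rw [dual_frame_expand finrank_PSpace (F.coframe_dual hp) X,
    dual_frame_expand finrank_PSpace (F.coframe_dual hp) Y]
  simp only [map_sum, map_smul, LinearMap.sum_apply, LinearMap.smul_apply, smul_eq_mul]
  refine Finset.sum_eq_zero fun l _ => ?_
  by_cases hl : l ≠ 2 ∧ l ≠ 3
  · rw [mul_eq_zero]
    right
    refine Finset.sum_eq_zero fun k _ => ?_
    by_cases hk : k ≠ 2 ∧ k ≠ 3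
    · rw [mul_eq_zero]
      right
      rcases lt_trichotomy k l with hkl | rfl | hkl
      · exact h k l hk hl hkl
      · exact hL _
      · have h2 := hL (F.e k p + F.e l p)
        simp only [map_add, LinearMap.add_apply, hL, h l k hl hk hkl, zero_add, add_zero] at h2
        exact h2
    · rw [hc X hX k hk, zero_mul]
  · rw [hc Y hY l hl, zero_mul]

include hU hω ha₆ in
/-- The Cartan connection form of the path geometries on the null surfaces, with curvature of normal
form, `K₁` as given and `L₁ = 0`. -/
theorem exists_cartanForm (hflat : IsHalfFlat U ω) :
    ∃ (ψ : Fin 3 → Fin 3 → PSpace → PSpace →L[ℝ] ℝ) (K₂ L₂ : PSpace → ℝ),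
      IsPathCartanForm (adaptedBundle U) (leafTangent ω) (liftedCoframe ω 0) (liftedCoframe ω 1)
        F.θ₂ ψ F.K₁ K₂ (fun _ => 0) L₂ := by
  set C := F.nullCalculus hU hω ha₆ with hC
  refine ⟨F.cartanForm hU hω ha₆, zeroExtend (C.curvature C.cartanForm 0 2 0 1).1,
    zeroExtend (C.curvature C.cartanForm 0 2 0 5).1, ?_, ?_, ?_, ?_⟩
  · exact fun i j => contDiffOn_sum_smul (F.contDiffOn_coframe hω) _
  · intro p hp
    have h : ∀ k, (C.cartanForm 0 0 k + C.cartanForm 1 1 k + C.cartanForm 2 2 k) = 0 := by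
      intro k
      fin_cases k <;> simp [NullCalculus.cartanForm] <;> algebra
    have h2 : ∀ k, zeroExtend (C.cartanForm 0 0 k).1 p + zeroExtend (C.cartanForm 1 1 k).1 p
        + zeroExtend (C.cartanForm 2 2 k).1 p = 0 := by
      intro k
      simp only [zeroExtend_coe _ (⟨p, hp⟩ : adaptedBundle U)]
      exact congrArg (fun f : SmoothFun (adaptedBundle U) => f.1 ⟨p, hp⟩) (h k)
    simp only [StructureForms.cartanForm, ← Finset.sum_add_distrib, ← add_smul, ← hC, h2, zero_smul,
      Finset.sum_const_zero]
  · intro p hp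
    simp only [StructureForms.cartanForm, zeroExtend_coe _ (⟨p, hp⟩ : adaptedBundle U), NullCalculus.cartanForm]
    refine ⟨?_, ?_, ?_⟩ <;> simp [Fin.sum_univ_eight, StructureForms.coframe]
  · intro p hp X hX Y hY i j
    have hd : DifferentiableAt ℝ (F.cartanForm hU hω ha₆ i j) p :=
      ((contDiffOn_sum_smul (F.contDiffOn_coframe hω) _).contDiffAt
        ((isOpen_adaptedBundle hU).mem_nhds hp)).differentiableAt (by simp)
    set q : adaptedBundle U := ⟨p, hp⟩
    let L : PSpace →ₗ[ℝ] PSpace →ₗ[ℝ] ℝ := extdBilin (F.cartanForm hU hω ha₆ i j) p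
      + ∑ k, wedgeBilin (F.cartanForm hU hω ha₆ i k p) (F.cartanForm hU hω ha₆ k j p)
      - (!![0, F.K₁ p, zeroExtend (C.curvature C.cartanForm 0 2 0 1).1 p; 0, 0, 0; 0, 0, 0] i j
          • wedgeBilin (liftedCoframe ω 0 p) (liftedCoframe ω 1 p)
        + !![0, 0, zeroExtend (C.curvature C.cartanForm 0 2 0 5).1 p; 0, 0, 0; 0, 0, 0] i j
          • wedgeBilin (liftedCoframe ω 0 p) (F.θ₂ p))
    have hL : ∀ X Y, L X Y = extd (F.cartanForm hU hω ha₆ i j) p X Y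
      + ∑ k, wedge (F.cartanForm hU hω ha₆ i k p) (F.cartanForm hU hω ha₆ k j p) X Y
      - pathCurvature (liftedCoframe ω 0 p) (liftedCoframe ω 1 p) (F.θ₂ p) (F.K₁ p)
        (zeroExtend (C.curvature C.cartanForm 0 2 0 1).1 p) 0
        (zeroExtend (C.curvature C.cartanForm 0 2 0 5).1 p) X Y i j := fun X Y => by
      rw [extd_apply hd, pathCurvature_eq]
      simp only [L, extdBilin, wedgeBilin, LinearMap.sub_apply, LinearMap.add_apply, LinearMap.sum_apply,
        LinearMap.smul_apply, LinearMap.mk₂_apply, smul_eq_mul]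
    have hself : ∀ X, L X X = 0 := by
      intro X
      simp only [L, extdBilin, wedgeBilin, LinearMap.sub_apply, LinearMap.add_apply, LinearMap.sum_apply,
        LinearMap.smul_apply, LinearMap.mk₂_apply, smul_eq_mul, wedge, sub_self, mul_zero, add_zero,
        Finset.sum_const_zero]
    have h0 := F.eq_zero_on_leaf hp L hself (fun k l hk hl hkl => ?_) hX hY
    · exact sub_eq_zero.1 ((hL X Y).symm.trans h0)
    · rw [hL, sub_eq_zero]
      have hc := F.cartanForm_curvature hU hω ha₆ i j k l q
      have hv := congrArg (fun f : SmoothFun (adaptedBundle U) => f.1 q)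
        (NullCalculus.curvature_cartanForm_of_lt (F.T_five_13_eq_zero hU hω ha₆ hflat)
          (F.a₇_eq_zero hU hω ha₆ hflat) hk hl hkl i j)
      have w1 : wedge (liftedCoframe ω 0 p) (liftedCoframe ω 1 p) (F.e k p) (F.e l p) = dualWedge 0 1 k l :=
        F.wedge_coframe hp 0 1 k l
      have w2 : wedge (liftedCoframe ω 0 p) (F.θ₂ p) (F.e k p) (F.e l p) = dualWedge 0 5 k l :=
        F.wedge_coframe hp 0 5 k l
      have z : ∀ f : SmoothFun (adaptedBundle U), zeroExtend f.1 p = f.1 q := fun f => zeroExtend_coe f.1 q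
      refine hc.trans (hv.trans ?_)
      have k1 : C.pathK₁.1 q = F.K₁ p := F.K₁_eq hU hω ha₆ q
      clear_value q
      fin_cases i <;> fin_cases j <;>
        simp [pathCurvature, w1, w2, z, dualWedge_apply, k1, ← hC]

end Cartan

/-! ### The Frobenius theorem for total differential equations -/

section Frobenius

open Metric Set
open scoped NNReal Topology

/-- The Picard-Lindelöf theorem, with the information that the solution stays in the given ball. -/
theorem exists_solution_mem_closedBall {E : Type*} [NormedAddCommGroup E] [NormedSpace ℝ E]
    [CompleteSpace E] {f : ℝ → E → E} {tmin tmax : ℝ} {t₀ : Icc tmin tmax} {x₀ : E} {a L K : ℝ≥0}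
    (hf : IsPicardLindelof f t₀ x₀ a 0 L K) :
    ∃ α : ℝ → E, α t₀ = x₀ ∧ ∀ t ∈ Icc tmin tmax,
      HasDerivWithinAt α (f t (α t)) (Icc tmin tmax) t ∧ α t ∈ closedBall x₀ a := by
  obtain ⟨α, hα⟩ := ODE.FunSpace.exists_isFixedPt_next hf (mem_closedBall_self le_rfl)
  refine ⟨α.compProj, by rw [ODE.FunSpace.compProj_val, ← hα, ODE.FunSpace.next_apply₀],
    fun t ht ↦ ⟨?_, α.compProj_mem_closedBall hf.mul_max_le⟩⟩
  apply ODE.hasDerivWithinAt_picard_Icc t₀.2 hf.continuousOn_uncurry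
    α.continuous_compProj.continuousOn (fun _ ht' ↦ α.compProj_mem_closedBall hf.mul_max_le)
    x₀ ht |>.congr_of_mem _ ht
  intro t' ht'
  nth_rw 1 [← hα]
  rw [ODE.FunSpace.compProj_of_mem ht', ODE.FunSpace.next_apply]

variable {E G : Type*} [NormedAddCommGroup E] [NormedSpace ℝ E] [NormedAddCommGroup G]
  [NormedSpace ℝ G]

/-- A differentiable solution of a smooth total differential equation is smooth. -/
theorem contDiffOn_of_total_differential {L : E × G → E →L[ℝ] G} {Ω : Set (E × G)}
    (hL : ContDiffOn ℝ (⊤ : ℕ∞) L Ω) {O : Set E} (hO : IsOpen O) {f : E → G}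
    (hf : ∀ a ∈ O, (a, f a) ∈ Ω ∧ HasFDerivAt f (L (a, f a)) a) : ContDiffOn ℝ (⊤ : ℕ∞) f O := by
  have hd : DifferentiableOn ℝ f O := fun a ha => (hf a ha).2.differentiableAt.differentiableWithinAt
  have key : ∀ n : ℕ, ContDiffOn ℝ n f O := by
    intro n
    induction n with
    | zero => exact contDiffOn_zero.2 hd.continuousOn
    | succ n ih =>
      push_cast
      rw [contDiffOn_succ_iff_fderiv_of_isOpen hO]
      refine ⟨hd, by simp, ?_⟩
      have h1 : ContDiffOn ℝ n (fun a => L (a, f a)) O :=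
        (hL.of_le (WithTop.coe_le_coe.2 le_top)).comp (contDiffOn_id.prodMk ih) fun a ha => (hf a ha).1
      exact h1.congr fun a ha => (hf a ha).2.fderiv
  exact contDiffOn_infty.2 key

/-- The Frobenius theorem: an integrable total differential equation `df = L(a, f)` has a local
solution. The value `f a` is the value at time `1` of the solution of the ordinary differential
equation along the segment from `0` to `a`. -/
theorem exists_total_differential_solution [CompleteSpace G] {L : E × G → E →L[ℝ] G}
    {Ω : Set (E × G)} (hΩ : IsOpen Ω) (hL : ContDiffOn ℝ (⊤ : ℕ∞) L Ω) {y₀ : G}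
    (h0 : ((0 : E), y₀) ∈ Ω)
    (hint : ∀ z ∈ Ω, ∀ a b, fderiv ℝ L z (a, L z a) b = fderiv ℝ L z (b, L z b) a) :
    ∃ (O : Set E) (f : E → G), IsOpen O ∧ 0 ∈ O ∧ f 0 = y₀ ∧ ContDiffOn ℝ (⊤ : ℕ∞) f O ∧
      ∀ a ∈ O, (a, f a) ∈ Ω ∧ HasFDerivAt f (L (a, f a)) a := by
  set z₀ : E × G := (0, y₀) with hz₀
  have hc : ContDiffAt ℝ (⊤ : ℕ∞) L z₀ := hL.contDiffAt (hΩ.mem_nhds h0)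
  obtain ⟨K₁, s₁, hs₁, hK₁⟩ := (hc.of_le (m := 1) (WithTop.coe_le_coe.2 le_top)).exists_lipschitzOnWith
  obtain ⟨K₂, s₂, hs₂, hK₂⟩ := (hc.fderiv_right (m := 1) (by exact WithTop.coe_le_coe.2 le_top)).exists_lipschitzOnWith
  obtain ⟨R', hR'0, hR'⟩ := Metric.mem_nhds_iff.1 (Filter.inter_mem (Filter.inter_mem hs₁ hs₂) (hΩ.mem_nhds h0))
  obtain ⟨R, hR0, rfl⟩ : ∃ R : ℝ, 0 < R ∧ R' = 3 * R := ⟨R' / 3, by positivity, by ring⟩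
  set B := ball z₀ (3 * R) with hB
  have hB1 : LipschitzOnWith K₁ L B := hK₁.mono fun z hz => (hR' hz).1.1
  have hB2 : LipschitzOnWith K₂ (fderiv ℝ L) B := hK₂.mono fun z hz => (hR' hz).1.2
  have hBΩ : B ⊆ Ω := fun z hz => (hR' hz).2
  have hz₀B : z₀ ∈ B := mem_ball_self hR'0
  have hLd : ∀ z ∈ B, DifferentiableAt ℝ L z := fun z hz =>
    (hL.contDiffAt (hΩ.mem_nhds (hBΩ hz))).differentiableAt (by simp)
  -- a bound for `L`
  obtain ⟨C, hC1, hC⟩ : ∃ C : ℝ, 1 ≤ C ∧ ∀ z ∈ B, ‖L z‖ ≤ C := by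
    refine ⟨‖L z₀‖ + K₁ * (3 * R) + 1, by
      have := norm_nonneg (L z₀)
      have : 0 ≤ (K₁ : ℝ) * (3 * R) := by positivity
      linarith, fun z hz => ?_⟩
    have h1 := hB1.norm_sub_le hz hz₀B
    have h2 : ‖z - z₀‖ ≤ 3 * R := (mem_ball_iff_norm.1 hz).le
    have h3 : (K₁ : ℝ) * ‖z - z₀‖ ≤ K₁ * (3 * R) := by gcongr
    have h4 := norm_le_norm_add_norm_sub' (L z) (L z₀)
    linarith
  have hDL : ∀ z ∈ B, ‖fderiv ℝ L z‖ ≤ K₁ := fun z hz =>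
    norm_fderiv_le_of_lipschitzOn ℝ (isOpen_ball.mem_nhds hz) hB1
  -- the second order Taylor estimate
  have hT : ∀ z ∈ B, ∀ w, z + w ∈ B → ‖L (z + w) - L z - fderiv ℝ L z w‖ ≤ K₂ * ‖w‖ ^ 2 := by
    intro z hz w hw
    have hseg : segment ℝ z (z + w) ⊆ B := (convex_ball _ _).segment_subset hz hw
    have h := Convex.norm_image_sub_le_of_norm_fderiv_le' (f := L) (s := segment ℝ z (z + w))
      (φ := fderiv ℝ L z) (C := K₂ * ‖w‖) (fun x hx => hLd x (hseg hx)) (fun x hx => ?_)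
      (convex_segment _ _) (left_mem_segment ℝ z (z + w)) (right_mem_segment ℝ z (z + w))
    · simpa [pow_two, mul_assoc] using h
    · refine (hB2.norm_sub_le (hseg hx) hz).trans ?_
      gcongr
      obtain ⟨t, ht, rfl⟩ := (segment_eq_image' ℝ z (z + w)).subset hx
      simpa [norm_smul, abs_of_nonneg ht.1] using mul_le_of_le_one_left (norm_nonneg w) ht.2
  obtain ⟨ρ, hρ0, hρR⟩ : ∃ ρ : ℝ, 0 < ρ ∧ 2 * C * ρ ≤ R :=
    ⟨R / (2 * C), by positivity, by field_simp; exact le_rfl⟩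
  have hρR2 : 2 * ρ ≤ R := by nlinarith
  have hmem : ∀ (x : E) (y : G), ‖x‖ < 3 * R → ‖y - y₀‖ < 3 * R → (x, y) ∈ B := by
    intro x y hx hy
    rw [hB, hz₀, mem_ball_iff_norm, Prod.mk_sub_mk, Prod.norm_mk, sub_zero]
    exact max_lt hx hy
  have hlip : ∀ (x : E) (c : E), ‖x‖ ≤ R → LipschitzOnWith (K₁ * ‖c‖₊) (fun y => L (x, y) c) (ball y₀ (3 * R)) := by
    intro x c hx
    refine LipschitzOnWith.of_dist_le_mul fun y hy y' hy' => ?_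
    rw [dist_eq_norm, dist_eq_norm, ← sub_apply]
    have h1 := hB1.norm_sub_le (hmem x y (by linarith) (mem_ball_iff_norm.1 hy))
      (hmem x y' (by linarith) (mem_ball_iff_norm.1 hy'))
    rw [Prod.mk_sub_mk, sub_self, Prod.norm_mk, norm_zero, max_eq_right (norm_nonneg _)] at h1
    calc ‖(L (x, y) - L (x, y')) c‖ ≤ ‖L (x, y) - L (x, y')‖ * ‖c‖ := ContinuousLinearMap.le_opNorm _ _
      _ ≤ (K₁ * ‖y - y'‖) * ‖c‖ := by gcongr
      _ = _ := by push_cast; ring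
  have hRn : (R.toNNReal : ℝ) = R := Real.coe_toNNReal _ hR0.le
  have hCn : ((C * ρ).toNNReal : ℝ) = C * ρ := Real.coe_toNNReal _ (by positivity)
  -- the solutions along the segments
  have hsol : ∀ a : E, ‖a‖ < ρ → ∃ α : ℝ → G, α 0 = y₀ ∧ ∀ t ∈ Icc (-2 : ℝ) 2,
      HasDerivWithinAt α (L (t • a, α t) a) (Icc (-2) 2) t ∧ α t ∈ closedBall y₀ R := by
    intro a ha
    have hta : ∀ t ∈ Icc (-2 : ℝ) 2, ‖t • a‖ ≤ R := by
      intro t ht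
      rw [norm_smul, Real.norm_eq_abs]
      have : |t| ≤ 2 := abs_le.2 ht
      have := norm_nonneg a
      nlinarith
    have hpl : IsPicardLindelof (fun t y => L (t • a, y) a) (⟨0, by norm_num, by norm_num⟩ : Icc (-2 : ℝ) 2)
        y₀ R.toNNReal 0 (C * ρ).toNNReal (K₁ * ‖a‖₊) := by
      refine ⟨fun t ht => (hlip _ a (hta t ht)).mono ?_, fun y hy => ?_, fun t ht y hy => ?_, ?_⟩
      · exact closedBall_subset_ball (by rw [hRn]; linarith)
      · have h1 : ContinuousOn (fun t : ℝ => L (t • a, y)) (Icc (-2) 2) := by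
          refine hB1.continuousOn.comp (by fun_prop) fun t ht => hmem _ _ ?_ ?_
          · linarith [hta t ht]
          · have := mem_closedBall_iff_norm.1 hy
            rw [hRn] at this
            linarith
        exact h1.clm_apply continuousOn_const
      · have := mem_closedBall_iff_norm.1 hy
        rw [hRn] at this
        rw [hCn]
        calc ‖L (t • a, y) a‖ ≤ ‖L (t • a, y)‖ * ‖a‖ := ContinuousLinearMap.le_opNorm _ _
          _ ≤ C * ρ := by
            gcongr
            exact hC _ (hmem _ _ (by linarith [hta t ht]) (by linarith))
      · rw [hRn, hCn]
        norm_num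
        linarith
    obtain ⟨α, h1, h2⟩ := exists_solution_mem_closedBall hpl
    rw [hRn] at h2
    exact ⟨α, h1, h2⟩
  choose! y hy0 hy using hsol
  have hyB : ∀ a, ‖a‖ < ρ → ∀ t ∈ Icc (-2 : ℝ) 2, (t • a, y a t) ∈ B := by
    intro a ha t ht
    refine hmem _ _ ?_ ?_
    · rw [norm_smul, Real.norm_eq_abs]
      have : |t| ≤ 2 := abs_le.2 ht
      have := norm_nonneg a
      nlinarith
    · have := mem_closedBall_iff_norm.1 (hy a ha t ht).2
      linarith
  have hyd : ∀ a, ‖a‖ < ρ → ∀ t ∈ Icc (0 : ℝ) 1, HasDerivAt (y a) (L (t • a, y a t) a) t := by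
    intro a ha t ht
    exact (hy a ha t ⟨by linarith [ht.1], by linarith [ht.2]⟩).1.hasDerivAt
      (Icc_mem_nhds (by linarith [ht.1]) (by linarith [ht.2]))
  have hI : ∀ t ∈ Icc (0 : ℝ) 1, t ∈ Icc (-2 : ℝ) 2 := fun t ht =>
    ⟨by linarith [ht.1], by linarith [ht.2]⟩
  set f : E → G := fun a => y a 1 with hf
  have hfB : ∀ a, ‖a‖ < ρ → (a, f a) ∈ B := by
    intro a ha
    have := hyB a ha 1 (by norm_num)
    rwa [one_smul] at this
  -- the main estimate
  set M : ℝ := K₂ * C ^ 2 * ρ + K₁ * C with hM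
  set K : ℝ≥0 := K₁ * ρ.toNNReal + 1 with hK
  have hmain : ∀ a, ‖a‖ < ρ → ∀ δ, ‖a + δ‖ < ρ → C * ‖δ‖ < R →
      ‖f (a + δ) - f a - L (a, f a) δ‖ ≤ M * ((Real.exp K - 1) / K) * ‖δ‖ ^ 2 := by
    intro a ha δ haδ hδ
    have hK0 : (K : ℝ) ≠ 0 := by rw [hK]; positivity
    set z : ℝ → E × G := fun t => (t • a, y a t) with hz
    set w : ℝ → E × G := fun t => (t • δ, t • L (z t) δ) with hw
    set v : ℝ → G := fun t => y a t + t • L (z t) δ with hv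
    have hzw : ∀ t, z t + w t = (t • (a + δ), v t) := fun t => by
      simp [hz, hw, hv]
    have hzB : ∀ t ∈ Icc (0 : ℝ) 1, z t ∈ B := fun t ht => hyB a ha t (hI t ht)
    have hLδ : ∀ t ∈ Icc (0 : ℝ) 1, ‖L (z t) δ‖ ≤ C * ‖δ‖ := fun t ht =>
      ((L (z t)).le_opNorm δ).trans (by gcongr; exact hC _ (hzB t ht))
    have htLδ : ∀ t ∈ Icc (0 : ℝ) 1, ‖t • L (z t) δ‖ ≤ C * ‖δ‖ := fun t ht => by
      rw [norm_smul, Real.norm_eq_abs, abs_of_nonneg ht.1]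
      exact (mul_le_of_le_one_left (norm_nonneg _) ht.2).trans (hLδ t ht)
    have htaδ : ∀ t ∈ Icc (0 : ℝ) 1, ‖t • (a + δ)‖ ≤ R := fun t ht => by
      rw [norm_smul, Real.norm_eq_abs, abs_of_nonneg ht.1]
      have := mul_le_of_le_one_left (norm_nonneg (a + δ)) ht.2
      linarith
    have hwn : ∀ t ∈ Icc (0 : ℝ) 1, ‖w t‖ ≤ C * ‖δ‖ := fun t ht => by
      rw [hw, Prod.norm_mk]
      refine max_le ?_ (htLδ t ht)
      rw [norm_smul, Real.norm_eq_abs, abs_of_nonneg ht.1]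
      have h1 := mul_le_of_le_one_left (norm_nonneg δ) ht.2
      have h2 := le_mul_of_one_le_left (norm_nonneg δ) hC1
      linarith
    have hvb : ∀ t ∈ Icc (0 : ℝ) 1, v t ∈ ball y₀ (3 * R) := fun t ht => by
      have h1 := mem_closedBall_iff_norm.1 (hy a ha t (hI t ht)).2
      have h2 := htLδ t ht
      have h3 := norm_add_le (y a t - y₀) (t • L (z t) δ)
      rw [mem_ball_iff_norm, hv]
      rw [show y a t + t • L (z t) δ - y₀ = y a t - y₀ + t • L (z t) δ by abel]
      linarith
    have hzwB : ∀ t ∈ Icc (0 : ℝ) 1, z t + w t ∈ B := fun t ht => by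
      rw [hzw]
      exact hmem _ _ (by linarith [htaδ t ht]) (mem_ball_iff_norm.1 (hvb t ht))
    have hvd : ∀ t ∈ Icc (0 : ℝ) 1, HasDerivAt v
        (L (z t) a + (L (z t) δ + t • fderiv ℝ L (z t) (a, L (z t) a) δ)) t := fun t ht => by
      have h1 : HasDerivAt z (a, L (z t) a) t := by
        have := ((hasDerivAt_id t).smul_const a).prodMk (hyd a ha t ht)
        simpa using this
      have h2 := ((hLd _ (hzB t ht)).hasFDerivAt.comp_hasDerivAt t h1).clm_apply (hasDerivAt_const t δ)
      have h3 := (hasDerivAt_id t).smul h2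
      refine ((hyd a ha t ht).add h3).congr_deriv ?_
      simp [hz, add_comm]
    have herr : ∀ t ∈ Icc (0 : ℝ) 1, dist
        (L (z t) a + (L (z t) δ + t • fderiv ℝ L (z t) (a, L (z t) a) δ))
        (L (t • (a + δ), v t) (a + δ)) ≤ M * ‖δ‖ ^ 2 := fun t ht => by
      -- by integrability the first variation of `L` along the segment is symmetric
      have h1 : t • fderiv ℝ L (z t) (a, L (z t) a) δ = fderiv ℝ L (z t) (w t) a := by
        rw [hint _ (hBΩ (hzB t ht)), hw, ← smul_apply, ← map_smul, Prod.smul_mk]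
      have h2 : L (z t) a + (L (z t) δ + fderiv ℝ L (z t) (w t) a) - L (z t + w t) (a + δ)
          = - ((L (z t + w t) - L (z t) - fderiv ℝ L (z t) (w t)) (a + δ))
            - fderiv ℝ L (z t) (w t) δ := by
        simp only [sub_apply, map_add]
        abel
      rw [h1, ← hzw, dist_eq_norm, h2]
      have h3 := hT _ (hzB t ht) _ (hzwB t ht)
      have h4 := (L (z t + w t) - L (z t) - fderiv ℝ L (z t) (w t)).le_opNorm (a + δ)
      have h5 := (fderiv ℝ L (z t) (w t)).le_opNorm δ
      have h6 := (fderiv ℝ L (z t)).le_opNorm (w t)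
      have h7 := hDL _ (hzB t ht)
      have h8 := hwn t ht
      calc _ ≤ ‖(L (z t + w t) - L (z t) - fderiv ℝ L (z t) (w t)) (a + δ)‖
            + ‖fderiv ℝ L (z t) (w t) δ‖ := (norm_sub_le _ _).trans (by rw [norm_neg])
        _ ≤ (K₂ * (C * ‖δ‖) ^ 2) * ρ + (K₁ * (C * ‖δ‖)) * ‖δ‖ := by
          refine add_le_add (h4.trans ?_) (h5.trans ?_)
          · refine mul_le_mul (h3.trans ?_) haδ.le (norm_nonneg _) (by positivity)
            gcongr
          · refine mul_le_mul_of_nonneg_right (h6.trans ?_) (norm_nonneg _)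
            gcongr
        _ = M * ‖δ‖ ^ 2 := by rw [hM]; ring
    have hI' : ∀ t ∈ Ico (0 : ℝ) 1, t ∈ Icc (0 : ℝ) 1 := fun t ht => ⟨ht.1, ht.2.le⟩
    have hG := dist_le_of_approx_trajectories_ODE_of_mem (a := 0) (b := 1) (K := K)
      (v := fun t x => L (t • (a + δ), x) (a + δ)) (s := fun _ => ball y₀ (3 * R))
      (f := y (a + δ)) (f' := fun t => L (t • (a + δ), y (a + δ) t) (a + δ)) (g := v)
      (g' := fun t => L (z t) a + (L (z t) δ + t • fderiv ℝ L (z t) (a, L (z t) a) δ))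
      (εf := 0) (εg := M * ‖δ‖ ^ 2) (δ := 0)
      (fun t ht => (hlip _ _ (htaδ t (hI' t ht))).weaken ?_)
      (fun t ht => (hyd _ haδ t ht).continuousAt.continuousWithinAt)
      (fun t ht => (hyd _ haδ t (hI' t ht)).hasDerivWithinAt)
      (fun t ht => by simp)
      (fun t ht => closedBall_subset_ball (by linarith) (hy _ haδ t (hI t (hI' t ht))).2)
      (fun t ht => (hvd t ht).continuousAt.continuousWithinAt)
      (fun t ht => (hvd t (hI' t ht)).hasDerivWithinAt)
      (fun t ht => herr t (hI' t ht)) (fun t ht => hvb t (hI' t ht))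
      (by simp [hv, hy0 _ ha, hy0 _ haδ]) 1 (by norm_num)
    · rw [gronwallBound_of_K_ne_0 hK0, dist_eq_norm] at hG
      simp only [hv, hz, one_smul, sub_zero, mul_one, zero_mul, zero_add] at hG
      rw [hf, sub_sub]
      refine hG.trans (le_of_eq ?_)
      ring
    · rw [hK]
      refine le_add_of_le_of_nonneg (mul_le_mul_right ?_ _) zero_le_one
      rw [← NNReal.coe_le_coe, Real.coe_toNNReal _ hρ0.le]
      exact haδ.le
  have hder : ∀ a ∈ ball (0 : E) ρ, (a, f a) ∈ Ω ∧ HasFDerivAt f (L (a, f a)) a := by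
    intro a ha
    rw [mem_ball_zero_iff] at ha
    refine ⟨hBΩ (hfB a ha), ?_⟩
    rw [hasFDerivAt_iff_isLittleO_nhds_zero]
    refine Asymptotics.IsBigO.trans_isLittleO (g := fun δ : E => ‖δ‖ ^ 2) ?_
      (Asymptotics.isLittleO_norm_pow_id one_lt_two)
    refine Asymptotics.IsBigO.of_bound (M * ((Real.exp K - 1) / K)) ?_
    have h1 : ∀ᶠ δ : E in 𝓝 0, ‖a + δ‖ < ρ :=
      (continuous_const.add continuous_id).norm.continuousAt.eventually_lt continuousAt_const (by simpa using ha)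
    have h2 : ∀ᶠ δ : E in 𝓝 0, C * ‖δ‖ < R :=
      (continuous_const.mul continuous_norm).continuousAt.eventually_lt continuousAt_const (by simpa using hR0)
    filter_upwards [h1, h2] with δ h1 h2
    simpa using hmain a ha δ h1 h2
  refine ⟨ball 0 ρ, f, isOpen_ball, mem_ball_self hρ0, ?_,
    contDiffOn_of_total_differential hL isOpen_ball hder, hder⟩
  -- the solution along the constant segment at `0` is constant
  have hconst : ∀ t ∈ Ico (0 : ℝ) 1, HasDerivWithinAt (y 0) 0 (Ici t) t := fun t ht => by
    have h := hyd 0 (by simpa using hρ0) t ⟨ht.1, ht.2.le⟩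
    simp only [map_zero] at h
    exact h.hasDerivWithinAt
  have h1 := constant_of_has_deriv_right_zero (f := y 0) (a := 0) (b := 1)
    (fun t ht => (hyd 0 (by simpa using hρ0) t ht).continuousAt.continuousWithinAt) hconst 1 (by norm_num)
  rw [hf]
  exact h1.trans (hy0 0 (by simpa using hρ0))

end Frobenius

/-! ### The null distribution -/

section Null

variable {U : Set E4} {ω : Fin 4 → E4 → E4 →L[ℝ] ℝ}

theorem IsCoframeOn.eq_zero (hω : IsCoframeOn U ω) {x : E4} (hx : x ∈ U) {X : E4}
    (h : ∀ i, ω i x X = 0) : X = 0 := by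
  have hli : LinearIndependent ℝ (fun i => (ω i x).toLinearMap : Fin 4 → Module.Dual ℝ E4) :=
    (hω.2 x hx).map' (ContinuousLinearMap.coeLM ℝ) (LinearMap.ker_eq_bot.2 ContinuousLinearMap.coe_injective)
  have hspan := hli.span_eq_top_of_card_eq_finrank' (by simp [Subspace.dual_finrank_eq])
  rw [← Module.forall_dual_apply_eq_zero_iff ℝ]
  intro φ
  obtain ⟨c, rfl⟩ := (Submodule.mem_span_range_iff_exists_fun ℝ).1
    (show φ ∈ Submodule.span ℝ (Set.range _) by rw [hspan]; trivial)
  simp [h]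

/-- The frame dual to the coframe `ω` at a point. -/
theorem IsCoframeOn.exists_dual (hω : IsCoframeOn U ω) {x : E4} (hx : x ∈ U) :
    ∃ ε : Fin 4 → E4, (∀ i j, ω i x (ε j) = if i = j then 1 else 0) ∧
      ∀ X, X = ∑ i, ω i x X • ε i := by
  let T : E4 →ₗ[ℝ] E4 := LinearMap.pi fun i => (ω i x).toLinearMap
  have hinj : Function.Injective T := by
    rw [← LinearMap.ker_eq_bot, LinearMap.ker_eq_bot']
    exact fun X hX => hω.eq_zero hx fun i => congrFun hX i
  choose ε hε using fun j : Fin 4 => LinearMap.injective_iff_surjective.1 hinj (Pi.single j 1)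
  have h : ∀ i j, ω i x (ε j) = if i = j then 1 else 0 := fun i j => by
    rw [← Pi.single_apply]
    exact congrFun (hε j) i
  refine ⟨ε, h, fun X => ?_⟩
  rw [← sub_eq_zero]
  exact hω.eq_zero hx fun i => by simp [h]

theorem extd_comp_fst {α : E4 → E4 →L[ℝ] ℝ} {p : PSpace} (h : DifferentiableAt ℝ α p.1) (X Y : PSpace) :
    extd (fun q : PSpace => (α q.1).comp (ContinuousLinearMap.fst ℝ E4 (Fin 4 → ℝ))) p X Y
      = extd α p.1 X.1 Y.1 := by
  have h1 : HasFDerivAt (fun q : PSpace => α q.1)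
      ((fderiv ℝ α p.1).comp (ContinuousLinearMap.fst ℝ E4 (Fin 4 → ℝ))) p :=
    h.hasFDerivAt.comp p hasFDerivAt_fst
  have h2 := h1.clm_comp (hasFDerivAt_const (ContinuousLinearMap.fst ℝ E4 (Fin 4 → ℝ)) p)
  rw [extd_apply h2.differentiableAt, extd_apply h, h2.fderiv]
  simp

/-- The exterior derivatives of the lifted coframe in terms of those of the coframe. -/
theorem extd_liftedCoframe (hU : IsOpen U) (hω : IsCoframeOn U ω) {p : PSpace}
    (hp : p ∈ adaptedBundle U) (i : Fin 4) (X Y : PSpace) :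
    extd (liftedCoframe ω i) p X Y =
      ∑ j, (fderiv ℝ (fun q : PSpace => (groupMatrix q.2)⁻¹ i j) p X * ω j p.1 Y.1
        - fderiv ℝ (fun q : PSpace => (groupMatrix q.2)⁻¹ i j) p Y * ω j p.1 X.1
        + (groupMatrix p.2)⁻¹ i j * extd (ω j) p.1 X.1 Y.1) := by
  have hd : ∀ j, DifferentiableAt ℝ (ω j) p.1 := fun j =>
    ((hω.1 j).contDiffAt (hU.mem_nhds hp.1)).differentiableAt (by simp)
  have hc : ∀ j, DifferentiableAt ℝ (fun q : PSpace => (groupMatrix q.2)⁻¹ i j) p := fun j =>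
    ((contDiffOn_groupMatrix_inv U i j).contDiffAt
      ((isOpen_adaptedBundle hU).mem_nhds hp)).differentiableAt (by simp)
  have h : extd (liftedCoframe ω i) p X Y = _ := extd_sum_smul hc (fun j =>
    ((hd j).comp p differentiableAt_fst).clm_comp (differentiableAt_const _)) X Y
  rw [h]
  exact Finset.sum_congr rfl fun j _ => by rw [← extd_comp_fst (hd j)]; rfl

theorem fderiv_groupMatrix_inv_eq_zero (hU : IsOpen U) {p : PSpace} (hp : p ∈ adaptedBundle U)
    {i j : Fin 4} (hij : j < i) : fderiv ℝ (fun q : PSpace => (groupMatrix q.2)⁻¹ i j) p = 0 ∧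
      (groupMatrix p.2)⁻¹ i j = 0 := by
  have h : ∀ q ∈ adaptedBundle U, (groupMatrix q.2)⁻¹ i j = 0 := fun q hq => by
    rw [groupMatrix_inv hq.2.1 hq.2.2]
    fin_cases i <;> fin_cases j <;> simp_all
  refine ⟨?_, h p hp⟩
  have h2 : (fun q : PSpace => (groupMatrix q.2)⁻¹ i j) =ᶠ[nhds p] fun _ => 0 :=
    Filter.eventually_of_mem ((isOpen_adaptedBundle hU).mem_nhds hp) h
  rw [h2.fderiv_eq]
  simp

variable (F : StructureForms U ω)

theorem liftedCoframe_eq_zero {p : PSpace} (hp : p ∈ adaptedBundle U) {Z : PSpace}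
    (hZ : Z.1 ∈ nullPlane ω p.1) : liftedCoframe ω 2 p Z = 0 ∧ liftedCoframe ω 3 p Z = 0 := by
  have h2 : ω 2 p.1 Z.1 = 0 := hZ.1
  have h3 : ω 3 p.1 Z.1 = 0 := hZ.2
  simp [liftedCoframe, Fin.sum_univ_four, groupMatrix_inv hp.2.1 hp.2.2, h2, h3]

/-- The null distribution is involutive. -/
theorem extd_eq_zero_of_mem_nullPlane (hU : IsOpen U) (hω : IsCoframeOn U ω)
    (h7 : ∀ p ∈ adaptedBundle U, F.a₇ p = 0) (h8 : ∀ p ∈ adaptedBundle U, F.a₈ p = 0)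
    {x : E4} (hx : x ∈ U) {X Y : E4} (hX : X ∈ nullPlane ω x) (hY : Y ∈ nullPlane ω x) :
    extd (ω 2) x X Y = 0 ∧ extd (ω 3) x X Y = 0 := by
  have hp : ((x, fun _ => 1) : PSpace) ∈ adaptedBundle U := ⟨hx, one_ne_zero, one_ne_zero⟩
  set p : PSpace := (x, fun _ => 1) with hp_def
  have hZ := liftedCoframe_eq_zero hp (Z := (X, 0)) hX
  have hZ' := liftedCoframe_eq_zero hp (Z := (Y, 0)) hY
  have e2 := F.dω₂ p hp (X, 0) (Y, 0)
  have e3 := F.dω₃ p hp (X, 0) (Y, 0)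
  rw [extd_liftedCoframe hU hω hp] at e2 e3
  have X2 : ω 2 x X = 0 := hX.1
  have X3 : ω 3 x X = 0 := hX.2
  have Y2 : ω 2 x Y = 0 := hY.1
  have Y3 : ω 3 x Y = 0 := hY.2
  have d20 := fderiv_groupMatrix_inv_eq_zero hU hp (show (0 : Fin 4) < 2 by decide)
  have d21 := fderiv_groupMatrix_inv_eq_zero hU hp (show (1 : Fin 4) < 2 by decide)
  have d30 := fderiv_groupMatrix_inv_eq_zero hU hp (show (0 : Fin 4) < 3 by decide)
  have d31 := fderiv_groupMatrix_inv_eq_zero hU hp (show (1 : Fin 4) < 3 by decide)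
  simp only [Fin.sum_univ_four, d20, d21, d30, d31, wedge, hZ, hZ', h7 p hp, h8 p hp] at e2 e3
  rw [groupMatrix_inv hp.2.1 hp.2.2] at e2 e3
  simp [hp_def, X2, X3, Y2, Y3] at e2 e3
  rw [e3] at e2
  exact ⟨by simpa using e2, e3⟩

/-- The coordinate `u / (f₀ f₁)` on the structure group. -/
noncomputable def slope (p : PSpace) : ℝ := p.2 2 / (p.2 0 * p.2 1)

/-- The form `θ²` on the leaves of `{ω², ω³}`, for vectors in the kernel of `ω̂⁰`. The structure
equation of `dω̂²`, evaluated on `Z` and the horizontal vector `X`, expresses it by the exterior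
derivatives of `ω²` and `ω³` on the base; `X` is chosen such that `ω̂²(X) = 0`. -/
theorem theta₂_eq (hU : IsOpen U) (hω : IsCoframeOn U ω)
    (h7 : ∀ p ∈ adaptedBundle U, F.a₇ p = 0) {p : PSpace} (hp : p ∈ adaptedBundle U) {Z : PSpace}
    (hZ : Z.1 ∈ nullPlane ω p.1) (hZ0 : liftedCoframe ω 0 p Z = 0) {X : E4}
    (hX2 : ω 2 p.1 X = slope p) (hX3 : ω 3 p.1 X = 1) :
    F.θ₂ p Z = p.2 1 * (fderiv ℝ slope p Z
      - (extd (ω 2) p.1 Z.1 X - slope p * extd (ω 3) p.1 Z.1 X)) := by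
  have h0 := hp.2.1
  have h1 := hp.2.2
  have hP := (isOpen_adaptedBundle hU).mem_nhds hp
  have Z2 : ω 2 p.1 Z.1 = 0 := hZ.1
  have Z3 : ω 3 p.1 Z.1 = 0 := hZ.2
  have hL := liftedCoframe_eq_zero hp hZ
  have i2 : ∀ q ∈ adaptedBundle U, (groupMatrix q.2)⁻¹ 2 2 = 1 / (q.2 0 * q.2 1 ^ 2) := fun q hq => by
    rw [groupMatrix_inv hq.2.1 hq.2.2]; simp
  have i3 : ∀ q ∈ adaptedBundle U, (groupMatrix q.2)⁻¹ 2 3 = - (slope q * (groupMatrix q.2)⁻¹ 2 2) :=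
    fun q hq => by
      have := hq.2.1
      have := hq.2.2
      rw [groupMatrix_inv hq.2.1 hq.2.2]
      simp [slope]
      field_simp
  have w2 : liftedCoframe ω 2 p (X, 0) = 0 := by
    simp only [liftedCoframe, Fin.sum_univ_four, groupMatrix_inv h0 h1]
    simp [hX2, hX3, slope]
    field_simp
    ring
  have w3 : liftedCoframe ω 3 p (X, 0) = 1 / (p.2 0 * p.2 1 ^ 3) := by
    simp only [liftedCoframe, Fin.sum_univ_four, groupMatrix_inv h0 h1]
    simp [hX3]
  have ds : DifferentiableAt ℝ slope p := by
    unfold slope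
    fun_prop (disch := simp [h0, h1])
  have dc : DifferentiableAt ℝ (fun q : PSpace => (groupMatrix q.2)⁻¹ 2 2) p :=
    ((contDiffOn_groupMatrix_inv U 2 2).contDiffAt hP).differentiableAt (by simp)
  have hd : fderiv ℝ (fun q : PSpace => (groupMatrix q.2)⁻¹ 2 3) p Z =
      - (slope p * fderiv ℝ (fun q : PSpace => (groupMatrix q.2)⁻¹ 2 2) p Z
        + (groupMatrix p.2)⁻¹ 2 2 * fderiv ℝ slope p Z) := by
    have h2 : (fun q : PSpace => (groupMatrix q.2)⁻¹ 2 3) =ᶠ[nhds p]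
        fun q => - (slope q * (groupMatrix q.2)⁻¹ 2 2) := Filter.eventually_of_mem hP i3
    rw [h2.fderiv_eq, fderiv_fun_neg, fderiv_fun_mul ds dc]
    simp
  have e2 := F.dω₂ p hp Z (X, 0)
  rw [extd_liftedCoframe hU hω hp] at e2
  have d20 := fderiv_groupMatrix_inv_eq_zero hU hp (show (0 : Fin 4) < 2 by decide)
  have d21 := fderiv_groupMatrix_inv_eq_zero hU hp (show (1 : Fin 4) < 2 by decide)
  simp only [Fin.sum_univ_four, d20, d21, wedge, hL, w2, w3, h7 p hp, hZ0, hd, hX2, hX3, Z2, Z3, i3 p hp,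
    i2 p hp, zero_apply] at e2
  field_simp at e2
  linear_combination e2

open scoped Topology in
/-- An integral surface of the null distribution through `x₀`. In linear coordinates `(a, y)` adapted to
the null plane at `x₀`, the null distribution is the graph of a linear map `L(a, y)`, and the
integral surface is the graph of a solution of `df = L(a, f)`. -/
theorem exists_integralSurface (hU : IsOpen U) (hω : IsCoframeOn U ω)
    (hnull : ∀ x ∈ U, ∀ X ∈ nullPlane ω x, ∀ Y ∈ nullPlane ω x,
      extd (ω 2) x X Y = 0 ∧ extd (ω 3) x X Y = 0) {x₀ : E4} (hx₀ : x₀ ∈ U) :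
    ∃ (W : Set E2) (σ : E2 → E4), IsIntegralSurface U ω W σ ∧ ∃ w ∈ W, σ w = x₀ := by
  obtain ⟨ε, hε, hexp⟩ := hω.exists_dual hx₀
  let I : E2 →L[ℝ] E4 := (ContinuousLinearMap.proj 0).smulRight (ε 0) + (ContinuousLinearMap.proj 1).smulRight (ε 1)
  let J : E2 →L[ℝ] E4 := (ContinuousLinearMap.proj 0).smulRight (ε 2) + (ContinuousLinearMap.proj 1).smulRight (ε 3)
  have hI : ∀ a, I a = a 0 • ε 0 + a 1 • ε 1 := fun a => rfl
  have hJ : ∀ a, J a = a 0 • ε 2 + a 1 • ε 3 := fun a => rfl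
  have hIJ : ∀ X : E4, ∃ a y, X = I a + J y := fun X =>
    ⟨![ω 0 x₀ X, ω 1 x₀ X], ![ω 2 x₀ X, ω 3 x₀ X], by
      conv_lhs => rw [hexp X]
      simp [hI, hJ, Fin.sum_univ_four, add_assoc]⟩
  let Θ : E4 → E4 →L[ℝ] E2 := fun x => (ω 2 x).smulRight (Pi.single 0 1) + (ω 3 x).smulRight (Pi.single 1 1)
  have hΘ0 : ∀ x X, Θ x X 0 = ω 2 x X := fun x X => by simp [Θ]
  have hΘ1 : ∀ x X, Θ x X 1 = ω 3 x X := fun x X => by simp [Θ]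
  have hΘnull : ∀ x X, X ∈ nullPlane ω x ↔ Θ x X = 0 := fun x X => by
    constructor
    · rintro ⟨h2, h3⟩
      ext i
      fin_cases i
      exacts [(hΘ0 x X).trans h2, (hΘ1 x X).trans h3]
    · exact fun h => ⟨(hΘ0 x X).symm.trans (congrFun h 0), (hΘ1 x X).symm.trans (congrFun h 1)⟩
  have hΘs : ContDiffOn ℝ (⊤ : ℕ∞) Θ U :=
    ((hω.1 2).smulRight contDiffOn_const).add ((hω.1 3).smulRight contDiffOn_const)
  let ξ : E2 × E2 → E4 := fun z => x₀ + I z.1 + J z.2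
  have hξ : ContDiff ℝ (⊤ : ℕ∞) ξ := by fun_prop
  have hξd : ∀ z, HasFDerivAt ξ (I.comp (ContinuousLinearMap.fst ℝ E2 E2)
      + J.comp (ContinuousLinearMap.snd ℝ E2 E2)) z := fun z =>
    ((I.hasFDerivAt.comp z hasFDerivAt_fst).const_add x₀).add (J.hasFDerivAt.comp z hasFDerivAt_snd)
  let M : E2 × E2 → E2 →L[ℝ] E2 := fun z => (Θ (ξ z)).comp J
  let L : E2 × E2 → E2 →L[ℝ] E2 := fun z => - (Ring.inverse (M z)).comp ((Θ (ξ z)).comp I)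
  have hξU : IsOpen (ξ ⁻¹' U) := hU.preimage hξ.continuous
  have hΘξ : ContDiffOn ℝ (⊤ : ℕ∞) (fun z => Θ (ξ z)) (ξ ⁻¹' U) :=
    hΘs.comp hξ.contDiffOn fun z hz => hz
  have hMs : ContDiffOn ℝ (⊤ : ℕ∞) M (ξ ⁻¹' U) := hΘξ.clm_comp contDiffOn_const
  let Ω : Set (E2 × E2) := ξ ⁻¹' U ∩ M ⁻¹' {A | IsUnit A}
  have hΩ : IsOpen Ω := hMs.continuousOn.isOpen_inter_preimage hξU Units.isOpen
  have hLs : ContDiffOn ℝ (⊤ : ℕ∞) L Ω := by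
    have h1 : ContDiffOn ℝ (⊤ : ℕ∞) (fun z => Ring.inverse (M z)) Ω := by
      rintro z ⟨hz, hu⟩
      obtain ⟨A, hA⟩ := hu
      have h2 := contDiffAt_ringInverse ℝ (n := (⊤ : ℕ∞)) A
      rw [hA] at h2
      exact (h2.comp z (hMs.contDiffAt (hξU.mem_nhds hz))).contDiffWithinAt
    exact (h1.clm_comp ((hΘξ.mono Set.inter_subset_left).clm_comp contDiffOn_const)).neg
  have hMinj : ∀ z ∈ Ω, ∀ y, M z y = 0 → y = 0 := by
    intro z hz y hy
    have h1 := congrArg (fun T : E2 →L[ℝ] E2 => T y) (Ring.inverse_mul_cancel _ hz.2)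
    simp only [mul_apply_eq_comp, hy, map_zero] at h1
    exact h1.symm
  have hL0 : ∀ z ∈ Ω, ∀ a, Θ (ξ z) (I a + J (L z a)) = 0 := by
    intro z hz a
    have h1 := congrArg (fun T : E2 →L[ℝ] E2 => T (Θ (ξ z) (I a))) (Ring.mul_inverse_cancel _ hz.2)
    have h2 : Θ (ξ z) (J (L z a)) = - (M z) (Ring.inverse (M z) (Θ (ξ z) (I a))) := by
      simp [L, M]
    rw [map_add, h2, ← sub_eq_add_neg, sub_eq_zero]
    exact h1.symm
  -- the null plane is the graph of `L`
  have hL : ∀ z ∈ Ω, ∀ a y, Θ (ξ z) (I a + J y) = 0 → y = L z a := by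
    intro z hz a y h
    rw [← sub_eq_zero]
    refine hMinj z hz _ ?_
    have h2 := hL0 z hz a
    simp only [map_add] at h h2
    change Θ (ξ z) (J (y - L z a)) = 0
    rw [map_sub, map_sub]
    linear_combination (exp := 1) h - h2
  have hint : ∀ z ∈ Ω, ∀ a b, fderiv ℝ L z (a, L z a) b = fderiv ℝ L z (b, L z b) a := by
    intro z hz a b
    have hz' := hΩ.mem_nhds hz
    have dL : DifferentiableAt ℝ L z := (hLs.contDiffAt hz').differentiableAt (by simp)
    have dΘ : DifferentiableAt ℝ Θ (ξ z) := (hΘs.contDiffAt (hU.mem_nhds hz.1)).differentiableAt (by simp)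
    have key : ∀ a b, fderiv ℝ Θ (ξ z) (I a + J (L z a)) (I b + J (L z b))
        + M z (fderiv ℝ L z (a, L z a) b) = 0 := by
      intro a b
      have h1 : HasFDerivAt (fun q => Θ (ξ q)) _ z := dΘ.hasFDerivAt.comp z (hξd z)
      have h2 := J.hasFDerivAt.comp z (dL.hasFDerivAt.clm_apply (hasFDerivAt_const b z))
      have h3 := h1.clm_apply (h2.const_add (I b))
      have h4 : (fun q => Θ (ξ q) (I b + (J ∘ fun q => L q b) q)) =ᶠ[𝓝 z] fun _ => 0 :=
        Filter.eventually_of_mem hz' fun q hq => hL0 q hq b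
      have h5 := congrArg (fun T : E2 × E2 →L[ℝ] E2 => T (a, L z a))
        (h3.unique ((hasFDerivAt_const (0 : E2) z).congr_of_eventuallyEq h4))
      simp only [FunLike.coe_add, Pi.add_apply, ContinuousLinearMap.comp_apply,
        ContinuousLinearMap.flip_apply, Function.comp_apply, ContinuousLinearMap.coe_fst',
        ContinuousLinearMap.coe_snd', zero_apply, map_zero, zero_add] at h5
      rw [add_comm]
      exact h5
    have hsymm : fderiv ℝ Θ (ξ z) (I a + J (L z a)) (I b + J (L z b))
        = fderiv ℝ Θ (ξ z) (I b + J (L z b)) (I a + J (L z a)) := by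
      have h2 := (hω.1 2).contDiffAt (hU.mem_nhds hz.1) |>.differentiableAt (by simp)
      have h3 := (hω.1 3).contDiffAt (hU.mem_nhds hz.1) |>.differentiableAt (by simp)
      have hn := hnull _ hz.1 _ ((hΘnull _ _).2 (hL0 z hz a)) _ ((hΘnull _ _).2 (hL0 z hz b))
      rw [extd_apply h2, extd_apply h3, sub_eq_zero, sub_eq_zero] at hn
      have h4 : ∀ X Y, fderiv ℝ Θ (ξ z) X Y =
          fderiv ℝ (ω 2) (ξ z) X Y • Pi.single 0 1 + fderiv ℝ (ω 3) (ξ z) X Y • Pi.single 1 1 := by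
        intro X Y
        have h5 : HasFDerivAt (fun x => Θ x Y) _ (ξ z) := dΘ.hasFDerivAt.clm_apply (hasFDerivAt_const Y _)
        have h6 : HasFDerivAt (fun x => Θ x Y) _ (ξ z) :=
          ((h2.hasFDerivAt.clm_apply (hasFDerivAt_const Y _)).smul_const (Pi.single 0 1 : E2)).add
          ((h3.hasFDerivAt.clm_apply (hasFDerivAt_const Y _)).smul_const (Pi.single 1 1 : E2))
        have h7 := congrArg (fun T : E4 →L[ℝ] E2 => T X) (h5.unique h6)
        simpa using h7
      rw [h4, h4, hn.1, hn.2]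
    rw [← sub_eq_zero]
    refine hMinj z hz _ ?_
    have k1 := key a b
    have k2 := key b a
    rw [hsymm] at k1
    rw [map_sub]
    linear_combination (exp := 1) k1 - k2
  have hξ0 : ξ 0 = x₀ := by simp [ξ]
  have h0 : ((0 : E2), (0 : E2)) ∈ Ω := by
    refine ⟨show ξ 0 ∈ U by rwa [hξ0], ?_⟩
    have h1 : M 0 = 1 := by
      ext y i
      change Θ (ξ 0) (J y) i = y i
      rw [hξ0]
      fin_cases i
      · exact (hΘ0 _ _).trans (by simp [hJ, hε])
      · exact (hΘ1 _ _).trans (by simp [hJ, hε])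
    change IsUnit (M 0)
    rw [h1]
    exact isUnit_one
  obtain ⟨O, f, hO, h0O, hf0, hfs, hf⟩ := exists_total_differential_solution hΩ hLs h0 hint
  refine ⟨O, fun a => ξ (a, f a), ⟨hO, hξ.comp_contDiffOn (contDiffOn_id.prodMk hfs),
    fun a ha => (hf a ha).1.1, fun a ha => ?_⟩, 0, h0O, by simp [ξ, hf0]⟩
  have hd := HasFDerivAt.comp (f := fun a => (a, f a)) a (hξd (a, f a))
    ((hasFDerivAt_id a).prodMk (hf a ha).2)
  change LinearMap.range (fderiv ℝ (ξ ∘ fun a => (a, f a)) a).toLinearMap = nullPlane ω (ξ (a, f a))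
  rw [hd.fderiv]
  ext X
  constructor
  · rintro ⟨b, rfl⟩
    exact (hΘnull _ _).2 (hL0 _ (hf a ha).1 b)
  · intro hX
    obtain ⟨b, y, rfl⟩ := hIJ X
    refine ⟨b, ?_⟩
    rw [hL _ (hf a ha).1 b y ((hΘnull _ _).1 hX)]
    simp

end Null

/-! ### Path geometries of second order equations that are cubic in the slope -/

section SmoothDual

variable {n : ℕ} {S : Set (Fin n → ℝ)} {α : Fin n → (Fin n → ℝ) → (Fin n → ℝ) →L[ℝ] ℝ}

/-- The frame dual to a smooth coframe is smooth. -/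
theorem exists_smooth_dual (hα : ∀ i, ContDiffOn ℝ (⊤ : ℕ∞) (α i) S) (hS : IsOpen S)
    (h0 : ∀ x ∈ S, ∀ X, (∀ i, α i x X = 0) → X = 0) :
    ∃ ε : Fin n → (Fin n → ℝ) → Fin n → ℝ, (∀ j, ContDiffOn ℝ (⊤ : ℕ∞) (ε j) S) ∧
      (∀ x ∈ S, ∀ i j, α i x (ε j x) = if i = j then 1 else 0) ∧
      ∀ x ∈ S, ∀ X, X = ∑ i, α i x X • ε i x := by
  let T : (Fin n → ℝ) → (Fin n → ℝ) →L[ℝ] (Fin n → ℝ) := fun x => ∑ i, (α i x).smulRight (Pi.single i 1)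
  have hT : ∀ x X i, T x X i = α i x X := fun x X i => by
    simp [T, Pi.single_apply]
  have hTs : ContDiffOn ℝ (⊤ : ℕ∞) T S := ContDiffOn.sum fun i _ => (hα i).smulRight contDiffOn_const
  have hu : ∀ x ∈ S, IsUnit (T x) := fun x hx => by
    have hinj : Function.Injective (T x).toLinearMap := by
      rw [← LinearMap.ker_eq_bot, LinearMap.ker_eq_bot']
      exact fun X hX => h0 x hx X fun i => (hT x X i).symm.trans (congrFun hX i)
    let e := (LinearEquiv.ofInjectiveEndo _ hinj).toContinuousLinearEquiv
    refine ⟨⟨T x, e.symm, ?_, ?_⟩, rfl⟩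
    · ext X : 1
      exact e.apply_symm_apply X
    · ext X : 1
      exact e.symm_apply_apply X
  have hdual : ∀ x ∈ S, ∀ i j, α i x (Ring.inverse (T x) (Pi.single j 1)) = if i = j then 1 else 0 := by
    intro x hx i j
    have h1 := congrArg (fun A : (Fin n → ℝ) →L[ℝ] (Fin n → ℝ) => A (Pi.single j 1) i)
      (Ring.mul_inverse_cancel _ (hu x hx))
    rw [← hT]
    refine h1.trans ?_
    simp [Pi.single_apply]
  refine ⟨fun j x => Ring.inverse (T x) (Pi.single j 1), fun j => ?_, hdual, fun x hx X => ?_⟩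
  · refine ContDiffOn.clm_apply (fun x hx => ?_) contDiffOn_const
    obtain ⟨A, hA⟩ := hu x hx
    have h2 := contDiffAt_ringInverse ℝ (n := (⊤ : ℕ∞)) A
    rw [hA] at h2
    exact (h2.comp x (hTs.contDiffAt (hS.mem_nhds hx))).contDiffWithinAt
  · rw [← sub_eq_zero]
    exact h0 x hx _ fun i => by simp [hdual x hx]

end SmoothDual

section Path

/-- The polynomial `b₀ + b₁ s + b₂ s² + b₃ s³` in the slope `s`, with functions `bᵢ` on the surface as
coefficients. -/
def slopeCubic (b : Fin 4 → E2 → ℝ) (q : E3) : ℝ :=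
  b 0 q.1 + b 1 q.1 * q.2 + b 2 q.1 * q.2 ^ 2 + b 3 q.1 * q.2 ^ 3

/-- The contact form `α⁰ - s α¹` of the space of directions of a surface with coframe `(α⁰, α¹)`: the
direction with coordinate `s` is the line `α⁰ = s α¹`. -/
noncomputable def contactForm (α : Fin 2 → E2 → E2 →L[ℝ] ℝ) (q : E3) : E3 →L[ℝ] ℝ :=
  (α 0 q.1 - q.2 • α 1 q.1).comp (ContinuousLinearMap.fst ℝ E2 ℝ)

/-- The form `α¹` on the space of directions. -/
noncomputable def baseForm (α : Fin 2 → E2 → E2 →L[ℝ] ℝ) (q : E3) : E3 →L[ℝ] ℝ :=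
  (α 1 q.1).comp (ContinuousLinearMap.fst ℝ E2 ℝ)

/-- The form `- (ds + B α¹)`, which defines the second order equation `ds = - B(s) α¹`. -/
noncomputable def slopeForm (α : Fin 2 → E2 → E2 →L[ℝ] ℝ) (b : Fin 4 → E2 → ℝ) (q : E3) :
    E3 →L[ℝ] ℝ :=
  - (ContinuousLinearMap.snd ℝ E2 ℝ + slopeCubic b q • baseForm α q)

variable {W : Set E2} {α : Fin 2 → E2 → E2 →L[ℝ] ℝ} {b : Fin 4 → E2 → ℝ}

/-- Every second order equation defines a path geometry, as `dη¹ ≡ - ds ∧ α¹` modulo the contact form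
`η¹`. -/
theorem isPathGeometry_of_coframe (hW : IsOpen W) (hα : ∀ i, ContDiffOn ℝ (⊤ : ℕ∞) (α i) W)
    (hb : ∀ i, ContDiffOn ℝ (⊤ : ℕ∞) (b i) W) (h0 : ∀ w ∈ W, ∀ X, (∀ i, α i w X = 0) → X = 0) :
    IsPathGeometry (W ×ˢ Set.univ)
      (fun q => LinearMap.ker (contactForm α q).toLinearMap ⊓ LinearMap.ker (slopeForm α b q).toLinearMap)
      (fun q => LinearMap.ker (baseForm α q).toLinearMap ⊓ LinearMap.ker (contactForm α q).toLinearMap) := by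
  obtain ⟨ε, -, hε, hexp⟩ := exists_smooth_dual hα hW h0
  have hO : IsOpen (W ×ˢ (Set.univ : Set ℝ)) := hW.prod isOpen_univ
  have hα' : ∀ i, ContDiffOn ℝ (⊤ : ℕ∞) (fun q : E3 => α i q.1) (W ×ˢ Set.univ) := fun i =>
    (hα i).comp contDiffOn_fst fun q hq => hq.1
  have hb' : ∀ i, ContDiffOn ℝ (⊤ : ℕ∞) (fun q : E3 => b i q.1) (W ×ˢ Set.univ) := fun i =>
    (hb i).comp contDiffOn_fst fun q hq => hq.1
  have hs : ContDiffOn ℝ (⊤ : ℕ∞) (fun q : E3 => q.2) (W ×ˢ Set.univ) := contDiffOn_snd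
  have hbase : ContDiffOn ℝ (⊤ : ℕ∞) (baseForm α) (W ×ˢ Set.univ) :=
    (hα' 1).clm_comp contDiffOn_const
  have hcubic : ContDiffOn ℝ (⊤ : ℕ∞) (slopeCubic b) (W ×ˢ Set.univ) :=
    (((hb' 0).add ((hb' 1).mul hs)).add ((hb' 2).mul (hs.pow 2))).add ((hb' 3).mul (hs.pow 3))
  refine ⟨hO, fun s hs' => ⟨W ×ˢ Set.univ, baseForm α, contactForm α, slopeForm α b, hO, hs',
    subset_rfl, hbase, ((hα' 0).sub (hs.smul (hα' 1))).clm_comp contDiffOn_const,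
    (contDiffOn_const.add (hcubic.smul hbase)).neg, fun q hq => ⟨?_, rfl, rfl, fun X Y hX hY => ?_⟩⟩⟩
  · rw [Fintype.linearIndependent_iff]
    intro c hc
    have h1 : ∀ X : E3, c 0 * α 1 q.1 X.1 + c 1 * (α 0 q.1 X.1 - q.2 * α 1 q.1 X.1)
        + c 2 * (- (X.2 + slopeCubic b q * α 1 q.1 X.1)) = 0 := fun X => by
      have := congrArg (fun T : E3 →L[ℝ] ℝ => T X) hc
      simp [Fin.sum_univ_three, baseForm, contactForm, slopeForm] at this
      linear_combination this
    have k2 := h1 (0, 1)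
    have k1 := h1 (ε 0 q.1, 0)
    have k0 := h1 (ε 1 q.1, 0)
    simp only [hε _ hq.1, map_zero] at k0 k1 k2
    norm_num at k0 k1 k2
    rw [k1, k2] at k0
    intro i
    fin_cases i
    exacts [by simpa using k0, k1, k2]
  · have hd : ∀ i, DifferentiableAt ℝ (α i) q.1 := fun i =>
      ((hα i).contDiffAt (hW.mem_nhds hq.1)).differentiableAt (by simp)
    have e : ∀ i, HasFDerivAt (fun q : E3 => α i q.1) _ q := fun i =>
      (hd i).hasFDerivAt.comp q hasFDerivAt_fst
    have h1 := HasFDerivAt.clm_comp ((e 0).sub ((hasFDerivAt_snd (𝕜 := ℝ) (p := q)).smul (e 1)))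
      (hasFDerivAt_const (ContinuousLinearMap.fst ℝ E2 ℝ) q)
    change HasFDerivAt (contactForm α) _ q at h1
    rw [extd_apply h1.differentiableAt, h1.fderiv]
    have hX' : α 0 q.1 X.1 = q.2 * α 1 q.1 X.1 := sub_eq_zero.1 (by simpa [contactForm] using hX)
    have hY' : α 0 q.1 Y.1 = q.2 * α 1 q.1 Y.1 := sub_eq_zero.1 (by simpa [contactForm] using hY)
    have line : ∀ Z : E2, α 0 q.1 Z = q.2 * α 1 q.1 Z → Z = α 1 q.1 Z • (q.2 • ε 0 q.1 + ε 1 q.1) := by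
      intro Z hZ
      conv_lhs => rw [hexp q.1 hq.1 Z]
      rw [Fin.sum_univ_two, hZ, smul_add, smul_smul, mul_comm]
    have eX := line _ hX'
    have eY := line _ hY'
    set v := q.2 • ε 0 q.1 + ε 1 q.1
    set x := α 1 q.1 X.1
    set y := α 1 q.1 Y.1
    have hx : α 1 q.1 X.1 = x := rfl
    have hy : α 1 q.1 Y.1 = y := rfl
    simp [wedge, baseForm, slopeForm, hx, hy]
    rw [eX, eY]
    simp
    ring

/-- The second order equation `ds = - B(s) α¹`, with `B` a cubic polynomial, is the equation of the
unparametrized geodesics of a connection. If `yᵃ = αᵃ(γ')`, with `y⁰ = s y¹`, the geodesic equation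
`(yᵃ)' + Gᵃ(y, y) ∈ ℝ yᵃ` with quadratic forms `G⁰, G¹` is equivalent to
`s' (y¹)² + y¹ G⁰(y, y) - y⁰ G¹(y, y) = 0`, and any cubic form in `y` can be written
as `y¹ G⁰ - y⁰ G¹`. -/
theorem arisesFromProjectiveStructure_of_coframe (hW : IsOpen W)
    (hα : ∀ i, ContDiffOn ℝ (⊤ : ℕ∞) (α i) W) (hb : ∀ i, ContDiffOn ℝ (⊤ : ℕ∞) (b i) W)
    (h0 : ∀ w ∈ W, ∀ X, (∀ i, α i w X = 0) → X = 0) :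
    ArisesFromProjectiveStructure W
      (fun q => LinearMap.ker (contactForm α q).toLinearMap ⊓ LinearMap.ker (slopeForm α b q).toLinearMap)
      (fun q => LinearMap.ker (baseForm α q).toLinearMap ⊓ LinearMap.ker (contactForm α q).toLinearMap) := by
  obtain ⟨ε, hεs, hε, hexp⟩ := exists_smooth_dual hα hW h0
  let δ : Fin 2 → E2 := fun i => Pi.single i 1
  -- the components of the connection with respect to the frame dual to `α`
  let G : Fin 2 → E2 → E2 → E2 → ℝ := ![fun w X Y => b 0 w * (α 1 w X * α 1 w Y)
      + b 1 w / 2 * (α 0 w X * α 1 w Y + α 0 w Y * α 1 w X),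
    fun w X Y => - (b 2 w / 2 * (α 0 w X * α 1 w Y + α 0 w Y * α 1 w X)
      + b 3 w * (α 0 w X * α 0 w Y))]
  let Q : Fin 2 → E2 → E2 → E2 → ℝ := fun a w X Y =>
    (fderiv ℝ (α a) w X Y + fderiv ℝ (α a) w Y X) / 2 + G a w X Y
  have hG0 : ∀ w X Y, G 0 w X Y = b 0 w * (α 1 w X * α 1 w Y)
      + b 1 w / 2 * (α 0 w X * α 1 w Y + α 0 w Y * α 1 w X) := fun _ _ _ => rfl
  have hG1 : ∀ w X Y, G 1 w X Y = - (b 2 w / 2 * (α 0 w X * α 1 w Y + α 0 w Y * α 1 w X)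
      + b 3 w * (α 0 w X * α 0 w Y)) := fun _ _ _ => rfl
  have hQs : ∀ a w X Y, Q a w X Y = Q a w Y X := by
    intro a w X Y
    fin_cases a
    · simp only [Q, Fin.zero_eta, hG0]; ring
    · simp only [Q, Fin.mk_one, hG1]; ring
  have hQ : ∀ a w X, Q a w X X = ∑ i, ∑ j, Q a w (δ i) (δ j) * X i * X j := by
    intro a w X
    have hX : X = X 0 • δ 0 + X 1 • δ 1 := by
      ext i
      fin_cases i <;> simp [δ]
    conv_lhs => rw [hX]
    simp only [Fin.sum_univ_two]
    fin_cases a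
    · simp only [Q, Fin.zero_eta, hG0, map_add, map_smul, add_apply, smul_apply, smul_eq_mul]; ring
    · simp only [Q, Fin.mk_one, hG1, map_add, map_smul, add_apply, smul_apply, smul_eq_mul]; ring
  have hQsm : ∀ a i j, ContDiffOn ℝ (⊤ : ℕ∞) (fun w => Q a w (δ i) (δ j)) W := by
    intro a i j
    have k : ∀ c i, ContDiffOn ℝ (⊤ : ℕ∞) (fun w => α c w (δ i)) W := fun c i =>
      (hα c).clm_apply contDiffOn_const
    have k2 : ∀ c i j, ContDiffOn ℝ (⊤ : ℕ∞) (fun w => fderiv ℝ (α c) w (δ i) (δ j)) W := fun c i j =>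
      (contDiffOn_fderiv_apply hW (hα c) contDiffOn_const).clm_apply contDiffOn_const
    have k3 : ContDiffOn ℝ (⊤ : ℕ∞) (fun w => G a w (δ i) (δ j)) W := by
      fin_cases a
      · exact ((hb 0).mul ((k 1 i).mul (k 1 j))).add (((hb 1).div_const 2).mul
          (((k 0 i).mul (k 1 j)).add ((k 0 j).mul (k 1 i))))
      · exact ((((hb 2).div_const 2).mul (((k 0 i).mul (k 1 j)).add ((k 0 j).mul (k 1 i)))).add
          ((hb 3).mul ((k 0 i).mul (k 0 j)))).neg
    exact (((k2 a i j).add (k2 a j i)).div_const 2).add k3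
  refine ⟨fun w k i j => ∑ a, ε a w k * Q a w (δ i) (δ j), ?_, fun w _ k i j => ?_, ?_⟩
  · refine contDiffOn_pi.2 fun k => contDiffOn_pi.2 fun i => contDiffOn_pi.2 fun j => ?_
    exact ContDiffOn.sum fun a _ => (contDiffOn_pi.1 (hεs a) k).mul (hQsm a i j)
  · simp only [hQs _ w (δ i) (δ j)]
  intro I c hI hc hcon t ht
  set γ : ℝ → E2 := fun r => (c r).1 with hγ
  set s : ℝ → ℝ := fun r => (c r).2 with hs
  have hγs : ContDiffOn ℝ (⊤ : ℕ∞) γ I := contDiff_fst.comp_contDiffOn hc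
  have hγ's : ContDiffOn ℝ (⊤ : ℕ∞) (deriv γ) I := hγs.deriv_of_isOpen hI (by simp)
  have hcd : ∀ r ∈ I, HasDerivAt c (deriv c r) r := fun r hr =>
    ((hc.contDiffAt (hI.mem_nhds hr)).differentiableAt (by simp)).hasDerivAt
  have hγd : ∀ r ∈ I, HasDerivAt γ (deriv c r).1 r := fun r hr =>
    (ContinuousLinearMap.fst ℝ E2 ℝ).hasFDerivAt.comp_hasDerivAt r (hcd r hr)
  have hsd : ∀ r ∈ I, HasDerivAt s (deriv c r).2 r := fun r hr =>
    (ContinuousLinearMap.snd ℝ E2 ℝ).hasFDerivAt.comp_hasDerivAt r (hcd r hr)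
  have hγ'd : HasDerivAt (deriv γ) (deriv (deriv γ) t) t :=
    ((hγ's.contDiffAt (hI.mem_nhds ht)).differentiableAt (by simp)).hasDerivAt
  have hγ1 : ∀ r ∈ I, (deriv c r).1 = deriv γ r := fun r hr => (hγd r hr).deriv.symm
  have hcontact : ∀ r ∈ I, α 0 (γ r) (deriv γ r) = s r * α 1 (γ r) (deriv γ r) := by
    intro r hr
    have h1 := (hcon r hr).2.1
    have h2 : deriv c r ∈ LinearMap.ker (contactForm α (c r)).toLinearMap :=
      (sup_le inf_le_left inf_le_right : _ ≤ LinearMap.ker (contactForm α (c r)).toLinearMap) h1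
    have h3 : contactForm α (c r) (deriv c r) = 0 := h2
    rw [← sub_eq_zero, ← hγ1 r hr]
    simpa [contactForm] using h3
  have hw : γ t ∈ W := (hcon t ht).1
  have hy1 : α 1 (γ t) (deriv γ t) ≠ 0 := by
    intro h
    refine (hcon t ht).2.2 ⟨?_, ?_⟩
    · change baseForm α (c t) (deriv c t) = 0
      simpa [baseForm, hγ1 t ht] using h
    · change contactForm α (c t) (deriv c t) = 0
      have := hcontact t ht
      rw [h, mul_zero] at this
      simp only [contactForm, ContinuousLinearMap.comp_apply, ContinuousLinearMap.coe_fst', sub_apply,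
        smul_apply, smul_eq_mul]
      rw [hγ1 t ht]
      change α 0 (γ t) (deriv γ t) - s t * α 1 (γ t) (deriv γ t) = 0
      rw [this, h]
      ring
  -- the derivatives of the components of the velocity
  have hyd : ∀ a, HasDerivAt (fun r => α a (γ r) (deriv γ r))
      (fderiv ℝ (α a) (γ t) (deriv γ t) (deriv γ t) + α a (γ t) (deriv (deriv γ) t)) t := by
    intro a
    have h1 : HasFDerivAt (α a) (fderiv ℝ (α a) (γ t)) (γ t) :=
      (((hα a).contDiffAt (hW.mem_nhds hw)).differentiableAt (by simp)).hasFDerivAt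
    have h2 := (h1.comp_hasDerivAt t (hγd t ht)).clm_apply hγ'd
    rw [hγ1 t ht] at h2
    exact h2
  have hrel := ((hyd 0).congr_of_eventuallyEq (Filter.eventually_of_mem (hI.mem_nhds ht)
    fun r hr => (hcontact r hr).symm)).unique ((hsd t ht).mul (hyd 1))
  have hct := hcontact t ht
  -- the covariant derivative of the velocity
  set A : E2 := deriv (deriv γ) t + ∑ a, Q a (γ t) (deriv γ t) (deriv γ t) • ε a (γ t) with hA_def
  have hA : ∀ k, deriv (deriv γ) t k + ∑ i, ∑ j, (∑ a, ε a (γ t) k * Q a (γ t) (δ i) (δ j))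
      * deriv γ t i * deriv γ t j = A k := by
    intro k
    simp only [hA_def, Pi.add_apply, Pi.smul_apply, smul_eq_mul, Fin.sum_univ_two]
    rw [hQ 0 _ (deriv γ t), hQ 1 _ (deriv γ t)]
    simp only [Fin.sum_univ_two]
    ring
  have hαA : ∀ a, α a (γ t) A = α a (γ t) (deriv (deriv γ) t)
      + (fderiv ℝ (α a) (γ t) (deriv γ t) (deriv γ t) + G a (γ t) (deriv γ t) (deriv γ t)) := by
    intro a
    have hQa : Q a (γ t) (deriv γ t) (deriv γ t)
        = fderiv ℝ (α a) (γ t) (deriv γ t) (deriv γ t) + G a (γ t) (deriv γ t) (deriv γ t) := by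
      simp only [Q]; ring
    rw [hA_def, map_add, map_sum]
    simp [hε _ hw, hQa]
  have hgeo : IsUnparamGeodesicAt (fun w k i j => ∑ a, ε a w k * Q a w (δ i) (δ j)) γ t ↔
      ∃ r : ℝ, ∀ a, α a (γ t) A = r * α a (γ t) (deriv γ t) := by
    refine exists_congr fun r => ?_
    constructor
    · intro h a
      have : A = r • deriv γ t := funext fun k => (hA k).symm.trans (h k)
      rw [this, map_smul, smul_eq_mul]
    · intro h k
      refine (hA k).trans ?_
      have : A - r • deriv γ t = 0 := h0 _ hw _ fun a => by rw [map_sub, h a, map_smul, smul_eq_mul, sub_self]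
      exact congrFun (sub_eq_zero.1 this) k
  have hmem : deriv c t ∈ LinearMap.ker (contactForm α (c t)).toLinearMap
      ⊓ LinearMap.ker (slopeForm α b (c t)).toLinearMap ↔
      (deriv c t).2 + slopeCubic b (c t) * α 1 (γ t) (deriv γ t) = 0 := by
    have k1 : contactForm α (c t) (deriv c t) = 0 := by
      change α 0 (γ t) (deriv c t).1 - s t * α 1 (γ t) (deriv c t).1 = 0
      rw [hγ1 t ht, hct, sub_self]
    have k2 : slopeForm α b (c t) (deriv c t)
        = - ((deriv c t).2 + slopeCubic b (c t) * α 1 (γ t) (deriv γ t)) := by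
      rw [← hγ1 t ht]
      simp [slopeForm, baseForm, hγ]
    rw [← neg_eq_zero, ← k2]
    exact ⟨fun h => h.2, fun h => ⟨k1, h⟩⟩
  rw [hmem, hgeo]
  have hB : slopeCubic b (c t) = b 0 (γ t) + b 1 (γ t) * s t + b 2 (γ t) * s t ^ 2 + b 3 (γ t) * s t ^ 3 := rfl
  have e0 := hαA 0
  have e1 := hαA 1
  rw [hG0, hct] at e0
  rw [hG1, hct] at e1
  rw [hB]
  constructor
  · intro h
    refine ⟨α 1 (γ t) A / α 1 (γ t) (deriv γ t), fun a => ?_⟩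
    fin_cases a
    · simp only [Fin.zero_eta, hct]
      rw [mul_left_comm, div_mul_cancel₀ _ hy1]
      linear_combination e0 - s t * e1 + hrel + α 1 (γ t) (deriv γ t) * h
    · exact (div_mul_cancel₀ _ hy1).symm
  · rintro ⟨r, h⟩
    refine mul_left_cancel₀ hy1 ?_
    have h00 := h 0
    rw [hct] at h00
    linear_combination h00 - s t * h 1 - (e0 - s t * e1 + hrel)

end Path

/-! ### The path geometry over an integral surface of the null distribution -/

section Surface

variable {U : Set E4} {ω : Fin 4 → E4 → E4 →L[ℝ] ℝ}

/-- The second component of `leafProj` is `slope`, which does not depend on the base point. -/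
theorem fderiv_leafProj {w : E2} {g : Fin 4 → ℝ} (h0 : g 0 ≠ 0) (h1 : g 1 ≠ 0) (x : E4) (X₁ : E4)
    (X : E2 × (Fin 4 → ℝ)) :
    fderiv ℝ leafProj (w, g) X = (X.1, fderiv ℝ slope (x, g) (X₁, X.2)) := by
  have hκ : DifferentiableAt ℝ (fun g : Fin 4 → ℝ => g 2 / (g 0 * g 1)) g := by
    fun_prop (disch := simp [h0, h1])
  have k1 := (hasFDerivAt_fst (𝕜 := ℝ) (p := (w, g))).prodMk
    (HasFDerivAt.comp (f := Prod.snd) (w, g) hκ.hasFDerivAt hasFDerivAt_snd)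
  have k2 := HasFDerivAt.comp (f := Prod.snd) (x, g) hκ.hasFDerivAt hasFDerivAt_snd
  change HasFDerivAt leafProj _ (w, g) at k1
  change HasFDerivAt slope _ (x, g) at k2
  rw [k1.fderiv, k2.fderiv]
  rfl

/-- The path geometry on an integral surface. By `theta₂_eq`, `θ² = f₁ (ds + B α¹)` on the kernel of
`ω̂⁰`, where `B` is the value of `dω² - s dω³` on the pair `(s ε₀ + ε₁, s ε₂ + ε₃)` up to sign, hence a
cubic polynomial in the slope `s = u / (f₀ f₁)`. -/
theorem exists_nullPathGeometry (F : StructureForms U ω) (hU : IsOpen U) (hω : IsCoframeOn U ω)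
    (h7 : ∀ p ∈ adaptedBundle U, F.a₇ p = 0) {W : Set E2} {σ : E2 → E4}
    (hσ : IsIntegralSurface U ω W σ) :
    ∃ ℓ₁ ℓ₂ : E3 → Submodule ℝ E3, IsNullPathGeometry F W σ ℓ₁ ℓ₂ ∧
      IsPathGeometry (W ×ˢ Set.univ) ℓ₁ ℓ₂ ∧ ArisesFromProjectiveStructure W ℓ₁ ℓ₂ := by
  obtain ⟨hW, hσs, hσU, hrange⟩ := hσ
  obtain ⟨ε, hεs, hε, hexp⟩ := exists_smooth_dual hω.1 hU fun x hx X h => hω.eq_zero hx h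
  have hnull : ∀ w ∈ W, ∀ X, ω 2 (σ w) (fderiv ℝ σ w X) = 0 ∧ ω 3 (σ w) (fderiv ℝ σ w X) = 0 :=
    fun w hw X => (hrange w hw).le ⟨X, rfl⟩
  -- the coframe on the surface, and the coefficients of the cubic in the slope
  let α : Fin 2 → E2 → E2 →L[ℝ] ℝ := fun i w => (ω (i.castLE (by norm_num)) (σ w)).comp (fderiv ℝ σ w)
  have hα0 : ∀ w X, α 0 w X = ω 0 (σ w) (fderiv ℝ σ w X) := fun _ _ => rfl
  have hα1 : ∀ w X, α 1 w X = ω 1 (σ w) (fderiv ℝ σ w X) := fun _ _ => rfl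
  let T : Fin 4 → Fin 4 → Fin 4 → E2 → ℝ := fun k i j w => extd (ω k) (σ w) (ε i (σ w)) (ε j (σ w))
  let b : Fin 4 → E2 → ℝ := ![fun w => - T 2 1 3 w, fun w => T 3 1 3 w - T 2 0 3 w - T 2 1 2 w,
    fun w => T 3 0 3 w + T 3 1 2 w - T 2 0 2 w, fun w => T 3 0 2 w]
  have hαs : ∀ i, ContDiffOn ℝ (⊤ : ℕ∞) (α i) W := fun i =>
    ((hω.1 _).comp hσs hσU).clm_comp (hσs.fderiv_of_isOpen hW (by simp))
  have hTs : ∀ k i j, ContDiffOn ℝ (⊤ : ℕ∞) (T k i j) W := fun k i j =>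
    (extd_contDiffOn hU (hω.1 k) (hεs i) (hεs j)).comp hσs hσU
  have hbs : ∀ i, ContDiffOn ℝ (⊤ : ℕ∞) (b i) W := by
    intro i
    fin_cases i
    exacts [(hTs 2 1 3).neg, ((hTs 3 1 3).sub (hTs 2 0 3)).sub (hTs 2 1 2),
      ((hTs 3 0 3).add (hTs 3 1 2)).sub (hTs 2 0 2), hTs 3 0 2]
  have hsep : ∀ w ∈ W, ∀ X, (∀ i, α i w X = 0) → X = 0 := by
    intro w hw
    let L : E2 →ₗ[ℝ] E2 := LinearMap.pi fun i => (α i w).toLinearMap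
    have hsurj : Function.Surjective L := by
      intro y
      have hmem : y 0 • ε 0 (σ w) + y 1 • ε 1 (σ w) ∈ nullPlane ω (σ w) := by
        constructor
        · change ω 2 (σ w) _ = 0
          simp [hε _ (hσU hw)]
        · change ω 3 (σ w) _ = 0
          simp [hε _ (hσU hw)]
      rw [← hrange w hw] at hmem
      obtain ⟨X, hX⟩ := hmem
      have hX' : fderiv ℝ σ w X = y 0 • ε 0 (σ w) + y 1 • ε 1 (σ w) := hX
      refine ⟨X, funext fun i => ?_⟩
      fin_cases i
      · refine (hα0 w X).trans ?_
        rw [hX']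
        simp [hε _ (hσU hw)]
      · refine (hα1 w X).trans ?_
        rw [hX']
        simp [hε _ (hσU hw)]
    intro X hX
    exact LinearMap.injective_iff_surjective.2 hsurj (by rw [map_zero]; exact funext hX)
  refine ⟨_, _, ?_, isPathGeometry_of_coframe hW hαs hbs hsep,
    arisesFromProjectiveStructure_of_coframe hW hαs hbs hsep⟩
  intro w hw g h0 h1 X
  dsimp only
  have hx := hσU hw
  set Z : PSpace := (fderiv ℝ σ w X.1, X.2) with hZ
  have hp : ((σ w, g) : PSpace) ∈ adaptedBundle U := ⟨hx, h0, h1⟩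
  obtain ⟨n2, n3⟩ := hnull w hw X.1
  have w0 : liftedCoframe ω 0 (σ w, g) Z = 1 / g 0 * (α 0 w X.1 - g 2 / (g 0 * g 1) * α 1 w X.1) := by
    simp only [liftedCoframe, Fin.sum_univ_four, groupMatrix_inv h0 h1, hα0, hα1]
    simp [hZ, n2, n3]
    field_simp
    ring
  have w1 : liftedCoframe ω 1 (σ w, g) Z = 1 / (g 0 * g 1) * α 1 w X.1 := by
    simp only [liftedCoframe, Fin.sum_univ_four, groupMatrix_inv h0 h1, hα1]
    simp [hZ, n2, n3]
  have hproj := fderiv_leafProj h0 h1 (w := w) (σ w) (fderiv ℝ σ w X.1) X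
  have hcontact : contactForm α (leafProj (w, g)) (fderiv ℝ leafProj (w, g) X) = 0 ↔
      liftedCoframe ω 0 (σ w, g) Z = 0 := by
    rw [w0, hproj, mul_eq_zero, or_iff_right (one_div_ne_zero h0)]
    rfl
  have hbase : baseForm α (leafProj (w, g)) (fderiv ℝ leafProj (w, g) X) = 0 ↔
      liftedCoframe ω 1 (σ w, g) Z = 0 := by
    rw [w1, hproj, mul_eq_zero, or_iff_right (one_div_ne_zero (mul_ne_zero h0 h1))]
    rfl
  have hslope : liftedCoframe ω 0 (σ w, g) Z = 0 →
      (slopeForm α b (leafProj (w, g)) (fderiv ℝ leafProj (w, g) X) = 0 ↔ F.θ₂ (σ w, g) Z = 0) := by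
    intro hZ0
    set s : ℝ := g 2 / (g 0 * g 1) with hs
    have hy0 : ω 0 (σ w) Z.1 = s * α 1 w X.1 := by
      rw [w0, mul_eq_zero, or_iff_right (one_div_ne_zero h0)] at hZ0
      exact sub_eq_zero.1 hZ0
    have hZ1 : Z.1 = α 1 w X.1 • (s • ε 0 (σ w) + ε 1 (σ w)) := by
      rw [hexp _ hx Z.1, Fin.sum_univ_four, hy0, show ω 1 (σ w) Z.1 = α 1 w X.1 from rfl,
        show ω 2 (σ w) Z.1 = 0 from n2, show ω 3 (σ w) Z.1 = 0 from n3]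
      simp [mul_smul, smul_add, smul_comm s]
    have hθ := theta₂_eq F hU hω h7 hp (Z := Z) ⟨n2, n3⟩ hZ0 (X := s • ε 2 (σ w) + ε 3 (σ w))
      (by simp [hε _ hx, slope, hs]) (by simp [hε _ hx])
    have hd : ∀ k, DifferentiableAt ℝ (ω k) (σ w) := fun k =>
      ((hω.1 k).contDiffAt (hU.mem_nhds hx)).differentiableAt (by simp)
    have hbil : ∀ k, extd (ω k) (σ w) Z.1 (s • ε 2 (σ w) + ε 3 (σ w)) =
        α 1 w X.1 * (s ^ 2 * T k 0 2 w + s * (T k 0 3 w + T k 1 2 w) + T k 1 3 w) := by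
      intro k
      simp only [T, extd_apply (hd k), hZ1, map_add, map_smul, add_apply, smul_apply, smul_eq_mul]
      ring
    have hκ : slopeForm α b (leafProj (w, g)) (fderiv ℝ leafProj (w, g) X) =
        - (fderiv ℝ slope (σ w, g) Z + (- T 2 1 3 w + (T 3 1 3 w - T 2 0 3 w - T 2 1 2 w) * s
          + (T 3 0 3 w + T 3 1 2 w - T 2 0 2 w) * s ^ 2 + T 3 0 2 w * s ^ 3) * α 1 w X.1) := by
      rw [hproj]
      rfl
    have hfin : F.θ₂ (σ w, g) Z
        = - g 1 * slopeForm α b (leafProj (w, g)) (fderiv ℝ leafProj (w, g) X) := by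
      rw [hκ, hθ, hbil, hbil, show slope (σ w, g) = s from rfl]
      ring
    rw [hfin, mul_eq_zero, or_iff_right (neg_ne_zero.2 h1)]
  refine ⟨?_, ?_, ?_⟩
  · constructor
    · intro h
      have k0 := hcontact.1 (by rw [h, map_zero])
      exact ⟨k0, hbase.1 (by rw [h, map_zero]), (hslope k0).1 (by rw [h, map_zero])⟩
    · rintro ⟨k0, k1, k2⟩
      have e1 := hbase.2 k1
      have e2 := (hslope k0).2 k2
      have e0 := hcontact.2 k0
      simp only [slopeForm, neg_apply, add_apply, smul_apply, e1, smul_zero, add_zero, neg_eq_zero] at e2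
      refine Prod.ext (hsep w hw _ fun i => ?_) e2
      have e1' : α 1 w (fderiv ℝ leafProj (w, g) X).1 = 0 := e1
      have e0' : α 0 w (fderiv ℝ leafProj (w, g) X).1
        - g 2 / (g 0 * g 1) * α 1 w (fderiv ℝ leafProj (w, g) X).1 = 0 := e0
      rw [e1', mul_zero, sub_zero] at e0'
      fin_cases i
      exacts [e0', e1']
  · constructor
    · rintro ⟨k0, k2⟩
      have k0' := hcontact.1 k0
      exact ⟨k0', (hslope k0').1 k2⟩
    · exact fun ⟨k0, k2⟩ => ⟨hcontact.2 k0, (hslope k0).2 k2⟩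
  · constructor
    · exact fun ⟨k1, k0⟩ => ⟨hcontact.1 k0, hbase.1 k1⟩
    · exact fun ⟨k0, k1⟩ => ⟨hbase.2 k1, hcontact.2 k0⟩

end Surface
end CayleyGeom

theorem proposition5p3 (U : Set E4) (hU : IsOpen U) (ω : Fin 4 → E4 → E4 →L[ℝ] ℝ)
    (hω : IsCoframeOn U ω) (hflat : IsHalfFlat U ω) (F : StructureForms U ω)
    (ha₆ : ∀ p ∈ adaptedBundle U, F.a₆ p = 0) :
    -- the distribution is null and integrable
    (∀ x ∈ U, ∀ X ∈ nullPlane ω x, cayleyCubic ω x X = 0) ∧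
    (∀ x ∈ U, ∃ (W : Set E2) (σ : E2 → E4), IsIntegralSurface U ω W σ ∧ ∃ w ∈ W, σ w = x) ∧
    -- the path geometry over each integral surface arises from a projective structure on it
    (∀ (W : Set E2) (σ : E2 → E4), IsIntegralSurface U ω W σ →
      ∃ ℓ₁ ℓ₂ : E3 → Submodule ℝ E3, IsNullPathGeometry F W σ ℓ₁ ℓ₂ ∧
        IsPathGeometry (W ×ˢ Set.univ) ℓ₁ ℓ₂ ∧ ArisesFromProjectiveStructure W ℓ₁ ℓ₂) ∧
    -- its curvature
    (∃ (ψ : Fin 3 → Fin 3 → PSpace → PSpace →L[ℝ] ℝ) (K₂ L₂ : PSpace → ℝ),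
      IsPathCartanForm (adaptedBundle U) (leafTangent ω) (liftedCoframe ω 0) (liftedCoframe ω 1)
        F.θ₂ ψ F.K₁ K₂ (fun _ => 0) L₂) := by
  have h7 : ∀ p ∈ adaptedBundle U, F.a₇ p = 0 := fun p hp =>
    congrArg (fun f : SmoothFun (adaptedBundle U) => f.1 ⟨p, hp⟩) (F.a₇_eq_zero hU hω ha₆ hflat)
  have h8 : ∀ p ∈ adaptedBundle U, F.a₈ p = 0 := fun p hp => F.a₈_eq_zero hU hω ha₆ hp
  refine ⟨fun x _ X hX => ?_, fun x hx => ?_, fun W σ hσ => ?_, exists_cartanForm F hU hω ha₆ hflat⟩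
  · have h2 : ω 2 x X = 0 := hX.1
    have h3 : ω 3 x X = 0 := hX.2
    simp [cayleyCubic, h2, h3]
  · exact exists_integralSurface hU hω
      (fun x hx X hX Y hY => extd_eq_zero_of_mem_nullPlane F hU hω h7 h8 hx hX hY) hx
  · exact exists_nullPathGeometry F hU hω h7 hσ
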